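/- **Setting.** Let $\varepsilon>0$ and let $f=f(w,v)\in C^3(\mathbb R^2)$ with $\|D^3_{wwv}f\|_{L^\infty}<\infty$. Let $\bar w,\bar v:\mathbb R\to\mathbb Z\varepsilon$ be right continuous, piecewise constant with finitely many jumps and compactly supported, and assume $\partial_wf(w,v)>-1$ for all $w$ in the convex hull of the range of $\bar w$ and all $v$ in the range of $\bar v$. For a function $g$, $g_\varepsilon$ is its piecewise affine interpolation on the grid $\mathbb Z\varepsilon$, and $\mathrm{conv}_{I}$, $\mathrm{conc}_I$ are the convex and concave envelopes on an interval $I$. *Waves.* Let $W(x)=\mathrm{Tot.Var.}(\bar w;(-\infty,x])$. The waves are $s\in\mathcal W=\{1,\dots,\mathrm{Tot.Var.}(\bar w)/\varepsilon\}$; the wave $s$ has initial position $\mathtt x(0,s)=\inf\{x:\varepsilon s\le W(x)\}$, sign $\mathcal S(s)=\mathrm{sign}[\bar w(\mathtt x(0,s))-\bar w(\mathtt x(0,s)-)]$, right state $\hat w(s)=\bar w(\mathtt x(0,s)-)+\mathcal S(s)[\varepsilon s-W(\mathtt x(0,s)-)]$, and segment $(\hat w(s)-\varepsilon,\hat w(s)]$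 if it is positive, $[\hat w(s),\hat w(s)+\varepsilon)$ if it is negative. For a set $\mathcal A$ of waves of the same sign whose segments fill an interval $I$, let $|\mathcal A|=\varepsilon\,\mathrm{card}\,\mathcal A$, $\sigma^{\mathrm{rh}}(g,\mathcal A)=\frac{g(\sup I)-g(\inf I)}{\sup I-\inf I}$, and let $\sigma^{\mathrm{ent}}(g,\mathcal A,s)$ be the slope of $\mathrm{conv}_Ig_\varepsilon$ (of $\mathrm{conc}_Ig_\varepsilon$ for negative waves) on the segment of $s$; the Riemann problem $\mathcal A$ with flux $g$ divides $s,s'$ if $\sigma^{\mathrm{ent}}(g,\mathcal A,s)\ne\sigma^{\mathrm{ent}}(g,\mathcal A,s')$. We write $\mathcal A<\mathcal B$ if $a<b$ for all $a\in\mathcal A$, $b\in\mathcal B$, and $\mathcal A\le\mathcal B$ if $\mathcal A<\mathcal B$ or $\mathcal A=\mathcal B$. *The wavefront solution.* The $\varepsilon$-wavefront solution of $w_t+\partial_wf(w,v)w_x=0$, $v_t-v_x=0$ with data $(\bar w,\bar v)$ is as follows. We have $v(t,x)=\bar v(x+t)$; its fronts (first family) are the lines $x=\xi-t$, $\xi$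 a jump point of $\bar v$, with strength $|\bar v(\xi)-\bar v(\xi-)|$. Let $\mathcal W(t)$ be the set of waves not canceled at time $t$ and $\mathcal W(t,x)$ the set of those with position $\mathtt x(t,s)=x$; then $w(t,x)=\sum_{s\in\mathcal W(t),\,\mathtt x(t,s)\le x}\varepsilon\mathcal S(s)$. From $t_0=0$, and from each collision time, every wave moves with the constant speed $\sigma(t_j,s)=\sigma^{\mathrm{ent}}\big(f(\cdot,v(t_j,\mathtt x(t_j,s))),\mathcal W(t_j,\mathtt x(t_j,s)),s\big)$ until the next collision time $t_{j+1}$, the first time after $t_j$ at which two or more wavefronts meet (a wavefront of the second family is the group of all waves with the same position and speed). At $t_{j+1}$, of the waves arriving at the collision point $x_{j+1}$, those survive for which $\mathcal S(s)w(t_{j+1},x_{j+1}-)\le\mathcal S(s)\hat w(s)-\varepsilon$ and $\mathcal S(s)\hat w(s)\le\mathcal S(s)w(t_{j+1},x_{j+1})$, while the others are canceled. The collision is transversal if one of the two colliding fronts is of the first family. *Effective flux.* On each maximal interval $\mathcal M$ of waves of $\mathcal W(t_j)$ of the same sign, $\mathtt f^{\mathrm{eff}}_{t_j}$ is any $C^{1,1}$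 function, on the closed interval spanned by the segments of $\mathcal M$, with $\frac{d^2}{dw^2}\mathtt f^{\mathrm{eff}}_{t_j}(w)=\frac{\partial^2f}{\partial w^2}(w,v(t_j,\mathtt x(t_j,r)))$ for a.e. $w$ in the segment of each $r\in\mathcal M$. It is unique up to affine functions. *Partitions.* Two waves $s<s'$ of $\mathcal W(t_j)$ have already interacted at time $t_j$ if $\mathtt x(t,s)=\mathtt x(t,s')$ for some $t\le t_j$; then they are divided in the real solution at time $t_j$ if $(\mathtt x(t_j,s),\sigma(t_j,s))\ne(\mathtt x(t_j,s'),\sigma(t_j,s'))$, and joined otherwise. Suppose they have already interacted and are divided at $t_j$. Let $\mathtt T=\max\{t\le t_j:\mathtt x(t,s)=\mathtt x(t,s')\}$ and $\mathcal I(t_j,s,s')=\mathcal W(\mathtt T,\mathtt x(\mathtt T,s))\cap\mathcal W(t_j)$. The partition $\mathcal P(t_j,s,s')$ of $\mathcal I(t_j,s,s')$ is defined recursively. If $t_j=\mathtt T$, two waves are equivalent iff they are joined in the real solution at $t_j$. If $t_j>\mathtt T$, two waves are equivalent iff they belong to the same $\mathcal K\in\mathcal P(t_{j-1},s,s')$ and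 the Riemann problem $\mathcal K\cap\mathcal W(t_j)$ with flux $\mathtt f^{\mathrm{eff}}_{t_j}$ does not divide them. *Weights.* For $p<p'$ in $\mathcal I(t_j,s,s')$, set $\pi(t_j,s,s')[p,p']=0$ if $j=0$ or $s,s'$ are joined at $t_{j-1}$. If they are divided at $t_{j-1}$, set $\pi(t_j,s,s')[p,p']=\pi(t_{j-1},s,s')[p,p']$ if the collision at $t_j$ is not transversal, and $$\pi(t_j,s,s')[p,p']=\pi(t_{j-1},s,s')[p,p']+2\|D^3_{wwv}f\|_{L^\infty}\,|v_{h(j)}|\sum_{\mathcal K}|\mathcal K|$$ if it is transversal, where $|v_{h(j)}|$ is the strength of the first-family front colliding at $t_j$, and the sum is over the $\mathcal K\in\mathcal P(t_{j-1},s,s')$ with $\mathcal K\subseteq\mathcal W(t_j,x_j)$ and $\mathcal K_p\le\mathcal K\le\mathcal K_{p'}$; here $\mathcal K_p,\mathcal K_{p'}$ are the elements of $\mathcal P(t_{j-1},s,s')$ containing $p,p'$. **Lemma.** Let $j\ge0$ be such that the collision times $t_1<\dots<t_j$ exist and at each $t_i$, $1\le i\le j$, exactly two wavefronts meet, at a single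 point $x_i$. Let $s<s'$ be two positive waves of $\mathcal W(t_j)$ which have already interacted at time $t_j$ and are divided in the real solution at time $t_j$. Let $\mathcal J,\mathcal J'\in\mathcal P(t_j,s,s')$ with $\mathcal J<\mathcal J'$, and let $p\in\mathcal J$, $p'\in\mathcal J'$. Then, for every effective flux $\mathtt f^{\mathrm{eff}}_{t_j}$ on the maximal homogeneous interval of waves containing $s$ and $s'$, $$\sigma^{\mathrm{rh}}(\mathtt f^{\mathrm{eff}}_{t_j},\mathcal J)-\sigma^{\mathrm{rh}}(\mathtt f^{\mathrm{eff}}_{t_j},\mathcal J')\le\pi(t_j,s,s')[p,p'].$$ -/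

import Mathlib

noncomputable section

open Set MeasureTheory
open scoped Classical

/-! ### Convex envelopes, interpolation, Rankine-Hugoniot speed -/

/-- The convex envelope of `g` on `[a, b]`, evaluated at `u`: the supremum of the convex functions
on `[a, b]` lying below `g`. -/
def convEnv (g : ℝ → ℝ) (a b u : ℝ) : ℝ :=
  sSup {y | ∃ h : ℝ → ℝ, ConvexOn ℝ (Icc a b) h ∧ (∀ x ∈ Icc a b, h x ≤ g x) ∧ y = h u}

/-- The concave envelope of `g` on `[a, b]`, evaluated at `u`. -/
def concEnv (g : ℝ → ℝ) (a b u : ℝ) : ℝ :=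
  sInf {y | ∃ h : ℝ → ℝ, ConcaveOn ℝ (Icc a b) h ∧ (∀ x ∈ Icc a b, g x ≤ h x) ∧ y = h u}

/-- The piecewise affine interpolation of `g` with grid size `ε`. -/
def interp (ε : ℝ) (g : ℝ → ℝ) (u : ℝ) : ℝ :=
  g (⌊u / ε⌋ * ε) + (u - ⌊u / ε⌋ * ε) / ε * (g ((⌊u / ε⌋ + 1) * ε) - g (⌊u / ε⌋ * ε))

/-- The Rankine-Hugoniot speed given to the (bounded) real interval `I` by the function `g`. -/
def rhSpeed (g : ℝ → ℝ) (I : Set ℝ) : ℝ :=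
  (g (sSup I) - g (sInf I)) / (sSup I - sInf I)

/-- Discretized initial datum: takes values in `ℤ ε`, is piecewise constant with finitely many
jumps and right continuous (it is constant on `[x, y]` as soon as `(x, y]` contains no point of a
suitable finite set), and has compact support. -/
structure IsGridDatum (ε : ℝ) (w : ℝ → ℝ) : Prop where
  grid : ∀ x, ∃ m : ℤ, w x = m * ε
  piecewiseConst : ∃ S : Finset ℝ, ∀ x y, x ≤ y → (∀ z ∈ S, z ∉ Ioc x y) → w x = w y
  compactSupport : HasCompactSupport w

/-- A set `A` of waves lies to the left of a set `B` of waves. -/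
def WavesLT (A B : Finset ℕ) : Prop := ∀ a ∈ A, ∀ b ∈ B, a < b

/-- The non-strict order on sets of waves: equal, or to the left. -/
def WavesLE (A B : Finset ℕ) : Prop := WavesLT A B ∨ A = B

/-! ### The wavefront solution and its waves -/

/-- The data of the problem `w_t + ∂_w f(w, v) w_x = 0`, `v_t - v_x = 0`: the function `f`, the
discretization parameter `ε`, the discretized initial data `w0`, `v0`. -/
structure WaveData where
  f : ℝ → ℝ → ℝ
  ε : ℝ
  w0 : ℝ → ℝ
  v0 : ℝ → ℝ

/-- The state of the solution at one of the times `t_j`: the time, the set `W(t_j)` of waves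
which are not canceled (a canceled wave is one with position `+∞`), the position of each of them
(the value of `pos` at a canceled wave is irrelevant). -/
structure WaveState where
  time : ℝ
  alive : Finset ℕ
  pos : ℕ → ℝ

namespace WaveData

/-- `∂²f/∂w²`. -/
def dww (D : WaveData) (w v : ℝ) : ℝ := iteratedDeriv 2 (fun x => D.f x v) w

/-- `∂³f/∂w²∂v`. -/
def dwwv (D : WaveData) (w v : ℝ) : ℝ := deriv (fun y => D.dww w y) v

/-- The sup norm of `∂³f/∂w²∂v`. -/
def normDwwv (D : WaveData) : ℝ := ⨆ z : ℝ × ℝ, |D.dwwv z.1 z.2|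

/-- Total variation of `w0` on `(-∞, x]`. -/
def tv (D : WaveData) (x : ℝ) : ℝ := (eVariationOn D.w0 (Iic x)).toReal

/-- The set of waves `{1, …, Tot.Var.(w0) / ε}`. -/
def waves (D : WaveData) : Finset ℕ :=
  Finset.Icc 1 ⌊(eVariationOn D.w0 univ).toReal / D.ε⌋₊

/-- Initial position of the wave `s`. -/
def pos0 (D : WaveData) (s : ℕ) : ℝ := sInf {x : ℝ | D.ε * s ≤ D.tv x}

/-- Sign of the wave `s`: `1` if it is positive, `-1` if it is negative. -/
def sgn (D : WaveData) (s : ℕ) : ℝ :=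
  Real.sign (D.w0 (D.pos0 s) - Function.leftLim D.w0 (D.pos0 s))

/-- Right state of the wave `s`. -/
def hatw (D : WaveData) (s : ℕ) : ℝ :=
  Function.leftLim D.w0 (D.pos0 s) +
    D.sgn s * (D.ε * s - Function.leftLim D.tv (D.pos0 s))

/-- The segment of values of `w` occupied by the wave `s`. -/
def seg (D : WaveData) (s : ℕ) : Set ℝ :=
  if 0 < D.sgn s then Ioc (D.hatw s - D.ε) (D.hatw s) else Ico (D.hatw s) (D.hatw s + D.ε)

/-- The union of the segments of the waves in `A`. -/
def segs (D : WaveData) (A : Finset ℕ) : Set ℝ := ⋃ s ∈ A, D.seg s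

/-- The Rankine-Hugoniot speed given to the interval of waves `A` by the function `g`. -/
def sigmaRH (D : WaveData) (g : ℝ → ℝ) (A : Finset ℕ) : ℝ := rhSpeed g (D.segs A)

/-- The entropic speed given to the wave `s` by the Riemann problem `A` with flux `g`: the slope of
the convex (concave, for negative waves) envelope of the interpolation of `g` on the grid cell of
`s`, on which that envelope is affine. -/
def sigmaEnt (D : WaveData) (g : ℝ → ℝ) (A : Finset ℕ) (s : ℕ) : ℝ :=
  if 0 < D.sgn s then
    deriv (convEnv (interp D.ε g) (sInf (D.segs A)) (sSup (D.segs A))) (D.hatw s - D.ε / 2)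
  else
    deriv (concEnv (interp D.ε g) (sInf (D.segs A)) (sSup (D.segs A))) (D.hatw s + D.ε / 2)

/-- The second component of the solution: it is transported with speed `-1`. -/
def v (D : WaveData) (t x : ℝ) : ℝ := D.v0 (x + t)

/-- The jump points of `v0`. The wavefronts of the first family are the lines `x = ξ - t`
with `ξ` in this set. -/
def vJumps (D : WaveData) : Set ℝ := {ξ | Function.leftLim D.v0 ξ ≠ D.v0 ξ}

/-- The strength of the wavefront of the first family issuing from `ξ`. -/
def vStrength (D : WaveData) (ξ : ℝ) : ℝ := |D.v0 ξ - Function.leftLim D.v0 ξ|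

/-- The speed of the wave `s` in the state `S`: the one given by the Riemann problem made of all
waves at the position of `s`, with the flux `f(·, v)`, where `v` is the value of the first family
at that position (the right state, by right continuity). -/
def speedIn (D : WaveData) (S : WaveState) (s : ℕ) : ℝ :=
  D.sigmaEnt (fun w => D.f w (D.v S.time (S.pos s)))
    (S.alive.filter fun r => S.pos r = S.pos s) s

/-- The position at time `t` of the wave `s`, moving with constant speed from the state `S`. -/
def track (D : WaveData) (S : WaveState) (t : ℝ) (s : ℕ) : ℝ :=
  S.pos s + D.speedIn S s * (t - S.time)

/-- The wavefronts outgoing from the state `S`, each of them given by its position and its speed.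
A wavefront of the second family consists of all the waves with the same position and the same
speed; wavefronts of the first family have speed `-1`. -/
def fronts (D : WaveData) (S : WaveState) : Set (ℝ × ℝ) :=
  {F | ∃ s ∈ S.alive, F = (S.pos s, D.speedIn S s)} ∪
    {F | ∃ ξ ∈ D.vJumps, F = (ξ - S.time, -1)}

/-- The wavefronts outgoing from `S` whose lines pass through the point `(t, x)`. -/
def frontsAt (D : WaveData) (S : WaveState) (t x : ℝ) : Set (ℝ × ℝ) :=
  {F ∈ D.fronts S | F.1 + F.2 * (t - S.time) = x}

/-- The times after the time of `S` at which the lines of two or more wavefronts meet. -/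
def meetTimes (D : WaveData) (S : WaveState) : Set ℝ :=
  {t | S.time < t ∧ ∃ x, (D.frontsAt S t x).Nontrivial}

/-- The first collision time after the time of `S`. -/
def nextTime (D : WaveData) (S : WaveState) : ℝ := sInf (D.meetTimes S)

/-- The point where the wavefronts collide at the first collision time after the time of `S`. -/
def nextPoint (D : WaveData) (S : WaveState) : ℝ :=
  Classical.epsilon fun x => (D.frontsAt S (D.nextTime S) x).Nontrivial

/-- `w(t, x)` for `t` up to (and including) the first collision after the time of `S`: each wave at
the left of `x`, or at `x`, contributes `ε` times its sign. Waves canceled at the collision add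
up to zero there. -/
def wRight (D : WaveData) (S : WaveState) (t x : ℝ) : ℝ :=
  D.ε * ∑ s ∈ S.alive.filter (fun s => D.track S t s ≤ x), D.sgn s

/-- The left limit `w(t, x-)`. -/
def wLeft (D : WaveData) (S : WaveState) (t x : ℝ) : ℝ :=
  D.ε * ∑ s ∈ S.alive.filter (fun s => D.track S t s < x), D.sgn s

/-- The state at time `0`. -/
def start (D : WaveData) : WaveState where
  time := 0
  alive := D.waves
  pos := D.pos0

/-- The state at the first collision time after the time of `S`. Waves which do not arrive at the
collision point survive; those arriving there survive if and only if their segment lies between the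
left and the right state of `w` at the collision point. -/
def next (D : WaveData) (S : WaveState) : WaveState where
  time := D.nextTime S
  alive := S.alive.filter fun s =>
    D.track S (D.nextTime S) s = D.nextPoint S →
      D.sgn s * D.wLeft S (D.nextTime S) (D.nextPoint S) ≤ D.sgn s * D.hatw s - D.ε ∧
        D.sgn s * D.hatw s ≤ D.sgn s * D.wRight S (D.nextTime S) (D.nextPoint S)
  pos := D.track S (D.nextTime S)

/-- The state at time `t_j`, with `t_0 = 0` and `t_1 < t_2 < …` the collision times. -/
def state (D : WaveData) : ℕ → WaveState
  | 0 => D.start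
  | j + 1 => D.next (D.state j)

/-- `t_j`. -/
def time (D : WaveData) (j : ℕ) : ℝ := (D.state j).time

/-- `W(t_j)`. -/
def alive (D : WaveData) (j : ℕ) : Finset ℕ := (D.state j).alive

/-- `x(t_j, s)`. -/
def pos (D : WaveData) (j s : ℕ) : ℝ := (D.state j).pos s

/-- `σ(t_j, s)`. -/
def speed (D : WaveData) (j s : ℕ) : ℝ := D.speedIn (D.state j) s

/-- `x_{j+1}`, the point of the `(j+1)`-st collision. -/
def collPoint (D : WaveData) (j : ℕ) : ℝ := D.nextPoint (D.state j)

/-- The `(j+1)`-st collision exists, it takes place at one point only, and exactly two wavefronts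
meet there. -/
structure BinaryCollision (D : WaveData) (j : ℕ) : Prop where
  nonempty : (D.meetTimes (D.state j)).Nonempty
  unique : ∃! x, (D.frontsAt (D.state j) (D.time (j + 1)) x).Nontrivial
  binary : (D.frontsAt (D.state j) (D.time (j + 1)) (D.collPoint j)).ncard = 2

/-- The `(j+1)`-st collision is transversal: one of the colliding wavefronts is of the
first family. -/
def IsTransversal (D : WaveData) (j : ℕ) : Prop :=
  D.collPoint j + D.time (j + 1) ∈ D.vJumps

/-- The position of the wave `s` at a time `0 ≤ t ≤ t_j`. -/
def posAt (D : WaveData) (j : ℕ) (t : ℝ) (s : ℕ) : ℝ :=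
  D.track (D.state (Nat.findGreatest (fun i => D.time i ≤ t) j)) t s

/-! ### The effective flux -/

/-- The maximal homogeneous interval of waves at time `t_j` containing the wave `s`. -/
def comp (D : WaveData) (j s : ℕ) : Finset ℕ :=
  (D.alive j).filter fun r =>
    ∀ q ∈ D.alive j, min r s ≤ q → q ≤ max r s → D.sgn q = D.sgn s

/-- `g` is an effective flux at time `t_j` on the maximal homogeneous interval of waves containing
`s`: on the closure of the interval spanned by it, `g` is `C^{1,1}`, and its second derivative is,
a.e. on the segment of each wave `r`, that of `f(·, v(t_j, x(t_j, r)))`. -/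
def IsEffectiveFlux (D : WaveData) (j s : ℕ) (g : ℝ → ℝ) : Prop :=
  ∃ (g' : ℝ → ℝ) (K : NNReal),
    LipschitzOnWith K g' (Icc (sInf (D.segs (D.comp j s))) (sSup (D.segs (D.comp j s)))) ∧
    (∀ w ∈ Icc (sInf (D.segs (D.comp j s))) (sSup (D.segs (D.comp j s))),
      HasDerivWithinAt g (g' w)
        (Icc (sInf (D.segs (D.comp j s))) (sSup (D.segs (D.comp j s)))) w) ∧
    ∀ r ∈ D.comp j s, ∀ᵐ w ∂(volume.restrict (D.seg r)),
      HasDerivAt g' (D.dww w (D.v (D.time j) (D.pos j r))) w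

/-- The function which is `f_ww(·, v(t_j, x(t_j, r)))` on the segment of each wave `r` of the
maximal homogeneous interval containing `s`, and `0` elsewhere. -/
def effSecond (D : WaveData) (j s : ℕ) (w : ℝ) : ℝ :=
  ∑ r ∈ D.comp j s,
    (D.seg r).indicator (fun y => D.dww y (D.v (D.time j) (D.pos j r))) w

/-- A representative of the effective flux (which is defined up to affine functions): the second
primitive of `effSecond` which vanishes, with its derivative, at `0`. -/
def effFlux (D : WaveData) (j s : ℕ) (w : ℝ) : ℝ :=
  ∫ y in (0 : ℝ)..w, (w - y) * D.effSecond j s y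

/-! ### Waves which have interacted, and the partitions -/

/-- The waves `s, s'` have already interacted at time `t_j`. -/
def AlreadyInteracted (D : WaveData) (j s s' : ℕ) : Prop :=
  ∃ t ∈ Icc 0 (D.time j), D.posAt j t s = D.posAt j t s'

/-- The waves `s, s'` (which have already interacted) are divided in the real solution at
time `t_j`; otherwise they are joined. -/
def Divided (D : WaveData) (j s s' : ℕ) : Prop :=
  (D.pos j s, D.speed j s) ≠ (D.pos j s', D.speed j s')

/-- The time of last interaction `T(t_j, s, s')`. -/
def lastTime (D : WaveData) (j s s' : ℕ) : ℝ :=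
  sSup {t | t ∈ Icc 0 (D.time j) ∧ D.posAt j t s = D.posAt j t s'}

/-- The interval `I(t_j, s, s')`: the waves of `W(t_j)` which at the time of last interaction of
`s, s'` were at the same position as `s, s'`. -/
def commonInterval (D : WaveData) (j s s' : ℕ) : Finset ℕ :=
  (D.alive j).filter fun r =>
    D.posAt j (D.lastTime j s s') r = D.posAt j (D.lastTime j s s') s

/-- The equivalence relation on `I(t_j, s, s')` which defines the partition `P(t_j, s, s')`. If
`t_j` is the time of last interaction, two waves are equivalent when they are joined in the real
solution. Otherwise they are equivalent when they were in the same class at the previous time and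
the Riemann problem made of the surviving waves of that class, with the effective flux, does not
divide them (a property not affected by the choice of the effective flux). -/
def PRel (D : WaveData) (s s' : ℕ) : ℕ → ℕ → ℕ → Prop
  | 0 => fun p q =>
      p ∈ D.commonInterval 0 s s' ∧ q ∈ D.commonInterval 0 s s' ∧ ¬ D.Divided 0 p q
  | j + 1 => fun p q =>
      p ∈ D.commonInterval (j + 1) s s' ∧ q ∈ D.commonInterval (j + 1) s s' ∧
      if D.lastTime (j + 1) s s' = D.time (j + 1) then ¬ D.Divided (j + 1) p q
      else PRel D s s' j p q ∧
        D.sigmaEnt (D.effFlux (j + 1) s) ((D.alive (j + 1)).filter (PRel D s s' j p)) p =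
          D.sigmaEnt (D.effFlux (j + 1) s) ((D.alive (j + 1)).filter (PRel D s s' j p)) q

/-- The element of `P(t_j, s, s')` containing `p`. -/
def PClass (D : WaveData) (j s s' p : ℕ) : Finset ℕ :=
  (D.commonInterval j s s').filter (D.PRel s s' j p)

/-- The partition `P(t_j, s, s')` of `I(t_j, s, s')`. -/
def P (D : WaveData) (j s s' : ℕ) : Finset (Finset ℕ) :=
  (D.commonInterval j s s').image (D.PClass j s s')

/-! ### The weights -/

/-- `W(t_{j+1}, x_{j+1})`, the set of waves located at the point of the `(j+1)`-st collision. -/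
def wavesAtColl (D : WaveData) (j : ℕ) : Finset ℕ :=
  (D.alive (j + 1)).filter fun r => D.pos (j + 1) r = D.collPoint j

/-- `M(t_{j+1}, s, s')[p, p']`: the total strength of the elements of `P(t_j, s, s')` between the
one of `p` and the one of `p'` which are contained in `W(t_{j+1}, x_{j+1})`. -/
def M (D : WaveData) (j s s' p p' : ℕ) : ℝ :=
  ∑ J ∈ (D.P j s s').filter (fun J =>
      WavesLE (D.PClass j s s' p) J ∧ WavesLE J (D.PClass j s s' p') ∧ J ⊆ D.wavesAtColl j),
    D.ε * J.card

/-- The weight `π(t_j, s, s')[p, p']`. -/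
def weight (D : WaveData) (s s' p p' : ℕ) : ℕ → ℝ
  | 0 => 0
  | j + 1 =>
      if ¬ D.Divided j s s' then 0
      else if D.IsTransversal j then
        weight D s s' p p' j +
          2 * D.normDwwv * D.vStrength (D.collPoint j + D.time (j + 1)) * D.M j s s' p p'
      else weight D s s' p p' j

end WaveData

end

noncomputable section

open Set MeasureTheory
open scoped Classical

/-! ### Convex envelopes on a grid -/

/-! The proof is an induction on the collision times. The inequality alone does not propagate, so
the invariant `Good` carries two further facts. The waves of one class are joined in the real
solution, so a class travels as one body until the next collision. Over the interval of each class,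
the chord of the effective flux lies below the flux at the grid points: the class is an admissible
shock for the effective flux.

If `s` and `s'` have the same position at the current time, the partition is the one produced by the
real Riemann problem at that point. There `v` is constant, so the effective flux equals `f(·, v)` up
to an affine function, which does not affect which waves are divided. The Rankine-Hugoniot speed of
a class is a slope of one convex envelope. These slopes increase from left to right, so the
difference is nonpositive, while the weight is nonnegative.

Otherwise each old class, restricted to the surviving waves, is split by the convex envelope of the
new effective flux. Inside one old class monotonicity of slopes settles the matter again. Let `p`,
`p'` lie in different old classes. All waves between them survive, so these classes lose waves at
their outer ends only. The new speed at `p` is at most the slope of the last affine piece of its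
envelope, a chord of the new flux over some `[c, b]` ending at the old right end. The new speed at
`p'` is at least the slope of a chord over some `[a, d]` starting at the old left end. By the chord
property, the slopes of the old flux over `[c, b]` and `[a, d]` compare in the right direction with
the old speeds.

What remains is the change of a difference of two mean slopes when the flux changes
(`slope_sub_slope_le`). By the mean value theorem it is a difference of two values of the derivative
of (new flux - old flux), hence an integral of the difference of the second derivatives. That
difference vanishes except on waves at the collision point, where it is at most the norm of
`D^3_{wwv} f` times the jump of `v`. In a transversal collision those waves belong to classes lying
entirely at the collision point, between the classes of `p` and `p'`, whose strength is what the
weight adds (`Good.card_le_weight`).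

Three tools support this. `convEnv_interp` reduces envelopes to convex sequences, and
`GridEnv.not_divides_of_subinterval` shows that a larger Riemann problem divides no pair that a
smaller one keeps together, whence joinedness. The invariant `Inv` (ordered positions, one sign per
position, right states equal to partial sums of signs) survives cancellations by `sum_surviving`,
and makes runs of waves of one sign fill consecutive grid cells (`Inv.block`). Finally, `∂_w f > -1`
makes `x + t` increase along every wave, so `v` seen by a wave changes only at collisions in which
the wave takes part (`Inv.v_track`). -/

theorem interp_eq_of_mem {ε : ℝ} (hε : 0 < ε) (g : ℝ → ℝ) (k : ℤ) {u : ℝ}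
    (hu : u ∈ Icc (k * ε) ((k + 1) * ε)) :
    interp ε g u = g (k * ε) + (u - k * ε) / ε * (g ((k + 1) * ε) - g (k * ε)) := by
  rcases eq_or_lt_of_le hu.2 with h | h
  · have hfl : ⌊u / ε⌋ = k + 1 := by
      rw [h, mul_div_assoc, div_self hε.ne', mul_one]
      exact_mod_cast Int.floor_intCast (k + 1)
    rw [interp, hfl, h]
    push_cast
    field_simp
    ring
  · have hfl : ⌊u / ε⌋ = k := by
      rw [Int.floor_eq_iff, le_div_iff₀ hε, div_lt_iff₀ hε]
      exact ⟨hu.1, h⟩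
    rw [interp, hfl]

theorem interp_grid {ε : ℝ} (hε : 0 < ε) (g : ℝ → ℝ) (k : ℤ) :
    interp ε g (k * ε) = g (k * ε) := by
  rw [interp_eq_of_mem hε g k ⟨le_rfl, by nlinarith⟩]
  simp

/-- Each point of `[mε, nε]` lies in a grid cell of this interval. -/
theorem exists_cell {ε : ℝ} (hε : 0 < ε) {m n : ℤ} (hmn : m < n) {u : ℝ}
    (hu : u ∈ Icc (m * ε) (n * ε)) :
    ∃ k : ℤ, m ≤ k ∧ k < n ∧ u ∈ Icc (k * ε) ((k + 1) * ε) := by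
  rcases eq_or_lt_of_le hu.2 with h | h
  · refine ⟨n - 1, by omega, by omega, ?_, ?_⟩
    · push_cast
      nlinarith
    · push_cast
      linarith
  · have h1 := Int.floor_le (u / ε)
    have h2 := Int.lt_floor_add_one (u / ε)
    rw [le_div_iff₀ hε] at h1
    rw [div_lt_iff₀ hε] at h2
    refine ⟨⌊u / ε⌋, ?_, ?_, h1, h2.le⟩
    · rw [Int.le_floor, le_div_iff₀ hε]
      exact hu.1
    · rw [Int.floor_lt, div_lt_iff₀ hε]
      exact h

/-- `e` is the convex envelope of the sequence `G` on the integer interval `[m, n]`. -/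
structure GridEnv (G e : ℤ → ℝ) (m n : ℤ) : Prop where
  le : ∀ i, m ≤ i → i ≤ n → e i ≤ G i
  left : e m = G m
  right : e n = G n
  convex : ∀ i, m < i → i < n → e i - e (i - 1) ≤ e (i + 1) - e i
  contact : ∀ i, m < i → i < n → e i - e (i - 1) ≠ e (i + 1) - e i → e i = G i

/-- Convexity of a sequence on the integer interval `[m, n]`. -/
def SeqConvex (e : ℤ → ℝ) (m n : ℤ) : Prop :=
  ∀ i, m < i → i < n → e i - e (i - 1) ≤ e (i + 1) - e i

theorem SeqConvex.mono {e : ℤ → ℝ} {m n : ℤ} (h : SeqConvex e m n) {i k : ℤ} (hi : m ≤ i)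
    (hik : i ≤ k) (hk : k < n) : e (i + 1) - e i ≤ e (k + 1) - e k := by
  induction k, hik using Int.leInduction with
  | base => exact le_rfl
  | succ k hik ih =>
    have := h (k + 1) (by omega) hk
    rw [add_sub_cancel_right] at this
    exact (ih (by omega)).trans this

theorem sub_le_of_slopes_le {e : ℤ → ℝ} {i l : ℤ} {c : ℝ} (hil : i ≤ l)
    (h : ∀ k, i ≤ k → k < l → e (k + 1) - e k ≤ c) : e l - e i ≤ c * (l - i) := by
  induction l, hil using Int.leInduction with
  | base => simp
  | succ l hil ih =>
    have h1 := ih fun k h1 h2 => h k h1 (by omega)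
    have h2 := h l hil (by omega)
    push_cast
    linarith

theorem le_sub_of_le_slopes {e : ℤ → ℝ} {i l : ℤ} {c : ℝ} (hil : i ≤ l)
    (h : ∀ k, i ≤ k → k < l → c ≤ e (k + 1) - e k) : c * (l - i) ≤ e l - e i := by
  have := sub_le_of_slopes_le (e := fun k => -e k) (c := -c) hil
    fun k h1 h2 => by have := h k h1 h2; linarith
  linarith

/-- Slopes increase, so the line through any one cell supports the whole sequence from below. -/
theorem SeqConvex.support {e : ℤ → ℝ} {m n : ℤ} (h : SeqConvex e m n) {i l : ℤ} (hi : m ≤ i)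
    (hi' : i < n) (hl : m ≤ l) (hl' : l ≤ n) : e i + (e (i + 1) - e i) * (l - i) ≤ e l := by
  rcases le_total i l with hil | hil
  · have := le_sub_of_le_slopes (e := e) (c := e (i + 1) - e i) hil
      fun k h1 h2 => h.mono hi h1 (by omega)
    linarith
  · have := sub_le_of_slopes_le (e := e) (c := e (i + 1) - e i) hil
      fun k h1 h2 => h.mono (by omega) h2.le hi'
    linarith

/-- The piecewise affine function with values `e` at the grid points is convex on `[mε, nε]`, if
`e` is convex. -/
theorem SeqConvex.exists_convexOn {ε : ℝ} (hε : 0 < ε) {e : ℤ → ℝ} {m n : ℤ} (hmn : m < n)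
    (h : SeqConvex e m n) :
    ∃ φ : ℝ → ℝ, ConvexOn ℝ (Icc (m * ε) (n * ε)) φ ∧ ∀ k, m ≤ k → k < n →
      ∀ u ∈ Icc (k * ε) ((k + 1) * ε), φ u = e k + (u - k * ε) / ε * (e (k + 1) - e k) := by
  set ℓ : ℤ → ℝ → ℝ := fun k u => e k + (u - k * ε) / ε * (e (k + 1) - e k) with hℓ
  have hne : (Finset.Ico m n).Nonempty := Finset.nonempty_Ico.2 hmn
  -- The maximum of the affine extensions of all cells is convex for free; on each cell its own line
  -- wins, by the support property at the two ends of the cell.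
  refine ⟨fun u => (Finset.Ico m n).sup' hne fun k => ℓ k u, ?_, ?_⟩
  · refine ⟨convex_Icc _ _, fun x _ y _ a b ha hb hab => ?_⟩
    refine Finset.sup'_le _ _ fun k hk => ?_
    have h1 := Finset.le_sup' (fun k => ℓ k x) hk
    have h2 := Finset.le_sup' (fun k => ℓ k y) hk
    have h3 : ℓ k (a • x + b • y) = a * ℓ k x + b * ℓ k y := by
      have hb' : b = 1 - a := by linarith
      subst hb'
      simp only [hℓ, smul_eq_mul]
      ring
    rw [h3]
    simp only [smul_eq_mul]
    exact add_le_add (mul_le_mul_of_nonneg_left h1 ha) (mul_le_mul_of_nonneg_left h2 hb)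
  · intro k hk hk' u hu
    refine le_antisymm (Finset.sup'_le _ _ fun i hi => ?_)
      (Finset.le_sup' (fun k => ℓ k u) (Finset.mem_Ico.2 ⟨hk, hk'⟩))
    rw [Finset.mem_Ico] at hi
    have h1 := h.support hi.1 hi.2 hk hk'.le
    have h2 := h.support (l := k + 1) hi.1 hi.2 (by omega) (by omega)
    push_cast at h2
    set t := (u - k * ε) / ε with ht
    have ht0 : 0 ≤ t := div_nonneg (by linarith [hu.1]) hε.le
    have ht1 : t ≤ 1 := by
      rw [ht, div_le_one hε]
      linarith [hu.2]
    have h3 : (u - i * ε) / ε = t + (k - i) := by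
      rw [ht]
      field_simp
      ring
    simp only [hℓ]
    rw [h3]
    nlinarith

/-- Moving one value up by `δ` lowers the second difference there by `2δ` and raises the
neighbouring ones by `δ`. This is how maximality of the envelope forces contact with the data at the
ends and at every kink. -/
theorem SeqConvex.raise {e : ℤ → ℝ} {m n : ℤ} (h : SeqConvex e m n) {i : ℤ}
    {δ : ℝ} (hδ : 0 ≤ δ)
    (hi : m < i → i < n → 2 * δ ≤ (e (i + 1) - e i) - (e i - e (i - 1))) :
    SeqConvex (fun k => e k + if k = i then δ else 0) m n := by
  intro k h1 h2
  have h3 := h k h1 h2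
  rcases lt_trichotomy k i with hk | hk | hk
  · simp only [hk.ne, if_false, show k - 1 ≠ i by omega]
    split_ifs <;> linarith
  · subst hk
    simp only [if_true, show k - 1 ≠ k by omega, show k + 1 ≠ k by omega, if_false]
    linarith [hi h1 h2]
  · simp only [hk.ne', if_false, show k + 1 ≠ i by omega]
    split_ifs <;> linarith

/-- The set of values at `u` of the convex functions below `interp ε g` is bounded above by
`interp ε g u`. -/
theorem convEnv_le {g : ℝ → ℝ} {a b u : ℝ} (hu : u ∈ Icc a b)
    (hne : ∃ h : ℝ → ℝ, ConvexOn ℝ (Icc a b) h ∧ ∀ x ∈ Icc a b, h x ≤ g x) :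
    convEnv g a b u ≤ g u := by
  obtain ⟨h, h1, h2⟩ := hne
  refine csSup_le ⟨h u, h, h1, h2, rfl⟩ ?_
  rintro y ⟨h', -, h2', rfl⟩
  exact h2' u hu

theorem le_convEnv {g h : ℝ → ℝ} {a b u : ℝ} (hu : u ∈ Icc a b)
    (h1 : ConvexOn ℝ (Icc a b) h) (h2 : ∀ x ∈ Icc a b, h x ≤ g x) : h u ≤ convEnv g a b u := by
  refine le_csSup ⟨g u, ?_⟩ ⟨h, h1, h2, rfl⟩
  rintro y ⟨h', -, h2', rfl⟩
  exact h2' u hu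

theorem convexOn_convEnv {g : ℝ → ℝ} {a b : ℝ}
    (hne : ∃ h : ℝ → ℝ, ConvexOn ℝ (Icc a b) h ∧ ∀ x ∈ Icc a b, h x ≤ g x) :
    ConvexOn ℝ (Icc a b) (convEnv g a b) := by
  obtain ⟨h, h1, h2⟩ := hne
  refine ⟨convex_Icc a b, fun x hx y hy α β hα hβ hαβ => ?_⟩
  refine csSup_le ⟨_, h, h1, h2, rfl⟩ ?_
  rintro z ⟨h', h1', h2', rfl⟩
  refine (h1'.2 hx hy hα hβ hαβ).trans ?_
  simp only [smul_eq_mul]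
  exact add_le_add (mul_le_mul_of_nonneg_left (le_convEnv hx h1' h2') hα)
    (mul_le_mul_of_nonneg_left (le_convEnv hy h1' h2') hβ)

theorem grid_mem_Icc {ε : ℝ} (hε : 0 < ε) {m n k : ℤ} (h1 : m ≤ k) (h2 : k ≤ n) :
    (k : ℝ) * ε ∈ Icc (m * ε) (n * ε) :=
  ⟨mul_le_mul_of_nonneg_right (by exact_mod_cast h1) hε.le,
    mul_le_mul_of_nonneg_right (by exact_mod_cast h2) hε.le⟩

theorem cell_subset_Icc {ε : ℝ} (hε : 0 < ε) {m n k : ℤ} (h1 : m ≤ k) (h2 : k < n) :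
    Icc ((k : ℝ) * ε) ((k + 1) * ε) ⊆ Icc (m * ε) (n * ε) := by
  refine Icc_subset_Icc (grid_mem_Icc hε h1 h2.le).1 ?_
  have := (grid_mem_Icc hε (m := m) (n := n) (k := k + 1) (by omega) (by omega)).2
  exact_mod_cast this

/-- A convex sequence below `g` on the grid yields a convex function below `interp ε g`. -/
theorem SeqConvex.minorant {ε : ℝ} (hε : 0 < ε) {g : ℝ → ℝ} {e : ℤ → ℝ} {m n : ℤ} (hmn : m < n)
    (h : SeqConvex e m n) (hle : ∀ i, m ≤ i → i ≤ n → e i ≤ g (i * ε)) :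
    ∃ φ : ℝ → ℝ, ConvexOn ℝ (Icc (m * ε) (n * ε)) φ ∧
      (∀ x ∈ Icc (m * ε) (n * ε), φ x ≤ interp ε g x) ∧ (∀ k, m ≤ k → k < n →
      ∀ u ∈ Icc (k * ε) ((k + 1) * ε), φ u = e k + (u - k * ε) / ε * (e (k + 1) - e k)) := by
  obtain ⟨φ, h1, h2⟩ := h.exists_convexOn hε hmn
  refine ⟨φ, h1, fun x hx => ?_, h2⟩
  obtain ⟨k, hk, hk', hxk⟩ := exists_cell hε hmn hx
  rw [h2 k hk hk' x hxk, interp_eq_of_mem hε g k hxk]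
  have h3 := hle k hk hk'.le
  have h4 := hle (k + 1) (by omega) (by omega)
  push_cast at h4
  set t := (x - k * ε) / ε with ht
  have ht0 : 0 ≤ t := div_nonneg (by linarith [hxk.1]) hε.le
  have ht1 : t ≤ 1 := by
    rw [ht, div_le_one hε]
    linarith [hxk.2]
  nlinarith

theorem SeqConvex.value_le_convEnv {ε : ℝ} (hε : 0 < ε) {g : ℝ → ℝ} {e : ℤ → ℝ} {m n : ℤ}
    (hmn : m < n) (h : SeqConvex e m n) (hle : ∀ i, m ≤ i → i ≤ n → e i ≤ g (i * ε)) {k : ℤ}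
    (hk : m ≤ k) (hk' : k ≤ n) : e k ≤ convEnv (interp ε g) (m * ε) (n * ε) (k * ε) := by
  obtain ⟨φ, h1, h2, h3⟩ := h.minorant hε hmn hle
  refine le_trans (le_of_eq ?_) (le_convEnv (grid_mem_Icc hε hk hk') h1 h2)
  rcases eq_or_lt_of_le hk' with rfl | hk'
  · have := h3 (k - 1) (by omega) (by omega) (k * ε) ⟨by push_cast; nlinarith, by push_cast; linarith⟩
    rw [this]
    push_cast
    rw [sub_add_cancel]
    field_simp
    ring
  · rw [h3 k hk hk' (k * ε) ⟨le_rfl, by nlinarith⟩]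
    simp

/-- The convex envelope of the interpolation of `g` on `[mε, nε]` is the piecewise affine function
given by the convex envelope of the sequence of the values of `g` on the grid. -/
theorem convEnv_interp {ε : ℝ} (hε : 0 < ε) (g : ℝ → ℝ) {m n : ℤ} (hmn : m < n) :
    ∃ e : ℤ → ℝ, GridEnv (fun k => g (k * ε)) e m n ∧ ∀ k : ℤ, m ≤ k → k < n →
      deriv (convEnv (interp ε g) (m * ε) (n * ε)) (k * ε + ε / 2) = (e (k + 1) - e k) / ε := by
  set E := convEnv (interp ε g) (m * ε) (n * ε) with hE
  set e : ℤ → ℝ := fun k => E (k * ε) with he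
  have hne : ∃ h : ℝ → ℝ, ConvexOn ℝ (Icc (m * ε) (n * ε)) h ∧
      ∀ x ∈ Icc (m * ε) (n * ε), h x ≤ interp ε g x := by
    -- The constant equal to the minimum of the grid values makes the family of convex minorants
    -- nonempty, so that its supremum is a genuine one.
    set c := (Finset.Icc m n).inf' (Finset.nonempty_Icc.2 hmn.le) fun k => g (k * ε) with hc
    have h1 : SeqConvex (fun _ => c) m n := fun i _ _ => by simp
    obtain ⟨φ, h2, h3, -⟩ := h1.minorant hε (g := g) hmn
      fun i hi hi' => Finset.inf'_le _ (Finset.mem_Icc.2 ⟨hi, hi'⟩)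
    exact ⟨φ, h2, h3⟩
  have hconv := convexOn_convEnv hne
  rw [← hE] at hconv
  have hle : ∀ i, m ≤ i → i ≤ n → e i ≤ g (i * ε) := fun i hi hi' => by
    rw [← interp_grid hε g i]
    exact convEnv_le (grid_mem_Icc hε hi hi') hne
  have hseq : SeqConvex e m n := by
    intro i hi hi'
    have h1 := grid_mem_Icc hε (m := m) (n := n) (k := i - 1) (by omega) (by omega)
    have h2 := grid_mem_Icc hε (m := m) (n := n) (k := i + 1) (by omega) (by omega)
    have h3 := hconv.2 h1 h2 (show (0 : ℝ) ≤ 1 / 2 by norm_num) (show (0 : ℝ) ≤ 1 / 2 by norm_num)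
      (by norm_num)
    have h4 : (1 / 2 : ℝ) • (((i - 1 : ℤ) : ℝ) * ε) + (1 / 2 : ℝ) • (((i + 1 : ℤ) : ℝ) * ε)
        = i * ε := by
      push_cast
      simp only [smul_eq_mul]
      ring
    rw [h4] at h3
    simp only [smul_eq_mul] at h3
    simp only [he]
    linarith
  -- Maximality: a value strictly below the data that could be raised without losing convexity would
  -- give a larger convex minorant.
  have hmax : ∀ i, m ≤ i → i ≤ n → ∀ δ, 0 < δ → δ ≤ g (i * ε) - e i →
      (m < i → i < n → 2 * δ ≤ (e (i + 1) - e i) - (e i - e (i - 1))) → False := by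
    intro i hi hi' δ hδ hδ' h
    have h1 := hseq.raise hδ.le h
    have h2 := h1.value_le_convEnv hε (g := g) hmn (fun k hk hk' => by
      have := hle k hk hk'
      split_ifs with hki
      · subst hki; linarith
      · linarith) hi hi'
    simp only [if_true] at h2
    change e i + δ ≤ e i at h2
    linarith
  refine ⟨e, ⟨hle, ?_, ?_, hseq, ?_⟩, ?_⟩
  · refine le_antisymm (hle m le_rfl hmn.le) ?_
    by_contra! h
    exact hmax m le_rfl hmn.le _ (sub_pos.2 h) le_rfl fun h => absurd h (lt_irrefl _)
  · refine le_antisymm (hle n hmn.le le_rfl) ?_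
    by_contra! h
    exact hmax n hmn.le le_rfl _ (sub_pos.2 h) le_rfl fun _ h => absurd h (lt_irrefl _)
  · intro i hi hi' hb
    refine le_antisymm (hle i hi.le hi'.le) ?_
    by_contra! h
    have h1 := lt_of_le_of_ne (hseq i hi hi') hb
    refine hmax i hi.le hi'.le (min (g (i * ε) - e i)
      (((e (i + 1) - e i) - (e i - e (i - 1))) / 2)) ?_ (min_le_left _ _) fun _ _ => ?_
    · exact lt_min (sub_pos.2 h) (by linarith)
    · have := min_le_right (g (i * ε) - e i) (((e (i + 1) - e i) - (e i - e (i - 1))) / 2)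
      linarith
  · intro k hk hk'
    -- The upper bound is convexity of the envelope between two grid points; for the lower bound,
    -- the piecewise affine function with values `e` is itself a competitor.
    have hlin : ∀ u ∈ Icc (k * ε) ((k + 1) * ε),
        E u = e k + (u - k * ε) / ε * (e (k + 1) - e k) := by
      intro u hu
      apply le_antisymm
      · have h1 := grid_mem_Icc hε (m := m) (n := n) (k := k) (by omega) (by omega)
        have h2 := grid_mem_Icc hε (m := m) (n := n) (k := k + 1) (by omega) (by omega)
        set t := (u - k * ε) / ε with ht
        have ht0 : 0 ≤ t := div_nonneg (by linarith [hu.1]) hε.le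
        have ht1 : t ≤ 1 := by
          rw [ht, div_le_one hε]
          linarith [hu.2]
        have h3 := hconv.2 h1 h2 (sub_nonneg.2 ht1) ht0 (by ring)
        have h4 : (1 - t) • ((k : ℝ) * ε) + t • (((k + 1 : ℤ) : ℝ) * ε) = u := by
          push_cast
          simp only [smul_eq_mul]
          rw [ht]
          field_simp
          ring
        rw [h4] at h3
        simp only [smul_eq_mul] at h3
        simp only [he]
        linarith
      · obtain ⟨φ, h1, h2, h3⟩ := hseq.minorant hε hmn hle
        rw [← h3 k hk hk' u hu]
        exact le_convEnv (cell_subset_Icc hε hk hk' hu) h1 h2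
    have hev : E =ᶠ[nhds (k * ε + ε / 2)]
        fun u => e k + (u - k * ε) / ε * (e (k + 1) - e k) := by
      filter_upwards [Icc_mem_nhds (show (k : ℝ) * ε < k * ε + ε / 2 by linarith)
        (show (k : ℝ) * ε + ε / 2 < (k + 1) * ε by linarith)] with u hu
      exact hlin u hu
    rw [hev.deriv_eq]
    have : HasDerivAt (fun u : ℝ => e k + (u - k * ε) / ε * (e (k + 1) - e k))
        ((e (k + 1) - e k) / ε) (k * ε + ε / 2) := by
      have h1 := ((((hasDerivAt_id ((k : ℝ) * ε + ε / 2)).sub_const ((k : ℝ) * ε)).div_const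
        ε).mul_const (e (k + 1) - e k)).const_add (e k)
      exact h1.congr_deriv (by ring)
    exact this.deriv

/-- The real infimum of a set is minus the supremum of the opposite set, and `h ↦ -h` exchanges
concave majorants and convex minorants. -/
theorem concEnv_eq (g : ℝ → ℝ) (a b : ℝ) : concEnv g a b = fun u => -convEnv (-g) a b u := by
  funext u
  rw [concEnv, convEnv, Real.sInf_def]
  congr 2
  ext y
  simp only [Set.mem_neg, mem_ofPred_eq, Pi.neg_apply]
  constructor
  · rintro ⟨h, h1, h2, h3⟩
    exact ⟨-h, h1.neg, fun x hx => neg_le_neg (h2 x hx), by simp [← h3]⟩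
  · rintro ⟨h, h1, h2, h3⟩
    exact ⟨-h, h1.neg, fun x hx => le_neg_of_le_neg (h2 x hx), by simp [h3]⟩

theorem interp_neg (ε : ℝ) (g : ℝ → ℝ) : -interp ε g = interp ε (-g) := by
  funext u
  simp only [interp, Pi.neg_apply]
  ring

theorem concEnv_interp {ε : ℝ} (hε : 0 < ε) (g : ℝ → ℝ) {m n : ℤ} (hmn : m < n) :
    ∃ e : ℤ → ℝ, GridEnv (fun k => -g (k * ε)) e m n ∧ ∀ k : ℤ, m ≤ k → k < n →
      deriv (concEnv (interp ε g) (m * ε) (n * ε)) (k * ε + ε / 2) = -((e (k + 1) - e k) / ε) := by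
  obtain ⟨e, h1, h2⟩ := convEnv_interp hε (-g) hmn
  refine ⟨e, h1, fun k hk hk' => ?_⟩
  rw [concEnv_eq, ← h2 k hk hk', interp_neg]
  exact deriv.fun_neg

/-! ### Affine pieces of the envelope of a sequence -/

namespace GridEnv

variable {G e : ℤ → ℝ} {m n : ℤ}

theorem mono (h : GridEnv G e m n) {i k : ℤ} (hi : m ≤ i) (hik : i ≤ k) (hk : k < n) :
    e (i + 1) - e i ≤ e (k + 1) - e k :=
  SeqConvex.mono h.convex hi hik hk

theorem support (h : GridEnv G e m n) {i l : ℤ} (hi : m ≤ i) (hi' : i < n) (hl : m ≤ l)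
    (hl' : l ≤ n) : e i + (e (i + 1) - e i) * (l - i) ≤ e l :=
  SeqConvex.support h.convex hi hi' hl hl'

/-- The maximal interval around the cell `k` where the envelope is affine. -/
theorem exists_class (h : GridEnv G e m n) {k : ℤ} (hk : m ≤ k) (hk' : k < n) :
    ∃ c d, m ≤ c ∧ c ≤ k ∧ k < d ∧ d ≤ n ∧ e c = G c ∧ e d = G d ∧
      ∀ i, m ≤ i → i < n → (e (i + 1) - e i = e (k + 1) - e k ↔ c ≤ i ∧ i < d) := by
  set A := (Finset.Ico m n).filter fun i => e (i + 1) - e i = e (k + 1) - e k with hA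
  have hkA : k ∈ A := by simp [hA, hk, hk']
  have hne : A.Nonempty := ⟨k, hkA⟩
  obtain ⟨hc, hc3⟩ := Finset.mem_filter.1 (A.min'_mem hne)
  obtain ⟨hd, hd3⟩ := Finset.mem_filter.1 (A.max'_mem hne)
  rw [Finset.mem_Ico] at hc hd
  set c := A.min' hne
  set d := A.max' hne
  have hck : c ≤ k := Finset.min'_le _ _ hkA
  have hkd : k ≤ d := Finset.le_max' _ _ hkA
  refine ⟨c, d + 1, hc.1, hck, by omega, by omega, ?_, ?_, fun i hi hi' => ⟨fun hs => ?_, fun hs => ?_⟩⟩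
  · rcases eq_or_lt_of_le hc.1 with h1 | h1
    · rw [← h1]
      exact h.left
    · refine h.contact c h1 hc.2 fun h2 => ?_
      have : c - 1 ∈ A := by
        simp only [hA, Finset.mem_filter, Finset.mem_Ico]
        refine ⟨by omega, ?_⟩
        rw [sub_add_cancel, h2, hc3]
      have := Finset.min'_le _ _ this
      change c ≤ c - 1 at this
      omega
  · rcases eq_or_lt_of_le (show d + 1 ≤ n by omega) with h1 | h1
    · rw [h1]
      exact h.right
    · refine h.contact (d + 1) (by omega) h1 fun h2 => ?_
      have : d + 1 ∈ A := by
        simp only [hA, Finset.mem_filter, Finset.mem_Ico]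
        refine ⟨by omega, ?_⟩
        rw [← h2, add_sub_cancel_right, hd3]
      have := Finset.le_max' _ _ this
      change d + 1 ≤ d at this
      omega
  · have hiA : i ∈ A := by simp [hA, hi, hi', hs]
    exact ⟨Finset.min'_le _ _ hiA, Int.lt_add_one_of_le (Finset.le_max' _ _ hiA)⟩
  · refine le_antisymm ?_ ?_
    · rw [← hd3]
      exact h.mono hi (by omega) hd.2
    · rw [← hc3]
      exact h.mono hc.1 hs.1 hi'

theorem affine_of_slopes {c d : ℤ} {x : ℝ} {l : ℤ} (hcl : c ≤ l) (hld : l ≤ d)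
    (hs : ∀ i, c ≤ i → i < d → e (i + 1) - e i = x) : e l = e c + x * (l - c) := by
  have h1 := sub_le_of_slopes_le (e := e) (c := x) hcl fun k h1 h2 => (hs k h1 (by omega)).le
  have h2 := le_sub_of_le_slopes (e := e) (c := x) hcl fun k h1 h2 => (hs k h1 (by omega)).ge
  linarith

/-- If the envelope on an interval does not divide two cells, neither does the envelope, on a larger
interval, of a sequence which differs by an affine one. -/
theorem not_divides_of_subinterval {G' e' : ℤ → ℝ} {m' n' : ℤ} (h : GridEnv G e m n)
    (h' : GridEnv G' e' m' n') (hm : m' ≤ m) (hn : n ≤ n') {α β : ℝ}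
    (hG : ∀ l, m ≤ l → l ≤ n → G' l = G l + (α + β * l)) {i k : ℤ} (hi : m ≤ i) (hi' : i < n)
    (hk : m ≤ k) (hk' : k < n) (hs : e (i + 1) - e i = e (k + 1) - e k) :
    e' (i + 1) - e' i = e' (k + 1) - e' k := by
  wlog hik : i ≤ k generalizing i k
  · exact (this hk hk' hi hi' hs.symm (by omega)).symm
  by_contra hne
  have hlt : e' (i + 1) - e' i < e' (k + 1) - e' k :=
    lt_of_le_of_ne (h'.mono (by omega) hik (by omega)) hne
  obtain ⟨c, d, hc, hck, hkd, hd, hec, hed, hcls⟩ := h.exists_class hk hk'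
  have hci := ((hcls i hi hi').1 hs).1
  -- If the slopes of `e'` at `i` and `k` differ, some grid point `l` in between is a kink of `e'`,
  -- where `e'` touches `G'`.
  obtain ⟨l, hil, hlk, hl⟩ : ∃ l, i < l ∧ l ≤ k ∧ e' l - e' (l - 1) ≠ e' (l + 1) - e' l := by
    by_contra! hcon
    apply hne
    clear hne hlt hs hkd hck hcls hk hk'
    induction k, hik using Int.leInduction with
    | base => rfl
    | succ k hik ih =>
      rw [ih fun l h1 h2 => hcon l h1 (by omega)]
      have := hcon (k + 1) (by omega) le_rfl
      rwa [add_sub_cancel_right] at this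
  have hlt' : e' l - e' (l - 1) < e' (l + 1) - e' l :=
    lt_of_le_of_ne (h'.convex l (by omega) (by omega)) hl
  have hcl := h'.contact l (by omega) (by omega) hl
  -- On `[c, d]` the envelope `e` is a chord of `G` lying below `G`. The support lines of `e'` to
  -- the left and right of `l`, compared with the data at `c` and `d`, give left slope `≥ x + β ≥`
  -- right slope, against the strict kink at `l`.
  have h1 := h'.support (i := l - 1) (l := c) (by omega) (by omega) (by omega) (by omega)
  have h2 := h'.support (i := l) (l := d) (by omega) (by omega) (by omega) (by omega)
  have h3 := h'.le c (by omega) (by omega)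
  have h4 := h'.le d (by omega) (by omega)
  have h5 := h.le l (by omega) (by omega)
  have h6 : ∀ i, c ≤ i → i < d → e (i + 1) - e i = e (k + 1) - e k :=
    fun i h1 h2 => (hcls i (by omega) (by omega)).2 ⟨h1, h2⟩
  have h7 := affine_of_slopes (l := l) (by omega) (by omega) h6
  have h8 := affine_of_slopes (l := d) (by omega) (by omega) h6
  rw [hG c (by omega) (by omega), ← hec] at h3
  rw [hG d (by omega) (by omega), ← hed] at h4
  rw [hG l (by omega) (by omega)] at hcl
  rw [sub_add_cancel] at h1
  push_cast at h1
  have hcl' : (c : ℝ) < l := by exact_mod_cast (show c < l by omega)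
  have hld' : (l : ℝ) < d := by exact_mod_cast (show l < d by omega)
  set x := e (k + 1) - e k
  set y := e' l - e' (l - 1)
  set z := e' (l + 1) - e' l
  have h9 : x + β ≤ y := by
    have : (x + β) * (l - c) ≤ y * (l - c) := by
      have : e' l - y * (l - c) ≤ e' c := by linarith
      linarith
    exact le_of_mul_le_mul_right this (by linarith)
  have h10 : z ≤ x + β := by
    have : z * (d - l) ≤ (x + β) * (d - l) := by linarith
    exact le_of_mul_le_mul_right this (by linarith)
  linarith

/-- A class of the envelope lies below `G`: chord property and slope. -/
theorem chord_le (h : GridEnv G e m n) {c d l : ℤ} (hc : m ≤ c) (hd : d ≤ n) (hcl : c ≤ l)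
    (hld : l ≤ d) (hec : e c = G c) {x : ℝ}
    (hs : ∀ i, c ≤ i → i < d → e (i + 1) - e i = x) : G c + x * (l - c) ≤ G l := by
  rw [← hec, ← affine_of_slopes hcl hld hs]
  exact h.le l (by omega) (by omega)

end GridEnv

/-! ### Piecewise constant grid data -/

theorem leftLim_eq_of_const {w : ℝ → ℝ} {x y : ℝ} (hy : y < x) (h : ∀ z ∈ Ico y x, w z = w y) :
    Function.leftLim w x = w y := by
  refine leftLim_eq_of_tendsto (tendsto_const_nhds.congr' ?_)
  filter_upwards [Ico_mem_nhdsLT hy] with z hz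
  exact (h z hz).symm

namespace IsGridDatum

variable {ε : ℝ} {w : ℝ → ℝ}

theorem exists_left (h : IsGridDatum ε w) (x : ℝ) : ∃ y < x, ∀ z ∈ Ico y x, w z = w y := by
  obtain ⟨S, hS⟩ := h.piecewiseConst
  set A := insert (x - 1) (S.filter fun p => p < x) with hA
  have hne : A.Nonempty := Finset.insert_nonempty _ _
  refine ⟨A.max' hne, ?_, fun z hz => (hS _ _ hz.1 fun p hp hpz => ?_).symm⟩
  · rw [Finset.max'_lt_iff]
    intro p hp
    rcases Finset.mem_insert.1 hp with rfl | hp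
    · linarith
    · exact (Finset.mem_filter.1 hp).2
  · have hpA : p ∈ A := by
      simp only [hA, Finset.mem_insert, Finset.mem_filter]
      exact Or.inr ⟨hp, hpz.2.trans_lt hz.2⟩
    exact absurd (A.le_max' p hpA) (not_le.2 hpz.1)

theorem exists_right (h : IsGridDatum ε w) (x : ℝ) : ∃ y > x, ∀ z ∈ Ico x y, w z = w x := by
  obtain ⟨S, hS⟩ := h.piecewiseConst
  set A := insert (x + 1) (S.filter fun p => x < p) with hA
  have hne : A.Nonempty := Finset.insert_nonempty _ _
  refine ⟨A.min' hne, ?_, fun z hz => (hS _ _ hz.1 fun p hp hpz => ?_).symm⟩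
  · rw [gt_iff_lt, Finset.lt_min'_iff]
    intro p hp
    rcases Finset.mem_insert.1 hp with rfl | hp
    · linarith
    · exact (Finset.mem_filter.1 hp).2
  · have hpA : p ∈ A := by
      simp only [hA, Finset.mem_insert, Finset.mem_filter]
      exact Or.inr ⟨hp, hpz.1⟩
    exact absurd ((A.min'_le p hpA).trans hpz.2) (not_le.2 hz.2)

/-- A point outside the exceptional finite set is not a jump, because a small interval ending at it
contains no exceptional point. -/
theorem finite_jumps (h : IsGridDatum ε w) : {ξ | Function.leftLim w ξ ≠ w ξ}.Finite := by
  obtain ⟨S, hS⟩ := h.piecewiseConst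
  refine S.finite_toSet.subset fun ξ hξ => ?_
  by_contra hξS
  obtain ⟨y, hy, hyc⟩ := h.exists_left ξ
  set A := insert y (S.filter fun p => p < ξ) with hA
  have hne : A.Nonempty := Finset.insert_nonempty _ _
  have hlt : A.max' hne < ξ := by
    rw [Finset.max'_lt_iff]
    intro p hp
    rcases Finset.mem_insert.1 hp with rfl | hp
    · exact hy
    · exact (Finset.mem_filter.1 hp).2
  have hle : y ≤ A.max' hne := A.le_max' y (Finset.mem_insert_self _ _)
  refine hξ ?_
  rw [leftLim_eq_of_const hy hyc, ← hyc _ ⟨hle, hlt⟩]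
  refine hS _ _ hlt.le fun p hp hpz => ?_
  have hpA : p ∈ A := by
    simp only [hA, Finset.mem_insert, Finset.mem_filter]
    exact Or.inr ⟨hp, lt_of_le_of_ne hpz.2 fun h => hξS (h ▸ hp)⟩
  exact absurd (A.le_max' p hpA) (not_le.2 hpz.1)

/-- The right derivative vanishes everywhere and, in the absence of jumps, the function is
continuous; hence it is constant. -/
theorem eq_of_no_jump (h : IsGridDatum ε w) {a b : ℝ} (hab : a ≤ b)
    (hj : ∀ z ∈ Ioc a b, Function.leftLim w z = w z) : w b = w a := by
  have hright : ∀ x, ContinuousWithinAt w (Ici x) x ∧ HasDerivWithinAt w 0 (Ici x) x := by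
    intro x
    obtain ⟨y, hy, hc⟩ := h.exists_right x
    have hev : w =ᶠ[nhdsWithin x (Ici x)] fun _ => w x := by
      filter_upwards [Ico_mem_nhdsGE hy] with z hz
      exact hc z hz
    have hd : HasDerivWithinAt w 0 (Ici x) x :=
      (hasDerivWithinAt_const x (Ici x) (w x)).congr_of_eventuallyEq hev rfl
    exact ⟨hd.continuousWithinAt, hd⟩
  refine constant_of_has_deriv_right_zero (f := w) (a := a) (b := b) (fun x hx => ?_)
    (fun x _ => (hright x).2) b ⟨hab, le_rfl⟩
  rcases eq_or_lt_of_le hx.1 with rfl | hax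
  · exact (hright a).1.mono Icc_subset_Ici_self
  · obtain ⟨y, hy, hc⟩ := h.exists_left x
    have hl := leftLim_eq_of_const hy hc
    rw [hj x ⟨hax, hx.2⟩] at hl
    have hleft : ContinuousWithinAt w (Iio x) x := by
      rw [ContinuousWithinAt, hl]
      refine tendsto_const_nhds.congr' ?_
      filter_upwards [Ico_mem_nhdsLT hy] with z hz
      exact (hc z hz).symm
    have := hleft.union (hright x).1
    rw [Iio_union_Ici] at this
    exact this.mono (subset_univ _)

theorem leftLim_eq_of_no_jump (h : IsGridDatum ε w) {a b : ℝ} (hab : a < b)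
    (hj : ∀ z ∈ Ioo a b, Function.leftLim w z = w z) : Function.leftLim w b = w a := by
  obtain ⟨y, hy, hc⟩ := h.exists_left b
  have hmax : max a y < b := max_lt hab hy
  rw [leftLim_eq_of_const hy hc, ← hc (max a y) ⟨le_max_right _ _, hmax⟩]
  exact h.eq_of_no_jump (le_max_left _ _) fun z hz => hj z ⟨hz.1, hz.2.trans_lt hmax⟩

/-- The datum factors through the monotone map counting exceptional points up to `x`, which has
finitely many values; a function on a finite set has bounded variation. -/
theorem boundedVariationOn (h : IsGridDatum ε w) : BoundedVariationOn w univ := by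
  obtain ⟨S, hS⟩ := h.piecewiseConst
  set r : ℝ → ℕ := fun x => (S.filter fun p => p ≤ x).card with hr
  have hmono : Monotone r := fun x y hxy =>
    Finset.card_le_card fun p hp => by
      rw [Finset.mem_filter] at hp ⊢
      exact ⟨hp.1, hp.2.trans hxy⟩
  have hle : ∀ x y, x ≤ y → r x = r y → w x = w y := by
    intro x y hxy hxr
    refine hS x y hxy fun p hp hpz => ?_
    have hsub : (S.filter fun p => p ≤ x) ⊂ S.filter fun p => p ≤ y := by
      rw [Finset.ssubset_iff_of_subset fun p hp => by
        rw [Finset.mem_filter] at hp ⊢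
        exact ⟨hp.1, hp.2.trans hxy⟩]
      exact ⟨p, by simp [hp, hpz.2], by simp [hpz.1]⟩
    exact (Finset.card_lt_card hsub).ne hxr
  have hdep : ∀ x y, r x = r y → w x = w y := fun x y hxr => by
    rcases le_total x y with hxy | hxy
    · exact hle x y hxy hxr
    · exact (hle y x hxy hxr.symm).symm
  have hcomp : w = (fun n => w (Function.invFun r n)) ∘ r := by
    funext x
    exact hdep _ _ (Function.invFun_eq (f := r) ⟨x, rfl⟩).symm
  have h1 := eVariationOn.comp_le_of_monotoneOn (fun n => w (Function.invFun r n))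
    (s := Iic S.card) (t := univ) r (hmono.monotoneOn _)
    fun x _ => Finset.card_le_card (Finset.filter_subset _ _)
  rw [← hcomp] at h1
  exact ne_top_of_le_ne_top (BoundedVariationOn.of_finite _ (Iic S.card)) h1

theorem exists_zero_left (h : IsGridDatum ε w) : ∃ a, ∀ x ≤ a, w x = 0 := by
  obtain ⟨R, hR⟩ := h.compactSupport.isCompact.isBounded.subset_closedBall 0
  refine ⟨-|R| - 1, fun x hx => ?_⟩
  by_contra hne
  have := hR (subset_tsupport _ hne)
  rw [Metric.mem_closedBall, Real.dist_eq, sub_zero] at this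
  have h1 := neg_abs_le x
  have h2 := le_abs_self R
  linarith

theorem exists_zero_right (h : IsGridDatum ε w) : ∃ a, ∀ x, a ≤ x → w x = 0 := by
  obtain ⟨R, hR⟩ := h.compactSupport.isCompact.isBounded.subset_closedBall 0
  refine ⟨|R| + 1, fun x hx => ?_⟩
  by_contra hne
  have := hR (subset_tsupport _ hne)
  rw [Metric.mem_closedBall, Real.dist_eq, sub_zero] at this
  have h1 := le_abs_self x
  have h2 := le_abs_self R
  linarith

end IsGridDatum

namespace WaveData

variable {D : WaveData}

/-! ### Total variation of the initial datum -/

theorem tv_add (hw : IsGridDatum D.ε D.w0) {a b : ℝ} (hab : a ≤ b) :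
    D.tv b = D.tv a + (eVariationOn D.w0 (Icc a b)).toReal := by
  have hb := hw.boundedVariationOn
  rw [tv, tv, ← Iic_union_Icc_eq_Iic hab, eVariationOn.union D.w0 (x := a) ⟨self_mem_Iic, fun _ h => h⟩
    ⟨left_mem_Icc.2 hab, fun _ h => h.1⟩, ENNReal.toReal_add (hb.mono (subset_univ _))
    (hb.mono (subset_univ _))]

theorem tv_mono (hw : IsGridDatum D.ε D.w0) {a b : ℝ} (hab : a ≤ b) : D.tv a ≤ D.tv b := by
  rw [tv_add hw hab]
  exact le_add_of_nonneg_right ENNReal.toReal_nonneg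

theorem abs_sub_le_tv (hw : IsGridDatum D.ε D.w0) {a b : ℝ} (hab : a ≤ b) :
    |D.w0 b - D.w0 a| ≤ D.tv b - D.tv a := by
  rw [tv_add hw hab, add_sub_cancel_left, ← Real.dist_eq]
  exact BoundedVariationOn.dist_le (hw.boundedVariationOn.mono (subset_univ _))
    (right_mem_Icc.2 hab) (left_mem_Icc.2 hab)

theorem tv_eq_of_const (hw : IsGridDatum D.ε D.w0) {a b : ℝ} (hab : a ≤ b)
    (h : ∀ z ∈ Icc a b, D.w0 z = D.w0 a) : D.tv b = D.tv a := by
  rw [tv_add hw hab, eVariationOn.constant_on, ENNReal.toReal_zero, add_zero]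
  rintro _ ⟨x, hx, rfl⟩ _ ⟨y, hy, rfl⟩
  rw [h x hx, h y hy]

theorem tv_jump (hw : IsGridDatum D.ε D.w0) {x y : ℝ} (hy : y < x)
    (h : ∀ z ∈ Ico y x, D.w0 z = D.w0 y) : D.tv x = D.tv y + |D.w0 x - D.w0 y| := by
  have hb := hw.boundedVariationOn
  have h0 : eVariationOn D.w0 (Ico y x) = 0 := by
    refine eVariationOn.constant_on ?_
    rintro _ ⟨p, hp, rfl⟩ _ ⟨q, hq, rfl⟩
    rw [h p hp, h q hq]
  have h1 : Iic y ∪ Ico y x = Iio x := by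
    ext z
    simp only [mem_union, mem_Iic, mem_Ico, mem_Iio]
    constructor
    · rintro (h | h)
      · linarith
      · exact h.2
    · intro h
      rcases le_total z y with h' | h'
      · exact Or.inl h'
      · exact Or.inr ⟨h', h⟩
  rw [tv, hb.eVariationOn_Iic_eq_Iio_add_edist, leftLim_eq_of_const hy h, ← h1,
    eVariationOn.union D.w0 (x := y) ⟨self_mem_Iic, fun _ h => h⟩
    ⟨left_mem_Ico.2 hy, fun _ h => h.1⟩, h0, add_zero,
    ENNReal.toReal_add (hb.mono (subset_univ _)) (edist_ne_top _ _), edist_dist,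
    ENNReal.toReal_ofReal dist_nonneg, Real.dist_eq, tv]

theorem tv_leftLim (hw : IsGridDatum D.ε D.w0) {x y : ℝ} (hy : y < x)
    (h : ∀ z ∈ Ico y x, D.w0 z = D.w0 y) :
    Function.leftLim D.tv x = D.tv y :=
  leftLim_eq_of_const hy fun _ hz =>
    tv_eq_of_const hw hz.1 fun p hp => h p ⟨hp.1, hp.2.trans_lt hz.2⟩

theorem tv_eq_zero (hw : IsGridDatum D.ε D.w0) : ∃ a, ∀ x ≤ a, D.tv x = 0 ∧ D.w0 x = 0 := by
  obtain ⟨a, ha⟩ := hw.exists_zero_left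
  refine ⟨a, fun x hx => ⟨?_, ha x hx⟩⟩
  rw [tv, eVariationOn.constant_on, ENNReal.toReal_zero]
  rintro _ ⟨p, hp, rfl⟩ _ ⟨q, hq, rfl⟩
  rw [ha p (le_trans hp hx), ha q (le_trans hq hx)]

theorem w0_eq_zero_of_tv (hw : IsGridDatum D.ε D.w0) {x : ℝ} (hx : D.tv x = 0) : D.w0 x = 0 := by
  obtain ⟨a, ha⟩ := tv_eq_zero hw
  have h1 := abs_sub_le_tv hw (min_le_left x a)
  rw [(ha _ (min_le_right x a)).1, (ha _ (min_le_right x a)).2, hx] at h1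
  simpa using h1

/-- The total variation takes values in the grid. -/
theorem tv_grid (hε : 0 < D.ε) (hw : IsGridDatum D.ε D.w0) (x : ℝ) : ∃ n : ℤ, D.tv x = n * D.ε := by
  -- The fractional part of `tv / ε` is locally constant, since jumps of the variation are integer
  -- multiples of `ε`. It vanishes far to the left, hence everywhere by connectedness.
  have hloc : IsLocallyConstant fun x => Int.fract (D.tv x / D.ε) := by
    rw [IsLocallyConstant.iff_eventually_eq]
    intro x
    obtain ⟨y, hy, hyc⟩ := hw.exists_left x
    obtain ⟨y', hy', hyc'⟩ := hw.exists_right x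
    filter_upwards [Ioo_mem_nhds hy hy'] with z hz
    rcases le_total x z with hxz | hxz
    · rw [tv_eq_of_const hw hxz fun p hp => hyc' p ⟨hp.1, hp.2.trans_lt hz.2⟩]
    · rcases eq_or_lt_of_le hxz with rfl | hxz
      · rfl
      · obtain ⟨m, hm⟩ := hw.grid x
        obtain ⟨m', hm'⟩ := hw.grid y
        rw [tv_jump hw hy hyc, ← tv_eq_of_const hw hz.1.le fun p hp =>
          hyc p ⟨hp.1, hp.2.trans_lt hxz⟩, hm, hm', ← sub_mul, abs_mul, abs_of_pos hε, add_div,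
          mul_div_cancel_right₀ _ hε.ne', ← Int.cast_sub, ← Int.cast_abs, Int.fract_add_intCast]
  obtain ⟨a, ha⟩ := tv_eq_zero hw
  have h1 := hloc.apply_eq_of_preconnectedSpace x a
  rw [(ha a le_rfl).1, zero_div, Int.fract_zero, Int.fract_eq_zero_iff] at h1
  obtain ⟨n, hn⟩ := h1
  exact ⟨n, by rw [hn, div_mul_cancel₀ _ hε.ne']⟩

theorem exists_tv_eq_total (hw : IsGridDatum D.ε D.w0) :
    ∃ x, D.tv x = (eVariationOn D.w0 univ).toReal := by
  obtain ⟨a, ha⟩ := hw.exists_zero_right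
  refine ⟨a, ?_⟩
  rw [tv, ← Iic_union_Ici (a := a), eVariationOn.union D.w0 (x := a) ⟨self_mem_Iic, fun _ h => h⟩
    ⟨self_mem_Ici, fun _ h => h⟩, eVariationOn.constant_on (s := Ici a), add_zero]
  rintro _ ⟨p, hp, rfl⟩ _ ⟨q, hq, rfl⟩
  rw [ha p hp, ha q hq]

/-! ### The waves at time zero -/

/-- The variation is constant just to the right of each point, so the infimum defining the position
is attained; membership in `waves` guarantees that the level `ε s` is reached at all. -/
theorem pos0_spec (hε : 0 < D.ε) (hw : IsGridDatum D.ε D.w0) {s : ℕ} (hs : s ∈ D.waves) :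
    D.ε * s ≤ D.tv (D.pos0 s) ∧ ∀ y < D.pos0 s, D.tv y < D.ε * s := by
  rw [waves, Finset.mem_Icc] at hs
  obtain ⟨b, hb⟩ := exists_tv_eq_total hw
  obtain ⟨a, ha⟩ := tv_eq_zero hw
  have hpos : 0 < D.ε * s := mul_pos hε (by exact_mod_cast hs.1)
  have hne : {x : ℝ | D.ε * s ≤ D.tv x}.Nonempty := by
    refine ⟨b, ?_⟩
    rw [mem_ofPred_eq, hb]
    have := (Nat.le_floor_iff (div_nonneg ENNReal.toReal_nonneg hε.le)).1 hs.2
    rwa [le_div_iff₀ hε, mul_comm] at this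
  have hbdd : BddBelow {x : ℝ | D.ε * s ≤ D.tv x} := by
    refine ⟨a, fun x hx => ?_⟩
    by_contra! h
    rw [mem_ofPred_eq, (ha x h.le).1] at hx
    linarith
  refine ⟨?_, fun y hy => ?_⟩
  · by_contra! h
    obtain ⟨y, hy, hyc⟩ := hw.exists_right (D.pos0 s)
    have : y ≤ D.pos0 s := le_csInf hne fun x hx => by
      by_contra! hxy
      rcases le_total x (D.pos0 s) with h1 | h1
      · exact absurd (hx.out.trans (tv_mono hw h1)) (not_le.2 h)
      · refine absurd hx.out (not_le.2 ?_)
        rwa [tv_eq_of_const hw h1 fun p hp => hyc p ⟨hp.1, hp.2.trans_lt hxy⟩]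
    linarith
  · by_contra! h
    exact absurd (csInf_le hbdd h) (not_le.2 hy)

theorem pos0_mono (hε : 0 < D.ε) (hw : IsGridDatum D.ε D.w0) {s r : ℕ} (hs : s ∈ D.waves)
    (hr : r ∈ D.waves) (hsr : s ≤ r) : D.pos0 s ≤ D.pos0 r := by
  by_contra! h
  have h1 := (pos0_spec hε hw hs).2 _ h
  have h2 := (pos0_spec hε hw hr).1
  have : (s : ℝ) ≤ r := by exact_mod_cast hsr
  nlinarith

/-- The values of the datum and of its total variation around the initial position of a wave. -/
theorem wave_spec (hε : 0 < D.ε) (hw : IsGridDatum D.ε D.w0) {s : ℕ} (hs : s ∈ D.waves) :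
    ∃ y < D.pos0 s, (∀ z ∈ Ico y (D.pos0 s), D.w0 z = D.w0 y) ∧ D.tv y ≤ D.ε * (s - 1) ∧
      D.tv (D.pos0 s) = D.tv y + |D.w0 (D.pos0 s) - D.w0 y| ∧
      D.sgn s = Real.sign (D.w0 (D.pos0 s) - D.w0 y) ∧
      D.hatw s = D.w0 y + D.sgn s * (D.ε * s - D.tv y) ∧ D.w0 (D.pos0 s) - D.w0 y ≠ 0 := by
  obtain ⟨y, hy, hyc⟩ := hw.exists_left (D.pos0 s)
  obtain ⟨h1, h2⟩ := pos0_spec hε hw hs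
  have h3 := tv_jump hw hy hyc
  have h4 := h2 y hy
  refine ⟨y, hy, hyc, ?_, h3, ?_, ?_, fun h => ?_⟩
  -- Off by one: `tv y` is a multiple of `ε` strictly below `ε s`, hence at most `ε (s - 1)`.
  · obtain ⟨n, hn⟩ := tv_grid hε hw y
    rw [hn, mul_comm, mul_lt_mul_iff_right₀ hε] at h4
    have h5 : n < (s : ℤ) := by exact_mod_cast h4
    have h6 : (n : ℝ) ≤ s - 1 := by
      have : n ≤ (s : ℤ) - 1 := by omega
      exact_mod_cast this
    rw [hn, mul_comm]
    exact mul_le_mul_of_nonneg_left h6 hε.le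
  · rw [sgn, leftLim_eq_of_const hy hyc]
  · rw [hatw, leftLim_eq_of_const hy hyc, tv_leftLim hw hy hyc]
  · rw [h, abs_zero, add_zero] at h3
    linarith

theorem sgn_eq (hε : 0 < D.ε) (hw : IsGridDatum D.ε D.w0) {s : ℕ} (hs : s ∈ D.waves) :
    D.sgn s = 1 ∨ D.sgn s = -1 := by
  obtain ⟨y, -, -, -, -, h, -, hne⟩ := wave_spec hε hw hs
  rw [h]
  rcases lt_or_gt_of_ne hne with h | h
  · exact Or.inr (Real.sign_of_neg h)
  · exact Or.inl (Real.sign_of_pos h)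

theorem sign_mul_abs (x : ℝ) : Real.sign x * |x| = x := by
  rcases lt_trichotomy x 0 with h | h | h
  · rw [Real.sign_of_neg h, abs_of_neg h]; ring
  · simp [h]
  · rw [Real.sign_of_pos h, abs_of_pos h]; ring

/-- The variation does not grow between the position of `s` and `z`, so neither does the datum
change, and `s` is the last wave of its jump. -/
theorem hatw_eq_of_tv (hε : 0 < D.ε) (hw : IsGridDatum D.ε D.w0) {s : ℕ} (hs : s ∈ D.waves) {z : ℝ}
    (hz : D.tv z = D.ε * s) : D.w0 z = D.hatw s := by
  obtain ⟨y, hy, hyc, h1, h2, h3, h4, h5⟩ := wave_spec hε hw hs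
  obtain ⟨h6, h7⟩ := pos0_spec hε hw hs
  have hxz : D.pos0 s ≤ z := by
    by_contra! h
    exact (h7 z h).ne hz
  have h8 := tv_mono hw hxz
  have h9 : D.tv (D.pos0 s) = D.tv z := by linarith
  have h10 := abs_sub_le_tv hw hxz
  rw [h9, sub_self, abs_nonpos_iff, sub_eq_zero] at h10
  rw [h10, h4, ← hz, ← h9, h2, add_sub_cancel_left, h3, sign_mul_abs]
  ring

theorem hatw_one (hε : 0 < D.ε) (hw : IsGridDatum D.ε D.w0) (hs : 1 ∈ D.waves) :
    D.hatw 1 = D.ε * D.sgn 1 := by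
  obtain ⟨y, hy, hyc, h1, h2, h3, h4, h5⟩ := wave_spec hε hw hs
  have h6 : D.tv y = 0 := by
    refine le_antisymm (by simpa using h1) ENNReal.toReal_nonneg
  rw [h4, h6, w0_eq_zero_of_tv hw h6]
  push_cast
  ring

theorem hatw_succ (hε : 0 < D.ε) (hw : IsGridDatum D.ε D.w0) {s : ℕ} (hs : s ∈ D.waves)
    (hs' : s + 1 ∈ D.waves) : D.hatw (s + 1) = D.hatw s + D.ε * D.sgn (s + 1) := by
  obtain ⟨y, hy, hyc, h1, h2, h3, h4, h5⟩ := wave_spec hε hw hs'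
  push_cast at h1 h4
  rw [add_sub_cancel_right] at h1
  -- Either the jump carrying wave `s + 1` starts exactly at level `ε s`, where the datum is `hatw
  -- s`, or that level is interior to the jump and both waves share position and sign.
  rcases eq_or_lt_of_le h1 with h | h
  · rw [h4, h, hatw_eq_of_tv hε hw hs h]
    ring
  · have hpos : D.pos0 s = D.pos0 (s + 1) := by
      refine le_antisymm (pos0_mono hε hw hs hs' (Nat.le_succ s)) ?_
      by_contra! hlt
      have h6 := (pos0_spec hε hw hs).1
      have h7 : D.tv (D.pos0 s) ≤ D.tv y := by
        rcases le_total (D.pos0 s) y with h8 | h8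
        · exact tv_mono hw h8
        · exact (tv_eq_of_const hw h8 fun p hp => hyc p ⟨hp.1, hp.2.trans_lt hlt⟩).le
      linarith
    rw [hatw, hatw, hpos, sgn, sgn, hpos]
    push_cast
    ring

/-- Right states telescope along consecutive waves. This is the initial case of the field `hatw` of
`Inv`. -/
theorem hatw_eq_sum (hε : 0 < D.ε) (hw : IsGridDatum D.ε D.w0) {s : ℕ} (hs : s ∈ D.waves) :
    D.hatw s = D.ε * ∑ r ∈ D.waves.filter (fun r => r ≤ s), D.sgn r := by
  have hIcc : D.waves.filter (fun r => r ≤ s) = Finset.Icc 1 s := by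
    rw [waves, Finset.mem_Icc] at hs
    ext r
    simp only [waves, Finset.mem_filter, Finset.mem_Icc]
    omega
  rw [hIcc]
  clear hIcc
  have h1 : 1 ≤ s := (Finset.mem_Icc.1 hs).1
  induction s, h1 using Nat.le_induction with
  | base => simpa using hatw_one hε hw hs
  | succ s h1 ih =>
    have hs' : s ∈ D.waves := by
      rw [waves, Finset.mem_Icc] at hs ⊢
      omega
    rw [hatw_succ hε hw hs' hs, ih hs', Finset.sum_Icc_succ_top (by omega)]
    ring

/-- Both ends of a segment lie between the two values of the datum at its jump; this is what lets
the hypothesis on `∂_w f` act on wave speeds. -/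
theorem hatw_mem_hull (hε : 0 < D.ε) (hw : IsGridDatum D.ε D.w0) {s : ℕ} (hs : s ∈ D.waves) :
    D.hatw s ∈ convexHull ℝ (Set.range D.w0) ∧
      D.hatw s - D.ε * D.sgn s ∈ convexHull ℝ (Set.range D.w0) := by
  obtain ⟨y, hy, hyc, h1, h2, h3, h4, h5⟩ := wave_spec hε hw hs
  have h6 := (pos0_spec hε hw hs).1
  set x := D.pos0 s
  set a := |D.w0 x - D.w0 y| with ha
  have ha0 : 0 < a := abs_pos.2 h5
  have key : ∀ t, 0 ≤ t → t ≤ a → D.w0 y + D.sgn s * t ∈ convexHull ℝ (Set.range D.w0) := by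
    intro t ht0 hta
    have h7 : D.w0 y + D.sgn s * t = (1 - t / a) • D.w0 y + (t / a) • D.w0 x := by
      have h8 : D.w0 x - D.w0 y = D.sgn s * a := by rw [h3, ha, sign_mul_abs]
      have h9 : D.w0 x = D.w0 y + D.sgn s * a := by linarith
      rw [h9]
      simp only [smul_eq_mul]
      field_simp
      ring
    rw [h7]
    refine convex_convexHull ℝ _ (subset_convexHull ℝ _ (Set.mem_range_self y))
      (subset_convexHull ℝ _ (Set.mem_range_self x)) ?_ (div_nonneg ht0 ha0.le) (by ring)
    rw [sub_nonneg, div_le_one ha0]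
    exact hta
  constructor
  · rw [h4]
    exact key _ (by nlinarith) (by linarith)
  · have h7 := key (D.ε * (s - 1) - D.tv y) (by linarith) (by nlinarith)
    rw [h4]
    convert h7 using 1
    ring

end WaveData

namespace WaveData

variable {D : WaveData}

/-! ### Blocks of waves -/

/-- The index of the grid cell occupied by the wave `s`. -/
def cell (D : WaveData) (s : ℕ) : ℤ := ⌊(D.hatw s - D.sgn s * (D.ε / 2)) / D.ε⌋

/-- The properties of the states of the wavefront solution at the collision times. -/
structure Inv (D : WaveData) (S : WaveState) : Prop where
  sub : S.alive ⊆ D.waves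
  mono : ∀ r ∈ S.alive, ∀ q ∈ S.alive, r ≤ q → S.pos r ≤ S.pos q
  homog : ∀ r ∈ S.alive, ∀ q ∈ S.alive, S.pos r = S.pos q → D.sgn r = D.sgn q
  hatw : ∀ s ∈ S.alive, D.hatw s = D.ε * ∑ r ∈ S.alive.filter (fun r => r ≤ s), D.sgn r

/-- `A` consists of waves of sign `c`, whose segments fill the grid cells from `m` to `n - 1`, in
increasing order if `c = 1` and in decreasing order if `c = -1`. -/
structure Block (D : WaveData) (c : ℝ) (A : Finset ℕ) (m n : ℤ) : Prop where
  lt : m < n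
  sgn : ∀ s ∈ A, D.sgn s = c
  hatw : ∀ s ∈ A, D.hatw s = D.cell s * D.ε + D.ε / 2 + c * (D.ε / 2)
  mono : ∀ r ∈ A, ∀ q ∈ A, r < q → c * D.cell r < c * D.cell q
  image : A.image D.cell = Finset.Ico m n

theorem exists_int_sum {A : Finset ℕ} {φ : ℕ → ℝ} (h : ∀ s ∈ A, φ s = 1 ∨ φ s = -1) :
    ∃ z : ℤ, ∑ s ∈ A, φ s = z := by
  induction A using Finset.induction_on with
  | empty => exact ⟨0, by simp⟩
  | insert a A ha ih =>
    obtain ⟨z, hz⟩ := ih fun s hs => h s (Finset.mem_insert_of_mem hs)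
    rw [Finset.sum_insert ha, hz]
    rcases h a (Finset.mem_insert_self _ _) with h | h
    · exact ⟨1 + z, by rw [h]; push_cast; ring⟩
    · exact ⟨-1 + z, by rw [h]; push_cast; ring⟩

namespace Inv

variable {S : WaveState}

theorem start (hε : 0 < D.ε) (hw : IsGridDatum D.ε D.w0) : D.Inv D.start where
  sub := subset_rfl
  mono := fun _ hr _ hq hrq => pos0_mono hε hw hr hq hrq
  homog := fun r _ q _ h => by
    change D.pos0 r = D.pos0 q at h
    rw [sgn, sgn, h]
  hatw := fun _ hs => hatw_eq_sum hε hw hs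

theorem sgn_eq (h : D.Inv S) (hε : 0 < D.ε) (hw : IsGridDatum D.ε D.w0) {s : ℕ}
    (hs : s ∈ S.alive) : D.sgn s = 1 ∨ D.sgn s = -1 :=
  WaveData.sgn_eq hε hw (h.sub hs)

/-- The right state is `ε` times a sum of signs, hence a grid point. Since `cell` is read off at the
midpoint of the segment, the formula is uniform in the sign. -/
theorem hatw_cell (h : D.Inv S) (hε : 0 < D.ε) (hw : IsGridDatum D.ε D.w0) {s : ℕ}
    (hs : s ∈ S.alive) : D.hatw s = D.cell s * D.ε + D.ε / 2 + D.sgn s * (D.ε / 2) := by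
  obtain ⟨z, hz⟩ := exists_int_sum (A := S.alive.filter fun r => r ≤ s) (φ := D.sgn)
    fun r hr => h.sgn_eq hε hw (Finset.mem_filter.1 hr).1
  have h1 := h.hatw s hs
  rw [hz] at h1
  rcases h.sgn_eq hε hw hs with h2 | h2
  · have : D.cell s = z - 1 := by
      rw [cell, h1, h2, Int.floor_eq_iff]
      push_cast
      rw [le_div_iff₀ hε, div_lt_iff₀ hε]
      constructor <;> nlinarith
    rw [this, h1, h2]
    push_cast
    ring
  · have : D.cell s = z := by
      rw [cell, h1, h2, Int.floor_eq_iff, le_div_iff₀ hε, div_lt_iff₀ hε]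
      constructor <;> nlinarith
    rw [this, h1, h2]
    ring

/-- The right states of two waves, in a set of waves of the same sign. -/
theorem cell_sub (h : D.Inv S) (hε : 0 < D.ε) (hw : IsGridDatum D.ε D.w0) {c : ℝ} {r q : ℕ}
    (hr : r ∈ S.alive) (hq : q ∈ S.alive) (hrq : r ≤ q)
    (hc : ∀ p ∈ S.alive, r ≤ p → p ≤ q → D.sgn p = c) :
    (D.cell q : ℝ) - D.cell r = c * (S.alive.filter fun p => r < p ∧ p ≤ q).card := by
  have h1 := h.hatw q hq
  have h2 := h.hatw r hr
  have hsplit : S.alive.filter (fun p => p ≤ q) =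
      S.alive.filter (fun p => p ≤ r) ∪ S.alive.filter (fun p => r < p ∧ p ≤ q) := by
    ext p
    simp only [Finset.mem_filter, Finset.mem_union, ← and_or_left]
    refine and_congr_right fun _ => ?_
    omega
  have hdisj : Disjoint (S.alive.filter fun p => p ≤ r)
      (S.alive.filter fun p => r < p ∧ p ≤ q) := by
    rw [Finset.disjoint_filter]
    intros
    omega
  have hsum : ∑ p ∈ S.alive.filter (fun p => r < p ∧ p ≤ q), D.sgn p =
      c * (S.alive.filter fun p => r < p ∧ p ≤ q).card := by
    rw [Finset.sum_congr rfl fun p hp => hc p (Finset.mem_filter.1 hp).1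
      (Finset.mem_filter.1 hp).2.1.le (Finset.mem_filter.1 hp).2.2, Finset.sum_const, nsmul_eq_mul]
    ring
  rw [hsplit, Finset.sum_union hdisj, hsum, mul_add, ← h2, h.hatw_cell hε hw hq,
    h.hatw_cell hε hw hr, hc q hq hrq le_rfl, hc r hr le_rfl hrq] at h1
  have h3 : ((D.cell q : ℝ) - D.cell r) * D.ε =
      (c * (S.alive.filter fun p => r < p ∧ p ≤ q).card) * D.ε := by linarith
  exact mul_right_cancel₀ hε.ne' h3

/-- Along consecutive living waves of one sign the partial sums move by one grid step per wave,
always in the same direction. The cells are then distinct, lie between those of the first and last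
wave, and are as many as the integers there, so none is missed. -/
theorem block (h : D.Inv S) (hε : 0 < D.ε) (hw : IsGridDatum D.ε D.w0) {c : ℝ}
    (hc : c = 1 ∨ c = -1) {A : Finset ℕ}
    (hA : A ⊆ S.alive) (hne : A.Nonempty) (hs : ∀ s ∈ A, D.sgn s = c)
    (hconv : ∀ r ∈ A, ∀ q ∈ A, ∀ p ∈ S.alive, r < p → p < q → p ∈ A) :
    ∃ m n, D.Block c A m n := by
  have hmem : ∀ r ∈ A, ∀ q ∈ A, ∀ p ∈ S.alive, r ≤ p → p ≤ q → p ∈ A := by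
    intro r hr q hq p hp h1 h2
    rcases eq_or_lt_of_le h1 with rfl | h1
    · exact hr
    rcases eq_or_lt_of_le h2 with rfl | h2
    · exact hq
    exact hconv r hr q hq p hp h1 h2
  have hsub : ∀ r ∈ A, ∀ q ∈ A, r ≤ q →
      (D.cell q : ℝ) - D.cell r = c * (S.alive.filter fun p => r < p ∧ p ≤ q).card :=
    fun r hr q hq hrq => h.cell_sub hε hw (hA hr) (hA hq) hrq
      fun p hp h1 h2 => hs p (hmem r hr q hq p hp h1 h2)
  have hcc : c * c = 1 := by rcases hc with rfl | rfl <;> norm_num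
  have hmono : ∀ r ∈ A, ∀ q ∈ A, r < q → c * D.cell r < c * D.cell q := by
    intro r hr q hq hrq
    have h1 := hsub r hr q hq hrq.le
    have h2 : 0 < (S.alive.filter fun p => r < p ∧ p ≤ q).card :=
      Finset.card_pos.2 ⟨q, by simp [hA hq, hrq]⟩
    have h3 : (0 : ℝ) < (S.alive.filter fun p => r < p ∧ p ≤ q).card := by exact_mod_cast h2
    have h4 : c * D.cell q - c * D.cell r =
        (S.alive.filter fun p => r < p ∧ p ≤ q).card := by
      rw [← mul_sub, h1, ← mul_assoc, hcc, one_mul]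
    linarith
  have hinj : ∀ r ∈ A, ∀ q ∈ A, D.cell r = D.cell q → r = q := by
    intro r hr q hq h1
    rcases lt_trichotomy r q with h2 | h2 | h2
    · have := hmono r hr q hq h2
      rw [h1] at this
      exact absurd this (lt_irrefl _)
    · exact h2
    · have := hmono q hq r hr h2
      rw [h1] at this
      exact absurd this (lt_irrefl _)
  have ha := A.min'_mem hne
  have hb := A.max'_mem hne
  set a := A.min' hne with ha_def
  set b := A.max' hne with hb_def
  have hab : a ≤ b := A.min'_le _ hb
  have hcard : (S.alive.filter fun p => a < p ∧ p ≤ b).card + 1 = A.card := by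
    have : S.alive.filter (fun p => a < p ∧ p ≤ b) = A.erase a := by
      ext p
      simp only [Finset.mem_filter, Finset.mem_erase]
      constructor
      · rintro ⟨h1, h2, h3⟩
        exact ⟨h2.ne', hmem a ha b hb p h1 h2.le h3⟩
      · rintro ⟨h1, h2⟩
        exact ⟨hA h2, lt_of_le_of_ne (A.min'_le _ h2) (Ne.symm h1), A.le_max' _ h2⟩
    rw [this, Finset.card_erase_add_one ha]
  have h1 := hsub a ha b hb hab
  have hmono' : ∀ r ∈ A, ∀ q ∈ A, r ≤ q → c * D.cell r ≤ c * D.cell q := by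
    intro r hr q hq hrq
    rcases eq_or_lt_of_le hrq with rfl | hrq
    · exact le_rfl
    · exact (hmono r hr q hq hrq).le
  have hcardi : (A.image D.cell).card = A.card := Finset.card_image_of_injOn fun r hr q hq => hinj r hr q hq
  have hhat : ∀ s ∈ A, D.hatw s = D.cell s * D.ε + D.ε / 2 + c * (D.ε / 2) := fun s h2 => by
    rw [h.hatw_cell hε hw (hA h2), hs s h2]
  rcases hc with rfl | rfl
  · have h2 : D.cell b - D.cell a = (S.alive.filter fun p => a < p ∧ p ≤ b).card := by
      rw [one_mul] at h1
      exact_mod_cast h1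
    refine ⟨D.cell a, D.cell b + 1, by omega, hs, hhat, hmono, ?_⟩
    refine Finset.eq_of_subset_of_card_le (fun k hk => ?_) ?_
    · obtain ⟨r, hr, rfl⟩ := Finset.mem_image.1 hk
      have h3 := hmono' a ha r hr (A.min'_le _ hr)
      have h4 := hmono' r hr b hb (A.le_max' _ hr)
      rw [one_mul, one_mul, Int.cast_le] at h3 h4
      rw [Finset.mem_Ico]
      omega
    · rw [hcardi, Int.card_Ico]
      omega
  · have h2 : D.cell a - D.cell b = (S.alive.filter fun p => a < p ∧ p ≤ b).card := by
      have : (D.cell a : ℝ) - D.cell b = (S.alive.filter fun p => a < p ∧ p ≤ b).card := by linarith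
      exact_mod_cast this
    refine ⟨D.cell b, D.cell a + 1, by omega, hs, hhat, hmono, ?_⟩
    refine Finset.eq_of_subset_of_card_le (fun k hk => ?_) ?_
    · obtain ⟨r, hr, rfl⟩ := Finset.mem_image.1 hk
      have h3 := hmono' a ha r hr (A.min'_le _ hr)
      have h4 := hmono' r hr b hb (A.le_max' _ hr)
      rw [neg_one_mul, neg_one_mul, neg_le_neg_iff, Int.cast_le] at h3 h4
      rw [Finset.mem_Ico]
      omega
    · rw [hcardi, Int.card_Ico]
      omega

end Inv

/-! ### Segments and entropic speeds of a block of waves -/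

namespace Block

variable {c : ℝ} {A : Finset ℕ} {m n : ℤ}

theorem cell_mem (h : D.Block c A m n) {s : ℕ} (hs : s ∈ A) : m ≤ D.cell s ∧ D.cell s < n :=
  Finset.mem_Ico.1 (h.image ▸ Finset.mem_image_of_mem _ hs)

theorem exists_cell_eq (h : D.Block c A m n) {k : ℤ} (hm : m ≤ k) (hn : k < n) :
    ∃ s ∈ A, D.cell s = k :=
  Finset.mem_image.1 (h.image ▸ Finset.mem_Ico.2 ⟨hm, hn⟩)

theorem cell_lt (h : D.Block 1 A m n) {r q : ℕ} (hr : r ∈ A) (hq : q ∈ A) :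
    D.cell r < D.cell q ↔ r < q := by
  have key : ∀ r ∈ A, ∀ q ∈ A, r < q → D.cell r < D.cell q := fun r hr q hq hrq => by
    simpa using h.mono r hr q hq hrq
  refine ⟨fun h1 => ?_, key r hr q hq⟩
  by_contra! h2
  rcases eq_or_lt_of_le h2 with rfl | h2
  · omega
  · have := key q hq r hr h2
    omega

theorem cell_le (h : D.Block 1 A m n) {r q : ℕ} (hr : r ∈ A) (hq : q ∈ A) :
    D.cell r ≤ D.cell q ↔ r ≤ q := by
  have := h.cell_lt hq hr
  omega

theorem of_image (h : D.Block c A m n) {B : Finset ℕ} (hB : B ⊆ A) {m' n' : ℤ} (hlt : m' < n')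
    (himg : B.image D.cell = Finset.Ico m' n') : D.Block c B m' n' :=
  ⟨hlt, fun s hs => h.sgn s (hB hs), fun s hs => h.hatw s (hB hs),
    fun r hr q hq => h.mono r (hB hr) q (hB hq), himg⟩

theorem le_of_subset (h : D.Block c A m n) {B : Finset ℕ} {m' n' : ℤ} (h' : D.Block c B m' n')
    (hB : B ⊆ A) : m ≤ m' ∧ n' ≤ n := by
  obtain ⟨r, hr, hr'⟩ := h'.exists_cell_eq le_rfl h'.lt
  obtain ⟨q, hq, hq'⟩ := h'.exists_cell_eq (k := n' - 1) (by have := h'.lt; omega) (by omega)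
  have h1 := h.cell_mem (hB hr)
  have h2 := h.cell_mem (hB hq)
  omega

theorem seg_pos (h : D.Block 1 A m n) {s : ℕ} (hs : s ∈ A) :
    D.seg s = Ioc (D.cell s * D.ε) ((D.cell s + 1) * D.ε) := by
  have h1 : D.hatw s = (D.cell s + 1) * D.ε := by rw [h.hatw s hs]; ring
  rw [seg, h.sgn s hs, if_pos one_pos, h1]
  congr 1
  ring

theorem seg_neg (h : D.Block (-1) A m n) {s : ℕ} (hs : s ∈ A) :
    D.seg s = Ico (D.cell s * D.ε) ((D.cell s + 1) * D.ε) := by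
  have h1 : D.hatw s = D.cell s * D.ε := by rw [h.hatw s hs]; ring
  rw [seg, h.sgn s hs, if_neg (by norm_num), h1]
  congr 1
  ring

theorem segs_pos (h : D.Block 1 A m n) (hε : 0 < D.ε) : D.segs A = Ioc (m * D.ε) (n * D.ε) := by
  ext w
  simp only [segs, mem_iUnion, exists_prop]
  constructor
  · rintro ⟨s, hs, hws⟩
    rw [h.seg_pos hs] at hws
    obtain ⟨h1, h2⟩ := h.cell_mem hs
    have h3 := (grid_mem_Icc hε h1 h2.le).1
    have h4 := (grid_mem_Icc hε (m := m) (n := n) (k := D.cell s + 1) (by omega) (by omega)).2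
    push_cast at h4
    exact ⟨h3.trans_lt hws.1, hws.2.trans h4⟩
  · intro hw
    have h1 := Int.ceil_lt_add_one (w / D.ε)
    have h2 := Int.le_ceil (w / D.ε)
    rw [div_le_iff₀ hε] at h2
    have h3 : (⌈w / D.ε⌉ - 1 : ℝ) * D.ε < w := by
      rw [← lt_div_iff₀ hε]
      linarith
    have h4 : m < ⌈w / D.ε⌉ := by
      rw [Int.lt_ceil, lt_div_iff₀ hε]
      exact hw.1
    have h5 : ⌈w / D.ε⌉ ≤ n := by
      rw [Int.ceil_le, div_le_iff₀ hε]
      exact hw.2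
    obtain ⟨s, hs, hsk⟩ := h.exists_cell_eq (k := ⌈w / D.ε⌉ - 1) (by omega) (by omega)
    refine ⟨s, hs, ?_⟩
    rw [h.seg_pos hs, hsk]
    push_cast
    rw [sub_add_cancel]
    exact ⟨h3, h2⟩

theorem segs_neg (h : D.Block (-1) A m n) (hε : 0 < D.ε) : D.segs A = Ico (m * D.ε) (n * D.ε) := by
  ext w
  simp only [segs, mem_iUnion, exists_prop]
  constructor
  · rintro ⟨s, hs, hws⟩
    rw [h.seg_neg hs] at hws
    obtain ⟨h1, h2⟩ := h.cell_mem hs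
    have h3 := (grid_mem_Icc hε h1 h2.le).1
    have h4 := (grid_mem_Icc hε (m := m) (n := n) (k := D.cell s + 1) (by omega) (by omega)).2
    push_cast at h4
    exact ⟨h3.trans hws.1, hws.2.trans_le h4⟩
  · intro hw
    have h1 := Int.lt_floor_add_one (w / D.ε)
    have h2 := Int.floor_le (w / D.ε)
    rw [le_div_iff₀ hε] at h2
    rw [div_lt_iff₀ hε] at h1
    have h4 : m ≤ ⌊w / D.ε⌋ := by
      rw [Int.le_floor, le_div_iff₀ hε]
      exact hw.1
    have h5 : ⌊w / D.ε⌋ < n := by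
      rw [Int.floor_lt, div_lt_iff₀ hε]
      exact hw.2
    obtain ⟨s, hs, hsk⟩ := h.exists_cell_eq h4 h5
    refine ⟨s, hs, ?_⟩
    rw [h.seg_neg hs, hsk]
    exact ⟨h2, h1⟩

theorem grid_lt (h : D.Block c A m n) (hε : 0 < D.ε) : (m : ℝ) * D.ε < n * D.ε :=
  mul_lt_mul_of_pos_right (by exact_mod_cast h.lt) hε

theorem inf_sup_pos (h : D.Block 1 A m n) (hε : 0 < D.ε) :
    sInf (D.segs A) = m * D.ε ∧ sSup (D.segs A) = n * D.ε := by
  rw [h.segs_pos hε]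
  exact ⟨csInf_Ioc (h.grid_lt hε), csSup_Ioc (h.grid_lt hε)⟩

theorem inf_sup_neg (h : D.Block (-1) A m n) (hε : 0 < D.ε) :
    sInf (D.segs A) = m * D.ε ∧ sSup (D.segs A) = n * D.ε := by
  rw [h.segs_neg hε]
  exact ⟨csInf_Ico (h.grid_lt hε), csSup_Ico (h.grid_lt hε)⟩

theorem sigmaRH_eq (h : D.Block 1 A m n) (hε : 0 < D.ε) (g : ℝ → ℝ) :
    D.sigmaRH g A = (g (n * D.ε) - g (m * D.ε)) / (n * D.ε - m * D.ε) := by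
  rw [sigmaRH, rhSpeed, (h.inf_sup_pos hε).1, (h.inf_sup_pos hε).2]

theorem exists_env_pos (h : D.Block 1 A m n) (hε : 0 < D.ε) (g : ℝ → ℝ) :
    ∃ e : ℤ → ℝ, GridEnv (fun k => g (k * D.ε)) e m n ∧ ∀ s ∈ A,
      D.sigmaEnt g A s = (e (D.cell s + 1) - e (D.cell s)) / D.ε := by
  obtain ⟨e, h1, h2⟩ := convEnv_interp hε g h.lt
  refine ⟨e, h1, fun s hs => ?_⟩
  obtain ⟨h3, h4⟩ := h.cell_mem hs
  rw [← h2 _ h3 h4, sigmaEnt, h.sgn s hs, if_pos one_pos, (h.inf_sup_pos hε).1,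
    (h.inf_sup_pos hε).2, h.hatw s hs]
  congr 1
  ring

theorem exists_env_neg (h : D.Block (-1) A m n) (hε : 0 < D.ε) (g : ℝ → ℝ) :
    ∃ e : ℤ → ℝ, GridEnv (fun k => -g (k * D.ε)) e m n ∧ ∀ s ∈ A,
      D.sigmaEnt g A s = -((e (D.cell s + 1) - e (D.cell s)) / D.ε) := by
  obtain ⟨e, h1, h2⟩ := concEnv_interp hε g h.lt
  refine ⟨e, h1, fun s hs => ?_⟩
  obtain ⟨h3, h4⟩ := h.cell_mem hs
  rw [← h2 _ h3 h4, sigmaEnt, h.sgn s hs, if_neg (by norm_num), (h.inf_sup_neg hε).1,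
    (h.inf_sup_neg hε).2, h.hatw s hs]
  congr 1
  ring

/-- For negative waves the cells are in reverse order and the slopes of a concave envelope decrease,
so in both cases speeds do not decrease with the wave label. -/
theorem sigmaEnt_mono (h : D.Block c A m n) (hc : c = 1 ∨ c = -1) (hε : 0 < D.ε) (g : ℝ → ℝ)
    {r q : ℕ} (hr : r ∈ A) (hq : q ∈ A) (hrq : r < q) :
    D.sigmaEnt g A r ≤ D.sigmaEnt g A q := by
  have h1 := h.mono r hr q hq hrq
  have h2 := h.cell_mem hr
  have h3 := h.cell_mem hq
  rcases hc with rfl | rfl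
  · obtain ⟨e, he, hs⟩ := h.exists_env_pos hε g
    rw [hs r hr, hs q hq]
    rw [one_mul, one_mul, Int.cast_lt] at h1
    exact div_le_div_of_nonneg_right (he.mono h2.1 h1.le h3.2) hε.le
  · obtain ⟨e, he, hs⟩ := h.exists_env_neg hε g
    rw [hs r hr, hs q hq]
    rw [neg_one_mul, neg_one_mul, neg_lt_neg_iff, Int.cast_lt] at h1
    exact neg_le_neg (div_le_div_of_nonneg_right (he.mono h3.1 h1.le h2.2) hε.le)

/-- The entropic speeds are mean slopes of the flux between two grid points. -/
theorem exists_sigmaEnt_eq_slope (h : D.Block c A m n) (hc : c = 1 ∨ c = -1) (hε : 0 < D.ε)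
    (g : ℝ → ℝ) {s : ℕ} (hs : s ∈ A) :
    ∃ k l : ℤ, m ≤ k ∧ k < l ∧ l ≤ n ∧
      D.sigmaEnt g A s = (g (l * D.ε) - g (k * D.ε)) / (l * D.ε - k * D.ε) := by
  have h2 := h.cell_mem hs
  rcases hc with rfl | rfl
  · obtain ⟨e, he, hsig⟩ := h.exists_env_pos hε g
    obtain ⟨k, l, hk, h3, h4, hl, hek, hel, hcls⟩ := he.exists_class h2.1 h2.2
    refine ⟨k, l, hk, by omega, hl, ?_⟩
    have h5 := GridEnv.affine_of_slopes (e := e) (c := k) (d := l) (l := l) (by omega) le_rfl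
      fun i h5 h6 => (hcls i (by omega) (by omega)).2 ⟨h5, h6⟩
    rw [hek, hel] at h5
    have hkl : (k : ℝ) < l := by exact_mod_cast (show k < l by omega)
    rw [hsig s hs, h5, ← sub_mul, add_sub_cancel_left]
    have := sub_pos.2 hkl
    field_simp
  · obtain ⟨e, he, hsig⟩ := h.exists_env_neg hε g
    obtain ⟨k, l, hk, h3, h4, hl, hek, hel, hcls⟩ := he.exists_class h2.1 h2.2
    refine ⟨k, l, hk, by omega, hl, ?_⟩
    have h5 := GridEnv.affine_of_slopes (e := e) (c := k) (d := l) (l := l) (by omega) le_rfl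
      fun i h5 h6 => (hcls i (by omega) (by omega)).2 ⟨h5, h6⟩
    rw [hek, hel] at h5
    have hkl : (k : ℝ) < l := by exact_mod_cast (show k < l by omega)
    have := sub_pos.2 hkl
    have h6 : g (l * D.ε) - g (k * D.ε) =
      -((e (D.cell s + 1) - e (D.cell s)) * (l - k)) := by linarith
    rw [hsig s hs, h6, ← sub_mul]
    field_simp

theorem Icc_subset_hull (h : D.Block c A m n) (hc : c = 1 ∨ c = -1) (hε : 0 < D.ε)
    (hw : IsGridDatum D.ε D.w0) (hA : A ⊆ D.waves) :
    Icc (m * D.ε) (n * D.ε) ⊆ convexHull ℝ (Set.range D.w0) := by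
  have key : ∀ s ∈ A, (D.cell s : ℝ) * D.ε ∈ convexHull ℝ (Set.range D.w0) ∧
      ((D.cell s + 1 : ℤ) : ℝ) * D.ε ∈ convexHull ℝ (Set.range D.w0) := by
    intro s hs
    obtain ⟨h1, h2⟩ := hatw_mem_hull hε hw (hA hs)
    rw [h.hatw s hs, h.sgn s hs] at h2
    rw [h.hatw s hs] at h1
    push_cast
    rcases hc with rfl | rfl
    · refine ⟨?_, ?_⟩
      · convert h2 using 1; ring
      · convert h1 using 1; ring
    · refine ⟨?_, ?_⟩
      · convert h1 using 1; ring
      · convert h2 using 1; ring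
  obtain ⟨r, hr, hr'⟩ := h.exists_cell_eq le_rfl h.lt
  obtain ⟨q, hq, hq'⟩ := h.exists_cell_eq (k := n - 1) (by have := h.lt; omega) (by omega)
  have h1 := (key r hr).1
  have h2 := (key q hq).2
  rw [hr'] at h1
  rw [hq', sub_add_cancel] at h2
  exact (convex_convexHull ℝ _).ordConnected.out h1 h2

end Block

/-! ### Speeds -/

theorem differentiable_flux (hf : ContDiff ℝ 3 (fun z : ℝ × ℝ => D.f z.1 z.2)) (v : ℝ) :
    Differentiable ℝ fun x => D.f x v := by
  have h1 : ContDiff ℝ 3 fun x : ℝ => D.f x v :=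
    hf.comp (contDiff_id.prodMk contDiff_const : ContDiff ℝ 3 fun x : ℝ => (x, v))
  exact h1.differentiable (by norm_num)

namespace Inv

variable {S : WaveState}

/-- The waves at the same position as `s` form a block. -/
theorem block_at (h : D.Inv S) (hε : 0 < D.ε) (hw : IsGridDatum D.ε D.w0) {s : ℕ}
    (hs : s ∈ S.alive) :
    ∃ m n, D.Block (D.sgn s) (S.alive.filter fun r => S.pos r = S.pos s) m n := by
  refine h.block hε hw (h.sgn_eq hε hw hs) (Finset.filter_subset _ _) ⟨s, by simp [hs]⟩ ?_ ?_
  · intro r hr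
    rw [Finset.mem_filter] at hr
    exact h.homog r hr.1 s hs hr.2
  · intro r hr q hq p hp h1 h2
    rw [Finset.mem_filter] at hr hq ⊢
    refine ⟨hp, le_antisymm ?_ ?_⟩
    · rw [← hq.2]
      exact h.mono p hp q hq.1 h2.le
    · rw [← hr.2]
      exact h.mono r hr.1 p hp h1.le

theorem speed_mono (h : D.Inv S) (hε : 0 < D.ε) (hw : IsGridDatum D.ε D.w0) {r q : ℕ}
    (hr : r ∈ S.alive) (hq : q ∈ S.alive) (hrq : r < q) (hpos : S.pos r = S.pos q) :
    D.speedIn S r ≤ D.speedIn S q := by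
  obtain ⟨m, n, hb⟩ := h.block_at hε hw hq
  rw [speedIn, speedIn, hpos]
  exact hb.sigmaEnt_mono (h.sgn_eq hε hw hq) hε _ (by simp [hr, hpos]) (by simp [hq]) hrq

/-- An entropic speed is a mean slope of `f(·, v)`, hence by the mean value theorem a value of `∂_w
f` at a point of the convex hull of the datum. -/
theorem neg_one_lt_speed (h : D.Inv S) (hε : 0 < D.ε) (hw : IsGridDatum D.ε D.w0)
    (hf : ContDiff ℝ 3 (fun z : ℝ × ℝ => D.f z.1 z.2))
    (hyp : ∀ w ∈ convexHull ℝ (Set.range D.w0), ∀ v ∈ Set.range D.v0,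
      -1 < deriv (fun x => D.f x v) w) {s : ℕ} (hs : s ∈ S.alive) : -1 < D.speedIn S s := by
  obtain ⟨m, n, hb⟩ := h.block_at hε hw hs
  obtain ⟨k, l, hk, hkl, hl, heq⟩ := hb.exists_sigmaEnt_eq_slope (h.sgn_eq hε hw hs) hε
    (fun w => D.f w (D.v S.time (S.pos s))) (s := s) (by simp [hs])
  rw [speedIn, heq]
  have hlt : (k : ℝ) * D.ε < l * D.ε := mul_lt_mul_of_pos_right (by exact_mod_cast hkl) hε
  have hd := differentiable_flux hf (D.v S.time (S.pos s))
  obtain ⟨x, hx, hxe⟩ := exists_deriv_eq_slope (fun w => D.f w (D.v S.time (S.pos s))) hlt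
    hd.continuous.continuousOn hd.differentiableOn
  rw [← hxe]
  refine hyp x ?_ _ ⟨_, rfl⟩
  refine hb.Icc_subset_hull (h.sgn_eq hε hw hs) hε hw
    ((Finset.filter_subset _ _).trans h.sub) ⟨?_, ?_⟩
  · exact (grid_mem_Icc hε hk (by omega : k ≤ n)).1.trans hx.1.le
  · exact hx.2.le.trans (grid_mem_Icc hε (by omega : m ≤ l) hl).2

end Inv

end WaveData

/-! ### Cancellation between two groups of waves -/

/-- The inner cardinality is the rank of `q` in `A`, and ranks take each value from `1` to `A.card`
once. This counts the survivors of a cancellation. -/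
theorem card_filter_rank_le (A : Finset ℕ) {k : ℕ} (hk : k ≤ A.card) :
    (A.filter fun q => (A.filter fun r => r ≤ q).card ≤ k).card = k := by
  induction A using Finset.induction_on_max generalizing k with
  | empty => simpa [eq_comm] using hk
  | insert a A ha ih =>
    have haA : a ∉ A := fun h => lt_irrefl _ (ha a h)
    have h1 : ∀ q ∈ A, (insert a A).filter (fun r => r ≤ q) = A.filter fun r => r ≤ q := by
      intro q hq
      rw [Finset.filter_insert, if_neg (not_le.2 (ha q hq))]
    have h2 : (insert a A).filter (fun r => r ≤ a) = insert a A := by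
      refine Finset.filter_true_of_mem fun r hr => ?_
      rcases Finset.mem_insert.1 hr with rfl | hr
      · exact le_rfl
      · exact (ha r hr).le
    rw [Finset.card_insert_of_notMem haA] at hk
    rw [Finset.filter_insert, h2, Finset.card_insert_of_notMem haA,
      Finset.filter_congr fun q hq => by rw [h1 q hq]]
    rcases eq_or_lt_of_le hk with rfl | hk
    · rw [if_pos le_rfl, Finset.card_insert_of_notMem (by simp [haA]), Finset.filter_true_of_mem]
      intro q hq
      exact (Finset.card_le_card (Finset.filter_subset _ _)).trans (Nat.le_succ _)
    · rw [if_neg (by omega)]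
      exact ih (by omega)

/-- The sum of the signs of the waves surviving a collision between a group `C₁` of waves of sign
`c` and a group `C₂`, at its right, of waves of sign `-c`, is the sum of all the signs. Here a wave
is described by the value `H` of the partial sum of the signs up to it. -/
theorem sum_surviving {C₁ C₂ : Finset ℕ} {c : ℝ} (hc : c * c = 1) {σ H : ℕ → ℝ}
    (h₁₂ : ∀ r ∈ C₁, ∀ q ∈ C₂, r < q) (h₁ : ∀ r ∈ C₁, σ r = c) (h₂ : ∀ r ∈ C₂, σ r = -c)
    (hH : ∀ s ∈ C₁ ∪ C₂, H s = ∑ q ∈ (C₁ ∪ C₂).filter (fun q => q ≤ s), σ q) {T : ℝ}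
    (hT : T = ∑ q ∈ C₁ ∪ C₂, σ q) :
    (∀ s ∈ C₁ ∪ C₂, (0 ≤ σ s * H s - 1 ∧ σ s * H s ≤ σ s * T) →
      ∑ q ∈ (C₁ ∪ C₂).filter (fun q => (0 ≤ σ q * H q - 1 ∧ σ q * H q ≤ σ q * T) ∧ q ≤ s), σ q
        = ∑ q ∈ (C₁ ∪ C₂).filter (fun q => q ≤ s), σ q) ∧
    ∑ q ∈ (C₁ ∪ C₂).filter (fun q => 0 ≤ σ q * H q - 1 ∧ σ q * H q ≤ σ q * T), σ q = T := by
  have hdisj : Disjoint C₁ C₂ := Finset.disjoint_left.2 fun r h h' => lt_irrefl _ (h₁₂ r h r h')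
  have hsum₁ : ∀ (P : ℕ → Prop) [DecidablePred P], ∑ q ∈ C₁.filter P, σ q = c * (C₁.filter P).card := fun P _ => by
    rw [Finset.sum_congr rfl fun q hq => h₁ q (Finset.mem_filter.1 hq).1, Finset.sum_const,
      nsmul_eq_mul, mul_comm]
  have hsum₂ : ∀ (P : ℕ → Prop) [DecidablePred P], ∑ q ∈ C₂.filter P, σ q = -c * (C₂.filter P).card := fun P _ => by
    rw [Finset.sum_congr rfl fun q hq => h₂ q (Finset.mem_filter.1 hq).1, Finset.sum_const,
      nsmul_eq_mul, mul_comm]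
  have hsum : ∀ (P : ℕ → Prop) [DecidablePred P], ∑ q ∈ (C₁ ∪ C₂).filter P, σ q =
      c * ((C₁.filter P).card - (C₂.filter P).card) := fun P _ => by
    rw [Finset.filter_union, Finset.sum_union (Finset.disjoint_filter_filter hdisj), hsum₁, hsum₂]
    ring
  have hT' : T = c * (C₁.card - C₂.card) := by
    have := hsum fun _ => True
    simp only [Finset.filter_true] at this
    rw [hT, this]
  have hH₁ : ∀ s ∈ C₁, H s = c * (C₁.filter fun q => q ≤ s).card := fun s hs => by
    have h0 : C₂.filter (fun q => q ≤ s) = ∅ :=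
      Finset.filter_false_of_mem fun q hq => not_le.2 (h₁₂ s hs q hq)
    rw [hH s (Finset.mem_union_left _ hs), hsum, h0]
    simp
  have hH₂ : ∀ s ∈ C₂, H s = c * (C₁.card - (C₂.filter fun q => q ≤ s).card) := fun s hs => by
    have h0 : C₁.filter (fun q => q ≤ s) = C₁ :=
      Finset.filter_true_of_mem fun q hq => (h₁₂ q hq s hs).le
    rw [hH s (Finset.mem_union_right _ hs), hsum, h0]
  -- In terms of ranks: a wave of `C₁` of rank `k` has `σ H = k` and survives iff `k + |C₂| ≤ |C₁|`;
  -- a wave of `C₂` of rank `k` has `σ H = k - |C₁|` and survives iff `k > |C₁|`.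
  have hs₁ : ∀ s ∈ C₁, ((0 ≤ σ s * H s - 1 ∧ σ s * H s ≤ σ s * T) ↔
      (C₁.filter fun q => q ≤ s).card + C₂.card ≤ C₁.card) := fun s hs => by
    have hpos : 1 ≤ (C₁.filter fun q => q ≤ s).card :=
      Finset.card_pos.2 ⟨s, by simp [hs]⟩
    have hpos' : (1 : ℝ) ≤ (C₁.filter fun q => q ≤ s).card := by exact_mod_cast hpos
    rw [h₁ s hs, hH₁ s hs, hT', ← mul_assoc, ← mul_assoc, hc, one_mul, one_mul]
    rw [and_iff_right (by linarith), le_sub_iff_add_le]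
    exact_mod_cast Iff.rfl
  have hs₂ : ∀ s ∈ C₂, ((0 ≤ σ s * H s - 1 ∧ σ s * H s ≤ σ s * T) ↔
      C₁.card + 1 ≤ (C₂.filter fun q => q ≤ s).card) := fun s hs => by
    have hle : (C₂.filter fun q => q ≤ s).card ≤ C₂.card :=
      Finset.card_le_card (Finset.filter_subset _ _)
    have hle' : ((C₂.filter fun q => q ≤ s).card : ℝ) ≤ C₂.card := by exact_mod_cast hle
    rw [h₂ s hs, hH₂ s hs, hT', neg_mul, neg_mul, ← mul_assoc, ← mul_assoc, hc, one_mul, one_mul]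
    rw [and_iff_left (by linarith)]
    constructor
    · intro h
      have : (C₁.card : ℝ) + 1 ≤ (C₂.filter fun q => q ≤ s).card := by linarith
      exact_mod_cast this
    · intro h
      have : (C₁.card : ℝ) + 1 ≤ (C₂.filter fun q => q ≤ s).card := by exact_mod_cast h
      linarith
  have hle₁ : ∀ s ∈ C₁, 1 ≤ (C₁.filter fun q => q ≤ s).card := fun s hs =>
    Finset.card_pos.2 ⟨s, by simp [hs]⟩
  have hle₂ : ∀ s, (C₂.filter fun q => q ≤ s).card ≤ C₂.card := fun s =>
    Finset.card_le_card (Finset.filter_subset _ _)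
  rcases le_or_gt C₂.card C₁.card with hcard | hcard
  -- Here `C₂` is annihilated and the survivors form an initial segment of `C₁`, so partial sums up
  -- to a survivor do not change.
  · have hno : ∀ s ∈ C₂, ¬ (0 ≤ σ s * H s - 1 ∧ σ s * H s ≤ σ s * T) := fun s hs h => by
      have := (hs₂ s hs).1 h
      have := hle₂ s
      omega
    refine ⟨fun s hs h => ?_, ?_⟩
    · have hsC : s ∈ C₁ := by
        rcases Finset.mem_union.1 hs with hs | hs
        · exact hs
        · exact absurd h (hno s hs)
      refine Finset.sum_congr (Finset.filter_congr fun q hq => ?_) fun _ _ => rfl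
      refine and_iff_right_of_imp fun hqs => ?_
      have hqC : q ∈ C₁ := by
        rcases Finset.mem_union.1 hq with hq | hq
        · exact hq
        · exact absurd hqs (not_le.2 (h₁₂ s hsC q hq))
      rw [hs₁ q hqC]
      refine le_trans (Nat.add_le_add_right (Finset.card_le_card fun r hr => ?_) _)
        ((hs₁ s hsC).1 h)
      rw [Finset.mem_filter] at hr ⊢
      exact ⟨hr.1, hr.2.trans hqs⟩
    · rw [hsum, Finset.filter_false_of_mem hno, Finset.filter_congr hs₁, hT']
      have := card_filter_rank_le C₁ (k := C₁.card - C₂.card) (by omega)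
      rw [Finset.filter_congr fun q _ => Nat.le_sub_iff_add_le hcard] at this
      rw [this, Nat.cast_sub hcard]
      simp
  · have hno : ∀ s ∈ C₁, ¬ (0 ≤ σ s * H s - 1 ∧ σ s * H s ≤ σ s * T) := fun s hs h => by
      have := (hs₁ s hs).1 h
      have := hle₁ s hs
      omega
    -- Now `C₁` is annihilated together with the first `|C₁|` waves of `C₂`. The count is needed for
    -- `C₂` and for its initial segments, in which ranks are the same as in `C₂`.
    have hcount : ∀ B : Finset ℕ, C₁.card ≤ B.card →
        ((B.filter fun q => C₁.card + 1 ≤ (B.filter fun r => r ≤ q).card).card : ℝ) =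
          B.card - C₁.card := fun B hB => by
      have h1 := card_filter_rank_le B hB
      have h2 := Finset.card_filter_add_card_filter_not (s := B)
        fun q => (B.filter fun r => r ≤ q).card ≤ C₁.card
      rw [h1, Finset.filter_congr (fun q _ => not_le)] at h2
      rw [eq_sub_iff_add_eq]
      have h3 : (B.filter fun q => C₁.card + 1 ≤ (B.filter fun r => r ≤ q).card).card + C₁.card
          = B.card := by
        rw [add_comm]
        exact h2
      exact_mod_cast h3
    refine ⟨fun s hs h => ?_, ?_⟩
    · have hsC : s ∈ C₂ := by
        rcases Finset.mem_union.1 hs with hs | hs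
        · exact absurd h (hno s hs)
        · exact hs
      have hrank := (hs₂ s hsC).1 h
      have h3 : C₁.filter (fun q => (0 ≤ σ q * H q - 1 ∧ σ q * H q ≤ σ q * T) ∧ q ≤ s) = ∅ :=
        Finset.filter_false_of_mem fun q hq hq' => hno q hq hq'.1
      have h4 : C₂.filter (fun q => (0 ≤ σ q * H q - 1 ∧ σ q * H q ≤ σ q * T) ∧ q ≤ s) =
          (C₂.filter fun q => q ≤ s).filter fun q =>
            C₁.card + 1 ≤ ((C₂.filter fun q => q ≤ s).filter fun r => r ≤ q).card := by
        ext q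
        simp only [Finset.mem_filter]
        rw [Finset.filter_filter]
        constructor
        · rintro ⟨h5, h6, h7⟩
          refine ⟨⟨h5, h7⟩, ?_⟩
          rw [Finset.filter_congr fun r _ => show r ≤ s ∧ r ≤ q ↔ r ≤ q by omega]
          exact (hs₂ q h5).1 h6
        · rintro ⟨⟨h5, h6⟩, h7⟩
          refine ⟨h5, (hs₂ q h5).2 ?_, h6⟩
          rwa [Finset.filter_congr fun r _ => show r ≤ s ∧ r ≤ q ↔ r ≤ q by omega] at h7
      have h5 : C₁.filter (fun q => q ≤ s) = C₁ :=
        Finset.filter_true_of_mem fun q hq => (h₁₂ q hq s hsC).le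
      rw [hsum, hsum, h3, h4, h5, hcount _ (by omega)]
      simp
    · rw [hsum, Finset.filter_false_of_mem hno, Finset.filter_congr hs₂, hcount _ hcard.le, hT']
      simp

namespace WaveData

variable {D : WaveData} {S : WaveState}

/-! ### Collisions -/

theorem finite_fronts (hv : IsGridDatum D.ε D.v0) (S : WaveState) : (D.fronts S).Finite := by
  refine Set.Finite.union ?_ ?_
  · refine (S.alive.finite_toSet.image fun s => (S.pos s, D.speedIn S s)).subset ?_
    rintro F ⟨s, hs, rfl⟩
    exact ⟨s, hs, rfl⟩
  · refine (hv.finite_jumps.image fun ξ => (ξ - S.time, (-1 : ℝ))).subset ?_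
    rintro F ⟨ξ, hξ, rfl⟩
    exact ⟨ξ, hξ, rfl⟩

/-- Distinct fronts that meet have distinct speeds, so each pair determines its meeting time.
Finiteness makes the infimum `nextTime` a minimum. -/
theorem finite_meetTimes (hv : IsGridDatum D.ε D.v0) (S : WaveState) : (D.meetTimes S).Finite := by
  refine (((finite_fronts hv S).prod (finite_fronts hv S)).image
    fun p : (ℝ × ℝ) × (ℝ × ℝ) => S.time + (p.2.1 - p.1.1) / (p.1.2 - p.2.2)).subset ?_
  rintro t ⟨-, x, F, ⟨hF, hFx⟩, F', ⟨hF', hFx'⟩, hne⟩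
  refine ⟨(F, F'), ⟨hF, hF'⟩, ?_⟩
  have h1 : F.2 - F'.2 ≠ 0 := fun h => by
    rw [sub_eq_zero] at h
    refine hne (Prod.ext ?_ h)
    rw [h] at hFx
    linarith
  simp only
  rw [← eq_sub_iff_add_eq', div_eq_iff h1]
  linarith

/-- The conditions on the first collision after the time of the state `S`. -/
structure Binary (D : WaveData) (S : WaveState) : Prop where
  nonempty : (D.meetTimes S).Nonempty
  unique : ∃! x, (D.frontsAt S (D.nextTime S) x).Nontrivial
  binary : (D.frontsAt S (D.nextTime S) (D.nextPoint S)).ncard = 2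

theorem BinaryCollision.toBinary {j : ℕ} (h : D.BinaryCollision j) : D.Binary (D.state j) :=
  ⟨h.nonempty, h.unique, h.binary⟩

/-- The position at time `t` of the wavefront `F` outgoing from the state `S`. -/
def frontPos (S : WaveState) (F : ℝ × ℝ) (t : ℝ) : ℝ := F.1 + F.2 * (t - S.time)

/-- The wavefront of the wave `s`. -/
def frontOf (D : WaveData) (S : WaveState) (s : ℕ) : ℝ × ℝ := (S.pos s, D.speedIn S s)

theorem frontOf_mem {s : ℕ} (hs : s ∈ S.alive) : D.frontOf S s ∈ D.fronts S := Or.inl ⟨s, hs, rfl⟩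

namespace Binary

theorem time_lt (h : D.Binary S) (hv : IsGridDatum D.ε D.v0) : S.time < D.nextTime S :=
  (h.nonempty.csInf_mem (finite_meetTimes hv S)).1

/-- Uniqueness of the collision point identifies the point chosen by `Classical.epsilon` with any
point where two fronts meet at that time. -/
theorem nextPoint_eq (h : D.Binary S) {F F' : ℝ × ℝ} (hF : F ∈ D.fronts S) (hF' : F' ∈ D.fronts S)
    (hne : F ≠ F') (heq : frontPos S F (D.nextTime S) = frontPos S F' (D.nextTime S)) :
    frontPos S F (D.nextTime S) = D.nextPoint S := by
  refine h.unique.unique ⟨F, ⟨hF, rfl⟩, F', ⟨hF', heq.symm⟩, hne⟩ ?_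
  obtain ⟨x, hx, -⟩ := h.unique
  exact Classical.epsilon_spec (p := fun x => (D.frontsAt S (D.nextTime S) x).Nontrivial) ⟨x, hx⟩

end Binary

theorem frontPos_ne {F F' : ℝ × ℝ} (hF : F ∈ D.fronts S)
    (hF' : F' ∈ D.fronts S) (hne : F ≠ F') {t : ℝ} (ht : S.time < t) (ht' : t < D.nextTime S) :
    frontPos S F t ≠ frontPos S F' t := fun heq => by
  refine absurd (csInf_le ⟨S.time, fun t ht => ht.1.le⟩ ?_) (not_le.2 ht')
  exact ⟨ht, _, F, ⟨hF, rfl⟩, F', ⟨hF', heq.symm⟩, hne⟩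

/-- A reversal of order would, by the intermediate value theorem, produce a meeting strictly before
the first collision. -/
theorem frontPos_le {F F' : ℝ × ℝ} (hF : F ∈ D.fronts S)
    (hF' : F' ∈ D.fronts S) (hlt : F.1 < F'.1) {t : ℝ} (ht : S.time ≤ t) (ht' : t ≤ D.nextTime S) :
    frontPos S F t ≤ frontPos S F' t := by
  by_contra! h
  have hcont : Continuous fun t => frontPos S F' t - frontPos S F t := by
    unfold frontPos
    fun_prop
  obtain ⟨u, hu, hu0⟩ := intermediate_value_Ioo' ht hcont.continuousOn
    (show (0 : ℝ) ∈ Ioo (frontPos S F' t - frontPos S F t)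
      (frontPos S F' S.time - frontPos S F S.time) by
      constructor
      · linarith
      · simp only [frontPos, sub_self, mul_zero, add_zero]
        linarith)
  refine frontPos_ne hF hF' (fun h => hlt.ne (by rw [h])) hu.1 (hu.2.trans_le ht') ?_
  simp only at hu0
  linarith

namespace Inv

/-- Waves leaving one point stay ordered because entropic speeds are monotone; waves leaving
different points belong to fronts that do not cross before the next collision. -/
theorem track_mono (h : D.Inv S) (hε : 0 < D.ε) (hw : IsGridDatum D.ε D.w0)
    {r q : ℕ} (hr : r ∈ S.alive) (hq : q ∈ S.alive) (hrq : r ≤ q) {t : ℝ} (ht : S.time ≤ t)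
    (ht' : t ≤ D.nextTime S) : D.track S t r ≤ D.track S t q := by
  rcases eq_or_lt_of_le hrq with rfl | hrq
  · exact le_rfl
  rcases eq_or_lt_of_le (h.mono r hr q hq hrq.le) with hpos | hpos
  · rw [track, track, hpos]
    exact add_le_add_right
      (mul_le_mul_of_nonneg_right (h.speed_mono hε hw hr hq hrq hpos) (by linarith)) _
  · exact frontPos_le (frontOf_mem hr) (frontOf_mem hq) hpos ht ht'

end Inv

/-- The waves arriving at the next collision point. -/
def arriving (D : WaveData) (S : WaveState) : Finset ℕ :=
  S.alive.filter fun s => D.track S (D.nextTime S) s = D.nextPoint S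

/-- The condition under which a wave arriving at the next collision point survives. -/
def Survives (D : WaveData) (S : WaveState) (s : ℕ) : Prop :=
  D.sgn s * D.wLeft S (D.nextTime S) (D.nextPoint S) ≤ D.sgn s * D.hatw s - D.ε ∧
    D.sgn s * D.hatw s ≤ D.sgn s * D.wRight S (D.nextTime S) (D.nextPoint S)

theorem mem_next_alive {s : ℕ} :
    s ∈ (D.next S).alive ↔ s ∈ S.alive ∧ (s ∈ D.arriving S → D.Survives S s) := by
  simp only [next, arriving, Survives, Finset.mem_filter]
  tauto

theorem next_alive_subset : (D.next S).alive ⊆ S.alive := fun _ hs => (mem_next_alive.1 hs).1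

/-! ### Preservation of the invariant through a collision -/

namespace Inv

/-- Since positions are ordered, the waves up to an arriving wave `s` are those strictly to the left
of the collision point and the arriving ones up to `s`. Survival thus becomes a condition on partial
sums over the arriving waves alone. -/
theorem arriving_sums (h : D.Inv S) (hε : 0 < D.ε) (hw : IsGridDatum D.ε D.w0)
    (hlt : S.time < D.nextTime S) :
    D.wRight S (D.nextTime S) (D.nextPoint S) = D.wLeft S (D.nextTime S) (D.nextPoint S) +
      D.ε * ∑ q ∈ D.arriving S, D.sgn q ∧
    ∀ s ∈ D.arriving S, D.hatw s = D.wLeft S (D.nextTime S) (D.nextPoint S) +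
      D.ε * ∑ q ∈ (D.arriving S).filter (fun q => q ≤ s), D.sgn q := by
  constructor
  · rw [wRight, wLeft, ← mul_add, arriving, ← Finset.sum_union]
    · congr 2
      ext q
      simp only [Finset.mem_filter, Finset.mem_union, ← and_or_left, le_iff_lt_or_eq]
    · rw [Finset.disjoint_filter]
      exact fun _ _ h => h.ne
  · intro s hs
    rw [arriving, Finset.mem_filter] at hs
    rw [h.hatw s hs.1, wLeft, ← mul_add, arriving, Finset.filter_filter, ← Finset.sum_union]
    · congr 2
      ext q
      simp only [Finset.mem_filter, Finset.mem_union, ← and_or_left]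
      refine and_congr_right fun hq => ⟨fun hqs => ?_, ?_⟩
      · have := h.track_mono hε hw hq hs.1 hqs hlt.le le_rfl
        rw [hs.2] at this
        rcases lt_or_eq_of_le this with h1 | h1
        · exact Or.inl h1
        · exact Or.inr ⟨h1, hqs⟩
      · rintro (h1 | h1)
        · by_contra! h2
          have := h.track_mono hε hw hs.1 hq h2.le hlt.le le_rfl
          rw [hs.2] at this
          linarith
        · exact h1.2
    · rw [Finset.disjoint_filter]
      exact fun _ _ h h' => h.ne h'.1

/-- If all the waves arriving at the collision point have the same sign, they survive. -/
theorem survives_of_same_sgn (h : D.Inv S) (hε : 0 < D.ε) (hw : IsGridDatum D.ε D.w0)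
    (hlt : S.time < D.nextTime S) {c : ℝ} (hc : c * c = 1) (hs : ∀ s ∈ D.arriving S, D.sgn s = c)
    {s : ℕ} (hsA : s ∈ D.arriving S) : D.Survives S s := by
  obtain ⟨h1, h2⟩ := h.arriving_sums hε hw hlt
  have hsum : ∀ B ⊆ D.arriving S, ∑ q ∈ B, D.sgn q = c * B.card := fun B hB => by
    rw [Finset.sum_congr rfl fun q hq => hs q (hB hq), Finset.sum_const, nsmul_eq_mul, mul_comm]
  have hsub := Finset.filter_subset (fun q => q ≤ s) (D.arriving S)
  have h3 : 1 ≤ ((D.arriving S).filter fun q => q ≤ s).card :=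
    Finset.card_pos.2 ⟨s, by simp [hsA]⟩
  have h4 := Finset.card_le_card hsub
  have h3' : (1 : ℝ) ≤ ((D.arriving S).filter fun q => q ≤ s).card := by exact_mod_cast h3
  have h4' : (((D.arriving S).filter fun q => q ≤ s).card : ℝ) ≤ (D.arriving S).card := by
    exact_mod_cast h4
  rw [Survives, hs s hsA, h2 s hsA, h1, hsum _ hsub, hsum _ subset_rfl]
  constructor
  · have : c * (D.wLeft S (D.nextTime S) (D.nextPoint S) +
        D.ε * (c * ((D.arriving S).filter fun q => q ≤ s).card)) =
        c * D.wLeft S (D.nextTime S) (D.nextPoint S) +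
        D.ε * (c * c) * ((D.arriving S).filter fun q => q ≤ s).card := by ring
    rw [this, hc]
    nlinarith
  · have : ∀ x : ℝ, c * (D.wLeft S (D.nextTime S) (D.nextPoint S) + D.ε * (c * x)) =
        c * D.wLeft S (D.nextTime S) (D.nextPoint S) + D.ε * (c * c) * x := fun x => by ring
    rw [this, this, hc]
    nlinarith

/-- Two surviving waves at the collision point have the same sign. -/
theorem sgn_eq_of_survives (h : D.Inv S) (hε : 0 < D.ε) (hw : IsGridDatum D.ε D.w0) {r q : ℕ}
    (hr : r ∈ S.alive) (hq : q ∈ S.alive) (hr' : D.Survives S r) (hq' : D.Survives S q) :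
    D.sgn r = D.sgn q := by
  unfold Survives at hr' hq'
  -- For opposite signs one survival condition gives `wLeft + ε ≤ wRight` and the other `wRight + ε
  -- ≤ wLeft`.
  rcases h.sgn_eq hε hw hr with h1 | h1 <;> rcases h.sgn_eq hε hw hq with h2 | h2 <;>
    rw [h1] at hr' ⊢ <;> rw [h2] at hq' ⊢ <;> linarith [hr'.1, hr'.2, hq'.1, hq'.2]

/-- The waves arriving at the collision point form two groups of waves of the same sign. -/
theorem exists_groups (h : D.Inv S) (hb : D.Binary S) (hv : IsGridDatum D.ε D.v0) :
    ∃ A B : Finset ℕ, D.arriving S = A ∪ B ∧ (∀ r ∈ A, ∀ q ∈ B, r < q) ∧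
      (∀ r ∈ A, ∀ q ∈ A, D.sgn r = D.sgn q) ∧ ∀ r ∈ B, ∀ q ∈ B, D.sgn r = D.sgn q := by
  have hlt := hb.time_lt hv
  obtain ⟨F, F', hne, hset⟩ := Set.ncard_eq_two.1 hb.binary
  have hF : F ∈ D.frontsAt S (D.nextTime S) (D.nextPoint S) := by simp [hset]
  have hF' : F' ∈ D.frontsAt S (D.nextTime S) (D.nextPoint S) := by simp [hset]
  wlog hle : F.1 ≤ F'.1 generalizing F F'
  · exact this F' F hne.symm (by rw [hset, Set.pair_comm]) hF' hF (by linarith)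
  -- Two fronts that start at the same point and meet again later have equal speeds, hence coincide.
  have hlt1 : F.1 < F'.1 := by
    refine lt_of_le_of_ne hle fun h1 => hne (Prod.ext h1 ?_)
    have h2 := hF.2
    rw [← hF'.2, h1] at h2
    have h3 : 0 < D.nextTime S - S.time := by linarith
    exact mul_right_cancel₀ h3.ne' (add_left_cancel h2)
  have hmem : ∀ s ∈ D.arriving S, D.frontOf S s = F ∨ D.frontOf S s = F' := by
    intro s hs
    rw [arriving, Finset.mem_filter] at hs
    have : D.frontOf S s ∈ D.frontsAt S (D.nextTime S) (D.nextPoint S) := ⟨frontOf_mem hs.1, hs.2⟩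
    rw [hset] at this
    exact this
  refine ⟨(D.arriving S).filter fun s => D.frontOf S s = F,
    (D.arriving S).filter fun s => D.frontOf S s = F', ?_, ?_, ?_, ?_⟩
  · ext s
    simp only [Finset.mem_union, Finset.mem_filter, ← and_or_left]
    exact ⟨fun hs => ⟨hs, hmem s hs⟩, fun hs => hs.1⟩
  · intro r hr q hq
    simp only [arriving, Finset.mem_filter] at hr hq
    by_contra! hqr
    have h1 := h.mono q hq.1.1 r hr.1.1 hqr
    have h2 : S.pos r = F.1 := congrArg Prod.fst hr.2
    have h3 : S.pos q = F'.1 := congrArg Prod.fst hq.2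
    linarith
  all_goals
    intro r hr q hq
    simp only [arriving, Finset.mem_filter] at hr hq
    exact h.homog r hr.1.1 q hq.1.1 (congrArg Prod.fst (hr.2.trans hq.2.symm))

/-- The sum of the signs of the arriving waves is not affected by the cancellation. -/
theorem sum_arriving (h : D.Inv S) (hb : D.Binary S) (hε : 0 < D.ε) (hw : IsGridDatum D.ε D.w0)
    (hv : IsGridDatum D.ε D.v0) :
    (∀ s ∈ D.arriving S, D.Survives S s →
      ∑ q ∈ (D.arriving S).filter (fun q => D.Survives S q ∧ q ≤ s), D.sgn q =
        ∑ q ∈ (D.arriving S).filter (fun q => q ≤ s), D.sgn q) ∧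
    ∑ q ∈ (D.arriving S).filter (fun q => D.Survives S q), D.sgn q =
      ∑ q ∈ D.arriving S, D.sgn q := by
  have hlt := hb.time_lt hv
  obtain ⟨h1, h2⟩ := h.arriving_sums hε hw hlt
  obtain ⟨A, B, hAB, hlAB, hA, hB⟩ := h.exists_groups hb hv
  have hsgn : ∀ s ∈ D.arriving S, D.sgn s = 1 ∨ D.sgn s = -1 := fun s hs =>
    h.sgn_eq hε hw (Finset.mem_filter.1 hs).1
  -- With a single sign all waves survive. Otherwise both groups are nonempty with opposite signs,
  -- and `sum_surviving` applies after removing `wLeft` and dividing by `ε`.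
  by_cases hsame : ∃ c : ℝ, c * c = 1 ∧ ∀ s ∈ D.arriving S, D.sgn s = c
  · obtain ⟨c, hc, hs⟩ := hsame
    have hall : ∀ s ∈ D.arriving S, D.Survives S s := fun s hsA =>
      h.survives_of_same_sgn hε hw hlt hc hs hsA
    refine ⟨fun s _ _ => Finset.sum_congr (Finset.filter_congr fun q hq => ?_) fun _ _ => rfl, ?_⟩
    · exact and_iff_right (hall q hq)
    · rw [Finset.filter_true_of_mem hall]
  · have hneA : A.Nonempty := by
      rw [Finset.nonempty_iff_ne_empty]
      rintro rfl
      rw [Finset.empty_union] at hAB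
      rcases B.eq_empty_or_nonempty with rfl | ⟨b, hbB⟩
      · exact hsame ⟨1, by norm_num, by simp [hAB]⟩
      · refine hsame ⟨D.sgn b, ?_, fun s hs => hB s (hAB ▸ hs) b hbB⟩
        rcases hsgn b (hAB ▸ hbB) with h | h <;> rw [h] <;> norm_num
    have hneB : B.Nonempty := by
      rw [Finset.nonempty_iff_ne_empty]
      rintro rfl
      rw [Finset.union_empty] at hAB
      obtain ⟨a, haA⟩ := hneA
      refine hsame ⟨D.sgn a, ?_, fun s hs => hA s (hAB ▸ hs) a haA⟩
      rcases hsgn a (hAB ▸ haA) with h | h <;> rw [h] <;> norm_num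
    obtain ⟨a, ha⟩ := hneA
    obtain ⟨b, hb'⟩ := hneB
    have haS : a ∈ D.arriving S := hAB ▸ Finset.mem_union_left _ ha
    have hbS : b ∈ D.arriving S := hAB ▸ Finset.mem_union_right _ hb'
    have hcc : D.sgn a * D.sgn a = 1 := by
      rcases hsgn a haS with h | h <;> rw [h] <;> norm_num
    have hba : D.sgn b = -D.sgn a := by
      have : D.sgn b ≠ D.sgn a := fun heq => hsame ⟨D.sgn a, hcc, fun s hs => by
        rw [hAB] at hs
        rcases Finset.mem_union.1 hs with hs | hs
        · exact hA s hs a ha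
        · rw [hB s hs b hb', heq]⟩
      rcases hsgn a haS with h | h <;> rcases hsgn b hbS with h' | h' <;>
        rw [h, h'] at this <;> rw [h, h'] <;> first | exact absurd rfl this | norm_num
    have key := sum_surviving hcc (σ := D.sgn)
      (H := fun s => ∑ q ∈ (A ∪ B).filter (fun q => q ≤ s), D.sgn q) hlAB
      (fun r hr => hA r hr a ha) (fun r hr => by rw [hB r hr b hb', hba]) (fun _ _ => rfl) rfl
    have hsurv : ∀ q ∈ A ∪ B, (D.Survives S q ↔
        0 ≤ D.sgn q * (∑ r ∈ (A ∪ B).filter (fun r => r ≤ q), D.sgn r) - 1 ∧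
        D.sgn q * (∑ r ∈ (A ∪ B).filter (fun r => r ≤ q), D.sgn r) ≤
          D.sgn q * ∑ r ∈ A ∪ B, D.sgn r) := by
      intro q hq
      rw [← hAB] at hq ⊢
      rw [Survives, h2 q hq, h1, mul_add, mul_add, add_sub_assoc, le_add_iff_nonneg_right,
        add_le_add_iff_left, mul_left_comm, mul_left_comm (D.sgn q)]
      refine and_congr ?_ (mul_le_mul_iff_right₀ hε)
      rw [show ∀ x : ℝ, D.ε * x - D.ε = D.ε * (x - 1) from fun x => by ring]
      exact mul_nonneg_iff_of_pos_left hε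
    rw [hAB]
    refine ⟨fun s hs hss => ?_, ?_⟩
    · rw [← key.1 s hs ((hsurv s hs).1 hss)]
      exact Finset.sum_congr (Finset.filter_congr fun q hq => by rw [hsurv q hq]) fun _ _ => rfl
    · rw [Finset.filter_congr hsurv]
      exact key.2

theorem next (h : D.Inv S) (hb : D.Binary S) (hε : 0 < D.ε) (hw : IsGridDatum D.ε D.w0)
    (hv : IsGridDatum D.ε D.v0) : D.Inv (D.next S) where
  sub := next_alive_subset.trans h.sub
  mono := fun r hr q hq hrq => h.track_mono hε hw (next_alive_subset hr) (next_alive_subset hq)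
    hrq (hb.time_lt hv).le le_rfl
  homog := fun r hr q hq hpos => by
    obtain ⟨hr, hr'⟩ := mem_next_alive.1 hr
    obtain ⟨hq, hq'⟩ := mem_next_alive.1 hq
    -- Waves of one front already shared a position; waves of different fronts can only meet at the
    -- collision point, where survivors have one sign.
    by_cases hF : D.frontOf S r = D.frontOf S q
    · exact h.homog r hr q hq (congrArg Prod.fst hF)
    · have h1 : D.track S (D.nextTime S) r = D.nextPoint S :=
        hb.nextPoint_eq (frontOf_mem hr) (frontOf_mem hq) hF hpos
      have h2 : D.track S (D.nextTime S) q = D.nextPoint S := by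
        rw [← h1]
        exact hpos.symm
      exact h.sgn_eq_of_survives hε hw hr hq (hr' (Finset.mem_filter.2 ⟨hr, h1⟩))
        (hq' (Finset.mem_filter.2 ⟨hq, h2⟩))
  hatw := fun s hs => by
    have hlt := hb.time_lt hv
    obtain ⟨hs, hs'⟩ := mem_next_alive.1 hs
    have hsplit : ∀ (P : ℕ → Prop) [DecidablePred P], ∑ r ∈ S.alive.filter P, D.sgn r =
        ∑ r ∈ (S.alive.filter fun r => r ∉ D.arriving S ∧ P r), D.sgn r +
          ∑ r ∈ (D.arriving S).filter P, D.sgn r := by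
      intro P _
      rw [← Finset.sum_union]
      · refine Finset.sum_congr ?_ fun _ _ => rfl
        ext r
        simp only [arriving, Finset.mem_union, Finset.mem_filter]
        tauto
      · rw [Finset.disjoint_left]
        intro r hr hr'
        exact (Finset.mem_filter.1 hr).2.1 (Finset.mem_filter.1 hr').1
    have hsplit' : ∑ r ∈ (D.next S).alive.filter (fun r => r ≤ s), D.sgn r =
        ∑ r ∈ (S.alive.filter fun r => r ∉ D.arriving S ∧ r ≤ s), D.sgn r +
          ∑ r ∈ (D.arriving S).filter (fun r => D.Survives S r ∧ r ≤ s), D.sgn r := by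
      rw [← Finset.sum_union]
      · refine Finset.sum_congr ?_ fun _ _ => rfl
        ext r
        simp only [mem_next_alive, Finset.mem_union, Finset.mem_filter]
        have : r ∈ D.arriving S → r ∈ S.alive := fun h => (Finset.mem_filter.1 h).1
        tauto
      · rw [Finset.disjoint_left]
        intro r hr hr'
        exact (Finset.mem_filter.1 hr).2.1 (Finset.mem_filter.1 hr').1
    rw [h.hatw s hs, hsplit, hsplit']
    congr 2
    obtain ⟨h1, h2⟩ := h.sum_arriving hb hε hw hv
    -- For an arriving survivor its partial sum is preserved. For a wave on the left no arriving
    -- wave counts, and for one on the right all of them do, with unchanged total.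
    by_cases hsA : s ∈ D.arriving S
    · exact (h1 s hsA (hs' hsA)).symm
    · have hne : D.track S (D.nextTime S) s ≠ D.nextPoint S := fun heq =>
        hsA (Finset.mem_filter.2 ⟨hs, heq⟩)
      rcases lt_or_gt_of_ne hne with hlt' | hlt'
      · have hno : ∀ r ∈ D.arriving S, ¬ r ≤ s := fun r hr hrs => by
          obtain ⟨hr, hr'⟩ := Finset.mem_filter.1 hr
          have := h.track_mono hε hw hr hs hrs hlt.le le_rfl
          linarith
        rw [Finset.filter_false_of_mem hno,
          Finset.filter_false_of_mem fun r hr hr' => hno r hr hr'.2]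
      · have hall : ∀ r ∈ D.arriving S, r ≤ s := fun r hr => by
          by_contra! hrs
          obtain ⟨hr, hr'⟩ := Finset.mem_filter.1 hr
          have := h.track_mono hε hw hs hr hrs.le hlt.le le_rfl
          linarith
        rw [Finset.filter_true_of_mem hall,
          Finset.filter_congr fun r hr => and_iff_left (hall r hr)]
        exact h2.symm

/-! ### The first family along a wave -/

/-- Second-family speeds exceed `-1`, so a group of waves is never the same pair (position, speed)
as a first-family front, and a meeting of the two counts as a collision. -/
theorem jump_front_ne (h : D.Inv S) (hε : 0 < D.ε) (hw : IsGridDatum D.ε D.w0)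
    (hf : ContDiff ℝ 3 (fun z : ℝ × ℝ => D.f z.1 z.2))
    (hyp : ∀ w ∈ convexHull ℝ (Set.range D.w0), ∀ v ∈ Set.range D.v0,
      -1 < deriv (fun x => D.f x v) w) {s : ℕ} (hs : s ∈ S.alive) (ξ : ℝ) :
    D.frontOf S s ≠ (ξ - S.time, -1) := fun heq => by
  have h1 := h.neg_one_lt_speed hε hw hf hyp hs
  have h2 : D.speedIn S s = -1 := congrArg Prod.snd heq
  linarith

/-- The value of the first component on the left of a wave, at the next collision time, is the one
before the collision. -/
theorem v_track (h : D.Inv S) (hb : D.Binary S) (hε : 0 < D.ε) (hw : IsGridDatum D.ε D.w0)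
    (hv : IsGridDatum D.ε D.v0) (hf : ContDiff ℝ 3 (fun z : ℝ × ℝ => D.f z.1 z.2))
    (hyp : ∀ w ∈ convexHull ℝ (Set.range D.w0), ∀ v ∈ Set.range D.v0,
      -1 < deriv (fun x => D.f x v) w) {s : ℕ} (hs : s ∈ S.alive) :
    Function.leftLim D.v0 (D.track S (D.nextTime S) s + D.nextTime S) = D.v0 (S.pos s + S.time) ∧
    (D.track S (D.nextTime S) s ≠ D.nextPoint S →
      D.v0 (D.track S (D.nextTime S) s + D.nextTime S) = D.v0 (S.pos s + S.time)) := by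
  have hlt := hb.time_lt hv
  have h1 := h.neg_one_lt_speed hε hw hf hyp hs
  have h2 : S.pos s + S.time < D.track S (D.nextTime S) s + D.nextTime S := by
    rw [track]
    nlinarith
  have hmeet : ∀ t, D.frontOf S s ≠ (D.track S t s + t - S.time, -1) ∧
      frontPos S (D.frontOf S s) t = frontPos S (D.track S t s + t - S.time, -1) t := fun t =>
    ⟨h.jump_front_ne hε hw hf hyp hs _, by
      simp only [frontPos, frontOf, track]
      ring⟩
  -- Since `x + t` increases along the wave, a jump of `v0` strictly between the two values would be
  -- crossed, hence collided with, before the next collision time.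
  have hno : ∀ z ∈ Ioo (S.pos s + S.time) (D.track S (D.nextTime S) s + D.nextTime S),
      Function.leftLim D.v0 z = D.v0 z := by
    intro z hz
    by_contra hj
    obtain ⟨t, ht, htz⟩ : ∃ t ∈ Ioo S.time (D.nextTime S), D.track S t s + t = z := by
      have hcont : Continuous fun t => D.track S t s + t := by
        unfold track
        fun_prop
      refine intermediate_value_Ioo hlt.le hcont.continuousOn ?_
      simpa [track] using hz
    obtain ⟨h3, h4⟩ := hmeet t
    rw [htz] at h3 h4
    exact frontPos_ne (frontOf_mem hs) (Or.inr ⟨z, hj, rfl⟩) h3 ht.1 ht.2 h4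
  refine ⟨hv.leftLim_eq_of_no_jump h2 hno, fun hne => ?_⟩
  refine hv.eq_of_no_jump h2.le fun z hz => ?_
  rcases eq_or_lt_of_le hz.2 with rfl | hz2
  · by_contra hj
    obtain ⟨h3, h4⟩ := hmeet (D.nextTime S)
    exact hne (hb.nextPoint_eq (frontOf_mem hs) (Or.inr ⟨_, hj, rfl⟩) h3 h4)
  · exact hno z ⟨hz.1, hz2⟩

/-- There is no cancellation in a transversal collision. -/
theorem survives_of_transversal (h : D.Inv S) (hb : D.Binary S) (hε : 0 < D.ε)
    (hw : IsGridDatum D.ε D.w0) (hv : IsGridDatum D.ε D.v0)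
    (hf : ContDiff ℝ 3 (fun z : ℝ × ℝ => D.f z.1 z.2))
    (hyp : ∀ w ∈ convexHull ℝ (Set.range D.w0), ∀ v ∈ Set.range D.v0,
      -1 < deriv (fun x => D.f x v) w) (ht : D.nextPoint S + D.nextTime S ∈ D.vJumps) {s : ℕ}
    (hs : s ∈ D.arriving S) : D.Survives S s := by
  have hlt := hb.time_lt hv
  obtain ⟨F, F', hne, hset⟩ := Set.ncard_eq_two.1 hb.binary
  have hmem : ∀ r ∈ D.arriving S, D.frontOf S r = F ∨ D.frontOf S r = F' := by
    intro r hr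
    rw [arriving, Finset.mem_filter] at hr
    have : D.frontOf S r ∈ D.frontsAt S (D.nextTime S) (D.nextPoint S) := ⟨frontOf_mem hr.1, hr.2⟩
    rw [hset] at this
    exact this
  have hξ : (D.nextPoint S + D.nextTime S - S.time, (-1 : ℝ)) = F ∨
      (D.nextPoint S + D.nextTime S - S.time, (-1 : ℝ)) = F' := by
    have : (D.nextPoint S + D.nextTime S - S.time, (-1 : ℝ)) ∈
        D.frontsAt S (D.nextTime S) (D.nextPoint S) := by
      refine ⟨Or.inr ⟨_, ht, rfl⟩, ?_⟩
      simp only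
      ring
    rw [hset] at this
    exact this
  -- Only two fronts meet and one is of the first family, so all arriving waves form the other and
  -- share a sign.
  have hsame : ∀ r ∈ D.arriving S, D.frontOf S r = D.frontOf S s := by
    intro r hr
    have h1 := h.jump_front_ne hε hw hf hyp (Finset.mem_filter.1 hr).1
      (D.nextPoint S + D.nextTime S)
    have h2 := h.jump_front_ne hε hw hf hyp (Finset.mem_filter.1 hs).1
      (D.nextPoint S + D.nextTime S)
    rcases hmem r hr with h3 | h3 <;> rcases hmem s hs with h4 | h4 <;> rcases hξ with h5 | h5 <;>
      simp_all
  refine h.survives_of_same_sgn hε hw hlt (c := D.sgn s) ?_ (fun r hr => ?_) hs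
  · rcases h.sgn_eq hε hw (Finset.mem_filter.1 hs).1 with h | h <;> rw [h] <;> norm_num
  · exact h.homog r (Finset.mem_filter.1 hr).1 s (Finset.mem_filter.1 hs).1
      (congrArg Prod.fst (hsame r hr))

end Inv

end WaveData

/-! ### Second primitives -/

/-- The remainder of the first-order expansion at `w` is the integral of `(x - y) ρ y` over `[w,
x]`, at most `C (x - w)²`. Boundedness replaces continuity of `ρ`, which fails for `effSecond`. -/
theorem hasDerivAt_second_primitive {ρ : ℝ → ℝ} (hint : ∀ a b, IntervalIntegrable ρ volume a b)
    {C : ℝ} (hC : ∀ y, |ρ y| ≤ C) (w : ℝ) :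
    HasDerivAt (fun x => ∫ y in (0 : ℝ)..x, (x - y) * ρ y) (∫ y in (0 : ℝ)..w, ρ y) w := by
  have hint' : ∀ x a b, IntervalIntegrable (fun y => (x - y) * ρ y) volume a b := fun x a b =>
    (hint a b).continuousOn_mul (by fun_prop)
  have key : ∀ x, (∫ y in (0 : ℝ)..x, (x - y) * ρ y) - (∫ y in (0 : ℝ)..w, (w - y) * ρ y) -
      (x - w) * (∫ y in (0 : ℝ)..w, ρ y) = ∫ y in w..x, (x - y) * ρ y := by
    intro x
    rw [← intervalIntegral.integral_add_adjacent_intervals (hint' x 0 w) (hint' x w x)]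
    have h1 : (∫ y in (0 : ℝ)..w, (x - y) * ρ y) =
        (∫ y in (0 : ℝ)..w, (w - y) * ρ y) + (x - w) * ∫ y in (0 : ℝ)..w, ρ y := by
      rw [← intervalIntegral.integral_const_mul, ← intervalIntegral.integral_add (hint' w 0 w)
        ((hint 0 w).const_mul _)]
      congr 1
      funext y
      ring
    rw [h1]
    ring
  rw [hasDerivAt_iff_isLittleO]
  refine Asymptotics.IsBigO.trans_isLittleO (g := fun x => (x - w) * (x - w)) ?_ ?_
  · refine Asymptotics.IsBigO.of_bound C (Filter.Eventually.of_forall fun x => ?_)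
    rw [smul_eq_mul, key x, norm_mul]
    have h1 : ‖∫ y in w..x, (x - y) * ρ y‖ ≤ |x - w| * C * |x - w| := by
      refine intervalIntegral.norm_integral_le_of_norm_le_const fun y hy => ?_
      rw [norm_mul, Real.norm_eq_abs, Real.norm_eq_abs]
      refine mul_le_mul ?_ (hC y) (abs_nonneg _) (abs_nonneg _)
      rcases le_total w x with h | h
      · rw [uIoc_of_le h] at hy
        rw [abs_of_nonneg (by linarith [hy.2]), abs_of_nonneg (by linarith)]
        linarith [hy.1]
      · rw [uIoc_of_ge h] at hy
        rw [abs_of_nonpos (by linarith [hy.1]), abs_of_nonpos (by linarith)]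
        linarith [hy.2]
    rw [Real.norm_eq_abs (x - w)]
    linarith
  · have h1 : Filter.Tendsto (fun x => x - w) (nhds w) (nhds 0) := by
      have : Continuous fun x => x - w := by fun_prop
      simpa using this.tendsto w
    have := ((Asymptotics.isLittleO_one_iff ℝ).2 h1).mul_isBigO
      (Asymptotics.isBigO_refl (fun x => x - w) (nhds w))
    simpa using this

/-- Two functions on an interval, whose derivatives have the same increments, differ by an affine
function. -/
theorem exists_affine_of_deriv {g₁ g₂ g₁' g₂' : ℝ → ℝ} {a b : ℝ}
    (h₁ : ∀ w ∈ Icc a b, HasDerivWithinAt g₁ (g₁' w) (Icc a b) w)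
    (h₂ : ∀ w ∈ Icc a b, HasDerivWithinAt g₂ (g₂' w) (Icc a b) w)
    (h : ∀ w ∈ Icc a b, g₁' w - g₁' a = g₂' w - g₂' a) :
    ∃ α β : ℝ, ∀ w ∈ Icc a b, g₁ w = g₂ w + (α + β * w) := by
  set β := g₁' a - g₂' a with hβ
  refine ⟨g₁ a - g₂ a - β * a, β, fun w hw => ?_⟩
  have hd : ∀ x ∈ Icc a b, HasDerivWithinAt (fun w => g₁ w - g₂ w - β * w)
      (g₁' x - g₂' x - β * 1) (Icc a b) x := fun x hx =>
    ((h₁ x hx).sub (h₂ x hx)).sub ((hasDerivWithinAt_id x _).const_mul β)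
  have h3 := norm_image_sub_le_of_norm_deriv_le_segment' hd (C := 0) (fun x hx => by
    have := h x (Ico_subset_Icc_self hx)
    rw [hβ, norm_le_zero_iff]
    linarith) w hw
  rw [zero_mul, norm_le_zero_iff] at h3
  linarith

namespace WaveData

variable {D : WaveData}

/-! ### Regularity of the flux -/

theorem contDiff_partial {F : ℝ × ℝ → ℝ} {n m : WithTop ℕ∞} (hF : ContDiff ℝ n F) (hmn : m + 1 ≤ n) :
    ContDiff ℝ m (fun z : ℝ × ℝ => deriv (fun x => F (x, z.2)) z.1) := by
  have hn : n ≠ 0 := by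
    rintro rfl
    have h1 : (1 : WithTop ℕ∞) ≤ m + 1 := le_add_self
    exact absurd (h1.trans hmn) (by simp)
  have h1 : ∀ z : ℝ × ℝ, deriv (fun x => F (x, z.2)) z.1 = fderiv ℝ F z (1, 0) := by
    intro z
    have h2 : HasDerivAt (fun x : ℝ => (x, z.2)) ((1 : ℝ), (0 : ℝ)) z.1 :=
      (hasDerivAt_id z.1).prodMk (hasDerivAt_const z.1 z.2)
    have h3 : HasFDerivAt F (fderiv ℝ F z) (z.1, z.2) := (hF.differentiable hn z).hasFDerivAt
    exact (h3.comp_hasDerivAt z.1 h2).deriv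
  rw [funext h1]
  exact (hF.fderiv_right hmn).clm_apply contDiff_const

theorem contDiff_dw (hf : ContDiff ℝ 3 (fun z : ℝ × ℝ => D.f z.1 z.2)) :
    ContDiff ℝ 2 (fun z : ℝ × ℝ => deriv (fun x => D.f x z.2) z.1) :=
  contDiff_partial hf (by norm_num)

theorem contDiff_dww (hf : ContDiff ℝ 3 (fun z : ℝ × ℝ => D.f z.1 z.2)) :
    ContDiff ℝ 1 (fun z : ℝ × ℝ => D.dww z.1 z.2) := by
  have h1 : (fun z : ℝ × ℝ => D.dww z.1 z.2) =
      fun z : ℝ × ℝ => deriv (fun x => deriv (fun y => D.f y z.2) x) z.1 := by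
    funext z
    rw [dww, iteratedDeriv_succ, iteratedDeriv_one]
  rw [h1]
  exact contDiff_partial (contDiff_dw hf) (by norm_num)

theorem hasDerivAt_dw (hf : ContDiff ℝ 3 (fun z : ℝ × ℝ => D.f z.1 z.2)) (v w : ℝ) :
    HasDerivAt (fun x => deriv (fun y => D.f y v) x) (D.dww w v) w := by
  have h1 : ContDiff ℝ 2 fun x : ℝ => deriv (fun y => D.f y v) x :=
    (contDiff_dw hf).comp (contDiff_id.prodMk contDiff_const : ContDiff ℝ 2 fun x : ℝ => (x, v))
  rw [dww, iteratedDeriv_succ, iteratedDeriv_one]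
  exact (h1.differentiable two_ne_zero w).hasDerivAt

theorem continuous_dww (hf : ContDiff ℝ 3 (fun z : ℝ × ℝ => D.f z.1 z.2)) (v : ℝ) :
    Continuous fun w => D.dww w v := by
  have h1 : Continuous fun w : ℝ => (w, v) := by fun_prop
  have h2 : Continuous fun z : ℝ × ℝ => D.dww z.1 z.2 := (contDiff_dww hf).continuous
  have h3 := h2.comp h1
  exact h3

theorem normDwwv_nonneg (D : WaveData) : 0 ≤ D.normDwwv := Real.iSup_nonneg fun _ => abs_nonneg _

theorem abs_dww_sub_le (hf : ContDiff ℝ 3 (fun z : ℝ × ℝ => D.f z.1 z.2))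
    (hfb : ∃ C : ℝ, ∀ w v : ℝ, |D.dwwv w v| ≤ C) (w v v' : ℝ) :
    |D.dww w v' - D.dww w v| ≤ D.normDwwv * |v' - v| := by
  have h0 := (contDiff_dww hf).comp
    (contDiff_const.prodMk contDiff_id : ContDiff ℝ 1 fun y : ℝ => (w, y))
  have h1 : ContDiff ℝ 1 fun y : ℝ => D.dww w y := h0
  obtain ⟨C, hC⟩ := hfb
  -- Boundedness is what makes the real supremum `normDwwv` an upper bound.
  have hbdd : BddAbove (Set.range fun z : ℝ × ℝ => |D.dwwv z.1 z.2|) :=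
    ⟨C, by rintro _ ⟨z, rfl⟩; exact hC _ _⟩
  exact convex_univ.norm_image_sub_le_of_norm_deriv_le (𝕜 := ℝ)
    (fun y _ => h1.differentiable (by norm_num) y)
    (fun y _ => le_ciSup hbdd (w, y)) (mem_univ v) (mem_univ v')

/-! ### The effective flux -/

theorem measurableSet_seg (s : ℕ) : MeasurableSet (D.seg s) := by
  unfold seg
  split_ifs
  · exact measurableSet_Ioc
  · exact measurableSet_Ico

theorem seg_subset_Icc (s : ℕ) : ∃ a b, D.seg s ⊆ Icc a b := by
  unfold seg
  split_ifs
  · exact ⟨_, _, Ioc_subset_Icc_self⟩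
  · exact ⟨_, _, Ico_subset_Icc_self⟩

theorem effSecond_intervalIntegrable (hf : ContDiff ℝ 3 (fun z : ℝ × ℝ => D.f z.1 z.2))
    (j s : ℕ) (a b : ℝ) : IntervalIntegrable (D.effSecond j s) volume a b := by
  have h1 : ∀ r ∈ D.comp j s, IntervalIntegrable ((D.seg r).indicator
      fun y => D.dww y (D.v (D.time j) (D.pos j r))) volume a b := fun r _ => by
    have h2 := (continuous_dww hf (D.v (D.time j) (D.pos j r))).intervalIntegrable (μ := volume) a b
    exact ⟨h2.1.indicator (measurableSet_seg r), h2.2.indicator (measurableSet_seg r)⟩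
  have h3 := IntervalIntegrable.sum (μ := volume) (a := a) (b := b) (D.comp j s) h1
  have h4 : D.effSecond j s = ∑ r ∈ D.comp j s, (D.seg r).indicator
      fun y => D.dww y (D.v (D.time j) (D.pos j r)) := by
    funext y
    rw [effSecond, Finset.sum_apply]
  rwa [h4]

theorem effSecond_bounded (hf : ContDiff ℝ 3 (fun z : ℝ × ℝ => D.f z.1 z.2)) (j s : ℕ) :
    ∃ C, ∀ y, |D.effSecond j s y| ≤ C := by
  have h1 : ∀ r, ∃ C, ∀ y, |(D.seg r).indicator
      (fun y => D.dww y (D.v (D.time j) (D.pos j r))) y| ≤ C := fun r => by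
    obtain ⟨a, b, hab⟩ := D.seg_subset_Icc r
    obtain ⟨C, hC⟩ := isCompact_Icc.exists_bound_of_continuousOn (s := Icc a b)
      (continuous_dww hf (D.v (D.time j) (D.pos j r))).continuousOn
    refine ⟨max C 0, fun y => ?_⟩
    by_cases hy : y ∈ D.seg r
    · rw [indicator_of_mem hy]
      exact (hC y (hab hy)).trans (le_max_left _ _)
    · rw [indicator_of_notMem hy, abs_zero]
      exact le_max_right _ _
  choose C hC using h1
  exact ⟨∑ r ∈ D.comp j s, C r, fun y => (Finset.abs_sum_le_sum_abs _ _).trans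
    (Finset.sum_le_sum fun r _ => hC r y)⟩

theorem hasDerivAt_effFlux (hf : ContDiff ℝ 3 (fun z : ℝ × ℝ => D.f z.1 z.2)) (j s : ℕ) (w : ℝ) :
    HasDerivAt (D.effFlux j s) (∫ y in (0 : ℝ)..w, D.effSecond j s y) w := by
  obtain ⟨C, hC⟩ := effSecond_bounded hf j s
  exact hasDerivAt_second_primitive (effSecond_intervalIntegrable hf j s) hC w

theorem Block.cell_injOn {c : ℝ} {A : Finset ℕ} {m n : ℤ} (h : D.Block c A m n) {r q : ℕ}
    (hr : r ∈ A) (hq : q ∈ A) (heq : D.cell r = D.cell q) : r = q := by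
  rcases lt_trichotomy r q with h1 | h1 | h1
  · have := h.mono r hr q hq h1
    rw [heq] at this
    exact absurd this (lt_irrefl _)
  · exact h1
  · have := h.mono q hq r hr h1
    rw [heq] at this
    exact absurd this (lt_irrefl _)

theorem Block.seg_disjoint {A : Finset ℕ} {m n : ℤ} (h : D.Block 1 A m n) (hε : 0 < D.ε) {r q : ℕ}
    (hr : r ∈ A) (hq : q ∈ A) {w : ℝ} (hwr : w ∈ D.seg r) (hwq : w ∈ D.seg q) : r = q := by
  rw [h.seg_pos hr] at hwr
  rw [h.seg_pos hq] at hwq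
  refine h.cell_injOn hr hq ?_
  have h1 : (D.cell r : ℝ) < D.cell q + 1 := by
    have := hwr.1.trans_le hwq.2
    rwa [mul_lt_mul_iff_left₀ hε] at this
  have h2 : (D.cell q : ℝ) < D.cell r + 1 := by
    have := hwq.1.trans_le hwr.2
    rwa [mul_lt_mul_iff_left₀ hε] at this
  have h3 : D.cell r < D.cell q + 1 := by exact_mod_cast h1
  have h4 : D.cell q < D.cell r + 1 := by exact_mod_cast h2
  omega

theorem effSecond_eq {j s : ℕ} {m n : ℤ} (hb : D.Block 1 (D.comp j s) m n) (hε : 0 < D.ε) {r : ℕ}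
    (hr : r ∈ D.comp j s) {w : ℝ} (hw : w ∈ D.seg r) :
    D.effSecond j s w = D.dww w (D.v (D.time j) (D.pos j r)) := by
  rw [effSecond, Finset.sum_eq_single r, indicator_of_mem hw]
  · intro q hq hqr
    refine indicator_of_notMem (fun hwq => hqr ?_) _
    exact hb.seg_disjoint hε hq hr hwq hw
  · exact fun h => absurd hr h

/-- On a block of waves where the first component is constant, the effective flux is the flux, up to
an affine function. -/
theorem exists_affine_effFlux (hf : ContDiff ℝ 3 (fun z : ℝ × ℝ => D.f z.1 z.2)) (hε : 0 < D.ε)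
    {j s : ℕ} {m n : ℤ} (hb : D.Block 1 (D.comp j s) m n) {A : Finset ℕ} {a b : ℤ}
    (hA : D.Block 1 A a b) (hsub : A ⊆ D.comp j s) {v : ℝ}
    (hv : ∀ r ∈ A, D.v (D.time j) (D.pos j r) = v) :
    ∃ α β : ℝ, ∀ w ∈ Icc (a * D.ε) (b * D.ε), D.f w v = D.effFlux j s w + (α + β * w) := by
  refine exists_affine_of_deriv (g₁' := fun x => deriv (fun y => D.f y v) x)
    (g₂' := fun x => ∫ y in (0 : ℝ)..x, D.effSecond j s y)
    (fun w _ => (differentiable_flux hf v w).hasDerivAt.hasDerivWithinAt)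
    (fun w _ => (hasDerivAt_effFlux hf j s w).hasDerivWithinAt) fun w hw => ?_
  have hint := effSecond_intervalIntegrable (D := D) hf j s
  rw [intervalIntegral.integral_interval_sub_left (hint _ _) (hint _ _),
    ← intervalIntegral.integral_eq_sub_of_hasDerivAt (fun x _ => hasDerivAt_dw hf v x)
      ((continuous_dww hf v).intervalIntegrable _ _)]
  refine intervalIntegral.integral_congr_ae (Filter.Eventually.of_forall fun y hy => ?_)
  rw [uIoc_of_le hw.1] at hy
  have hy' : y ∈ D.segs A := by
    rw [hA.segs_pos hε]
    exact ⟨hy.1, hy.2.trans hw.2⟩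
  obtain ⟨r, hr, hyr⟩ := mem_iUnion₂.1 hy'
  rw [effSecond_eq hb hε (hsub hr) hyr, hv r hr]

/-- Effective fluxes are unique, up to affine functions. -/
theorem IsEffectiveFlux.exists_affine (hf : ContDiff ℝ 3 (fun z : ℝ × ℝ => D.f z.1 z.2))
    (hε : 0 < D.ε) {j s : ℕ} {m n : ℤ} (hb : D.Block 1 (D.comp j s) m n) {g : ℝ → ℝ}
    (hg : D.IsEffectiveFlux j s g) :
    ∃ α β : ℝ, ∀ w ∈ Icc (m * D.ε) (n * D.ε), g w = D.effFlux j s w + (α + β * w) := by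
  obtain ⟨g', K, hK, hg', hae⟩ := hg
  rw [(hb.inf_sup_pos hε).1, (hb.inf_sup_pos hε).2] at hK hg'
  refine exists_affine_of_deriv (g₂' := fun x => ∫ y in (0 : ℝ)..x, D.effSecond j s y) hg'
    (fun w _ => (hasDerivAt_effFlux hf j s w).hasDerivWithinAt) fun w hw => ?_
  have hint := effSecond_intervalIntegrable (D := D) hf j s
  -- The Lipschitz bound makes `g'` the integral of its a.e. derivative; the a.e. identity alone
  -- would not determine it.
  have hac : AbsolutelyContinuousOnInterval g' (m * D.ε) w := by
    refine LipschitzOnWith.absolutelyContinuousOnInterval (K := K) ?_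
    rw [uIcc_of_le hw.1]
    exact hK.mono (Icc_subset_Icc_right hw.2)
  rw [intervalIntegral.integral_interval_sub_left (hint _ _) (hint _ _),
    ← hac.integral_deriv_eq_sub]
  have hae' : ∀ᵐ y, ∀ r ∈ D.comp j s, y ∈ D.seg r →
      HasDerivAt g' (D.dww y (D.v (D.time j) (D.pos j r))) y := by
    rw [Finset.eventually_all]
    intro r hr
    exact (ae_restrict_iff' (measurableSet_seg r)).1 (hae r hr)
  refine intervalIntegral.integral_congr_ae ?_
  filter_upwards [hae'] with y hy hyI
  rw [uIoc_of_le hw.1] at hyI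
  have hy' : y ∈ D.segs (D.comp j s) := by
    rw [hb.segs_pos hε]
    exact ⟨hyI.1, hyI.2.trans hw.2⟩
  obtain ⟨r, hr, hyr⟩ := mem_iUnion₂.1 hy'
  rw [effSecond_eq hb hε hr hyr, (hy r hr hyr).deriv]

theorem volume_seg {c : ℝ} {A : Finset ℕ} {m n : ℤ} (_h : D.Block c A m n) (s : ℕ) :
    volume (D.seg s) = ENNReal.ofReal D.ε := by
  unfold seg
  split_ifs
  · rw [Real.volume_Ioc]
    congr 1
    ring
  · rw [Real.volume_Ico]
    congr 1
    ring

/-- The variation, between two consecutive collision times, of the increments of the derivative of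
the effective flux. -/
theorem abs_effFlux_deriv_sub_le (hf : ContDiff ℝ 3 (fun z : ℝ × ℝ => D.f z.1 z.2)) (hε : 0 < D.ε)
    (hfb : ∃ C : ℝ, ∀ w v : ℝ, |D.dwwv w v| ≤ C) {i j s : ℕ} {m n m' n' : ℤ}
    (hbi : D.Block 1 (D.comp i s) m n) (hbj : D.Block 1 (D.comp j s) m' n')
    {A R : Finset ℕ} {a b : ℤ} (hA : D.Block 1 A a b) (hAi : A ⊆ D.comp i s)
    (hAj : A ⊆ D.comp j s) {κ : ℝ} (hκ : 0 ≤ κ)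
    (hR : ∀ r ∈ A, r ∈ R → |D.v (D.time j) (D.pos j r) - D.v (D.time i) (D.pos i r)| ≤ κ)
    (hR' : ∀ r ∈ A, r ∉ R → D.v (D.time j) (D.pos j r) = D.v (D.time i) (D.pos i r))
    {x y : ℝ} (hx : a * D.ε ≤ x) (hxy : x ≤ y) (hy : y ≤ b * D.ε) :
    |(∫ t in x..y, D.effSecond j s t) - ∫ t in x..y, D.effSecond i s t| ≤
      D.normDwwv * κ * (D.ε * R.card) := by
  have hN := D.normDwwv_nonneg
  rw [← intervalIntegral.integral_sub (effSecond_intervalIntegrable hf j s _ _)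
    (effSecond_intervalIntegrable hf i s _ _)]
  have hind : ∀ r, Integrable ((D.seg r).indicator fun _ => D.normDwwv * κ) volume := fun r => by
    refine (integrable_indicator_iff (measurableSet_seg r)).2 (integrableOn_const ?_)
    rw [volume_seg hA]
    exact ENNReal.ofReal_ne_top
  -- Dominating function: within `A` the two second derivatives differ, by at most `normDwwv * κ`,
  -- only on segments of waves of `R`, each of length `ε`.
  have hsum : Integrable (fun t => ∑ r ∈ R, (D.seg r).indicator (fun _ => D.normDwwv * κ) t)
      volume := integrable_finsetSum _ fun r _ => hind r
  have h1 := intervalIntegral.norm_integral_le_of_norm_le (μ := volume)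
    (f := fun t => D.effSecond j s t - D.effSecond i s t)
    (g := fun t => ∑ r ∈ R, (D.seg r).indicator (fun _ => D.normDwwv * κ) t) hxy
    (Filter.Eventually.of_forall fun t ht => ?_) hsum.intervalIntegrable
  · refine h1.trans ?_
    rw [intervalIntegral.integral_of_le hxy]
    refine (setIntegral_le_integral hsum (Filter.Eventually.of_forall fun t =>
      Finset.sum_nonneg fun r _ => indicator_nonneg (fun _ _ => mul_nonneg hN hκ) t)).trans ?_
    rw [integral_finsetSum _ fun r _ => hind r]
    rw [Finset.sum_congr rfl fun r _ => by
      rw [integral_indicator (measurableSet_seg r), setIntegral_const, Measure.real, volume_seg hA,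
        ENNReal.toReal_ofReal hε.le, smul_eq_mul]]
    rw [Finset.sum_const, nsmul_eq_mul]
    exact le_of_eq (by ring)
  · have ht' : t ∈ D.segs A := by
      rw [hA.segs_pos hε]
      exact ⟨hx.trans_lt ht.1, ht.2.trans hy⟩
    obtain ⟨r, hr, htr⟩ := mem_iUnion₂.1 ht'
    rw [effSecond_eq hbi hε (hAi hr) htr, effSecond_eq hbj hε (hAj hr) htr, Real.norm_eq_abs]
    by_cases hrR : r ∈ R
    · refine le_trans ?_ (Finset.single_le_sum (f := fun r =>
        (D.seg r).indicator (fun _ => D.normDwwv * κ) t)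
        (fun q _ => indicator_nonneg (fun _ _ => mul_nonneg hN hκ) t) hrR)
      rw [indicator_of_mem htr]
      exact (abs_dww_sub_le hf hfb _ _ _).trans (mul_le_mul_of_nonneg_left (hR r hr hrR) hN)
    · rw [hR' r hr hrR, sub_self, abs_zero]
      exact Finset.sum_nonneg fun r _ => indicator_nonneg (fun _ _ => mul_nonneg hN hκ) t

end WaveData

/-! ### The solution along the sequence of collision times -/

namespace WaveData

variable {D : WaveData}

/-- The standing assumptions on the parameter, the flux and the initial data. -/
structure Standing (D : WaveData) : Prop where
  eps : 0 < D.ε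
  flux : ContDiff ℝ 3 (fun z : ℝ × ℝ => D.f z.1 z.2)
  bound : ∃ C : ℝ, ∀ w v : ℝ, |D.dwwv w v| ≤ C
  datum_w : IsGridDatum D.ε D.w0
  datum_v : IsGridDatum D.ε D.v0
  hyp : ∀ w ∈ convexHull ℝ (Set.range D.w0), ∀ v ∈ Set.range D.v0,
    -1 < deriv (fun x => D.f x v) w

namespace Standing

theorem inv_state (H : D.Standing) {j : ℕ} (hbin : ∀ i < j, D.BinaryCollision i) :
    D.Inv (D.state j) := by
  induction j with
  | zero => exact Inv.start H.eps H.datum_w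
  | succ j ih =>
    exact (ih fun i hi => hbin i (by omega)).next (hbin j (by omega)).toBinary H.eps H.datum_w
      H.datum_v

theorem time_lt (H : D.Standing) {j : ℕ} (hb : D.BinaryCollision j) : D.time j < D.time (j + 1) :=
  hb.toBinary.time_lt H.datum_v

theorem time_nonneg (H : D.Standing) {j : ℕ} (hbin : ∀ i < j, D.BinaryCollision i) :
    0 ≤ D.time j := by
  induction j with
  | zero => exact le_rfl
  | succ j ih =>
    exact (ih fun i hi => hbin i (by omega)).trans (H.time_lt (hbin j (by omega))).le

end Standing

theorem alive_succ_subset (j : ℕ) : D.alive (j + 1) ⊆ D.alive j := next_alive_subset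

/-! ### Positions and times of last interaction -/

theorem posAt_of_time_le {j : ℕ} {t : ℝ} (ht : D.time j ≤ t) (r : ℕ) :
    D.posAt j t r = D.track (D.state j) t r := by
  rw [posAt, Nat.findGreatest_eq ht]

theorem posAt_time (j r : ℕ) : D.posAt j (D.time j) r = D.pos j r := by
  rw [posAt_of_time_le le_rfl, track, time, sub_self, mul_zero, add_zero, pos]

theorem posAt_succ {j : ℕ} {t : ℝ} (ht : t < D.time (j + 1)) (r : ℕ) :
    D.posAt (j + 1) t r = D.posAt j t r := by
  rw [posAt, posAt,
    Nat.findGreatest_of_not (P := fun i => D.time i ≤ t) (n := j) (not_le.2 ht)]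

/-- The times at which two waves are at the same position. -/
def meetings (D : WaveData) (j s s' : ℕ) : Set ℝ :=
  {t | t ∈ Icc 0 (D.time j) ∧ D.posAt j t s = D.posAt j t s'}

theorem lastTime_eq_time (H : D.Standing) {j s s' : ℕ} (hbin : ∀ i < j, D.BinaryCollision i)
    (hpos : D.pos j s = D.pos j s') : D.lastTime j s s' = D.time j := by
  have : IsGreatest (D.meetings j s s') (D.time j) :=
    ⟨⟨⟨H.time_nonneg hbin, le_rfl⟩, by rw [posAt_time, posAt_time, hpos]⟩, fun t ht => ht.1.2⟩
  exact this.csSup_eq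

theorem meetings_zero {s s' : ℕ} (hpos : D.pos 0 s ≠ D.pos 0 s') : D.meetings 0 s s' = ∅ := by
  refine Set.eq_empty_of_forall_notMem fun t ht => hpos ?_
  have h1 : t = D.time 0 := le_antisymm ht.1.2 ht.1.1
  have h2 := ht.2
  rwa [h1, posAt_time, posAt_time] at h2

theorem pos_succ_eq_of_not_divided {j r q : ℕ} (h : ¬ D.Divided j r q) :
    D.pos (j + 1) r = D.pos (j + 1) q := by
  rw [Divided, not_not, Prod.mk.injEq] at h
  change D.track (D.state j) _ r = D.track (D.state j) _ q
  rw [track, track]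
  rw [pos, pos, speed, speed] at h
  rw [h.1, h.2]

/-- Strictly between consecutive collision times distinct fronts do not meet, so waves apart at the
later time gain no new meeting. -/
theorem meetings_succ (H : D.Standing) {j s s' : ℕ} (hb : D.BinaryCollision j)
    (hs : s ∈ D.alive j) (hs' : s' ∈ D.alive j) (hpos : D.pos (j + 1) s ≠ D.pos (j + 1) s') :
    D.meetings (j + 1) s s' = D.meetings j s s' := by
  have hlt := H.time_lt hb
  ext t
  constructor
  · rintro ⟨⟨h0, h1⟩, h2⟩
    have ht : t < D.time (j + 1) := by
      refine lt_of_le_of_ne h1 fun h => hpos ?_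
      rwa [h, posAt_time, posAt_time] at h2
    rw [posAt_succ ht, posAt_succ ht] at h2
    refine ⟨⟨h0, ?_⟩, h2⟩
    by_contra! h3
    rw [posAt_of_time_le h3.le, posAt_of_time_le h3.le] at h2
    have hne : D.frontOf (D.state j) s ≠ D.frontOf (D.state j) s' := fun h =>
      hpos (pos_succ_eq_of_not_divided (not_not.2 h))
    exact frontPos_ne (frontOf_mem hs) (frontOf_mem hs') hne h3 ht h2
  · rintro ⟨⟨h0, h1⟩, h2⟩
    have ht : t < D.time (j + 1) := h1.trans_lt hlt
    exact ⟨⟨h0, ht.le⟩, by rw [posAt_succ ht, posAt_succ ht, h2]⟩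

theorem lastTime_le {j s s' : ℕ} (hint : D.AlreadyInteracted j s s') :
    D.lastTime j s s' ≤ D.time j := by
  obtain ⟨t, ht, htt⟩ := hint
  exact csSup_le (s := D.meetings j s s') ⟨t, ht, htt⟩ fun t ht => ht.1.2

theorem alreadyInteracted_of_succ (H : D.Standing) {j s s' : ℕ} (hb : D.BinaryCollision j)
    (hs : s ∈ D.alive j) (hs' : s' ∈ D.alive j) (hpos : D.pos (j + 1) s ≠ D.pos (j + 1) s')
    (hint : D.AlreadyInteracted (j + 1) s s') : D.AlreadyInteracted j s s' := by
  obtain ⟨t, ht, htt⟩ := hint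
  have : t ∈ D.meetings (j + 1) s s' := ⟨ht, htt⟩
  rw [meetings_succ H hb hs hs' hpos] at this
  exact ⟨t, this⟩

theorem lastTime_succ (H : D.Standing) {j s s' : ℕ} (hb : D.BinaryCollision j)
    (hs : s ∈ D.alive j) (hs' : s' ∈ D.alive j) (hpos : D.pos (j + 1) s ≠ D.pos (j + 1) s') :
    D.lastTime (j + 1) s s' = D.lastTime j s s' :=
  congrArg sSup (meetings_succ H hb hs hs' hpos)

theorem mem_commonInterval_of_pos_eq (H : D.Standing) {j s s' : ℕ}
    (hbin : ∀ i < j, D.BinaryCollision i) (hpos : D.pos j s = D.pos j s') {r : ℕ} :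
    r ∈ D.commonInterval j s s' ↔ r ∈ D.alive j ∧ D.pos j r = D.pos j s := by
  rw [commonInterval, lastTime_eq_time H hbin hpos, Finset.mem_filter, posAt_time, posAt_time]

theorem mem_commonInterval_succ (H : D.Standing) {j s s' : ℕ} (hb : D.BinaryCollision j)
    (hs : s ∈ D.alive j) (hs' : s' ∈ D.alive j) (hpos : D.pos (j + 1) s ≠ D.pos (j + 1) s')
    (hint : D.AlreadyInteracted j s s') {r : ℕ} :
    r ∈ D.commonInterval (j + 1) s s' ↔ r ∈ D.commonInterval j s s' ∧ r ∈ D.alive (j + 1) := by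
  have h1 := (lastTime_le hint).trans_lt (H.time_lt hb)
  rw [commonInterval, commonInterval, lastTime_succ H hb hs hs' hpos, Finset.mem_filter,
    Finset.mem_filter, posAt_succ h1, posAt_succ h1]
  constructor
  · rintro ⟨h2, h3⟩
    exact ⟨⟨alive_succ_subset j h2, h3⟩, h2⟩
  · rintro ⟨⟨-, h3⟩, h2⟩
    exact ⟨h2, h3⟩

theorem PRel_of_pos_eq (H : D.Standing) {j s s' : ℕ} (hbin : ∀ i < j, D.BinaryCollision i)
    (hpos : D.pos j s = D.pos j s') {p q : ℕ} :
    D.PRel s s' j p q ↔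
      p ∈ D.commonInterval j s s' ∧ q ∈ D.commonInterval j s s' ∧ ¬ D.Divided j p q := by
  cases j with
  | zero => rfl
  | succ j =>
    simp only [PRel, if_pos (lastTime_eq_time H hbin hpos)]

/-- Waves apart at the new time last met no later than the previous one, which selects the recursive
branch of the definition. -/
theorem PRel_succ (H : D.Standing) {j s s' : ℕ} (hb : D.BinaryCollision j)
    (hs : s ∈ D.alive j) (hs' : s' ∈ D.alive j) (hpos : D.pos (j + 1) s ≠ D.pos (j + 1) s')
    (hint : D.AlreadyInteracted j s s') {p q : ℕ} :
    D.PRel s s' (j + 1) p q ↔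
      p ∈ D.commonInterval (j + 1) s s' ∧ q ∈ D.commonInterval (j + 1) s s' ∧
      D.PRel s s' j p q ∧
        D.sigmaEnt (D.effFlux (j + 1) s) ((D.alive (j + 1)).filter (D.PRel s s' j p)) p =
          D.sigmaEnt (D.effFlux (j + 1) s) ((D.alive (j + 1)).filter (D.PRel s s' j p)) q := by
  have h1 := (lastTime_le hint).trans_lt (H.time_lt hb)
  rw [← lastTime_succ H hb hs hs' hpos] at h1
  simp only [PRel, if_neg h1.ne]

/-! ### Blocks in the solution -/

theorem comp_block (H : D.Standing) {j s : ℕ} (hbin : ∀ i < j, D.BinaryCollision i)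
    (hs : s ∈ D.alive j) (hpos : D.sgn s = 1) : ∃ m n, D.Block 1 (D.comp j s) m n := by
  refine (H.inv_state hbin).block H.eps H.datum_w (Or.inl rfl) (Finset.filter_subset _ _)
    ⟨s, ?_⟩ ?_ ?_
  · rw [comp, Finset.mem_filter]
    refine ⟨hs, fun q _ h1 h2 => ?_⟩
    rw [min_self] at h1
    rw [max_self] at h2
    rw [le_antisymm h2 h1]
  · intro r hr
    rw [comp, Finset.mem_filter] at hr
    rw [hr.2 r hr.1 (min_le_left _ _) (le_max_left _ _), hpos]
  · intro r hr q hq p hp hrp hpq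
    rw [comp, Finset.mem_filter] at hr hq ⊢
    refine ⟨hp, fun u hu h1 h2 => ?_⟩
    rcases le_total s p with hsp | hsp
    · exact hq.2 u hu (by omega) (by omega)
    · exact hr.2 u hu (by omega) (by omega)

/-- Waves between two surviving ones are not canceled, if they all are positive. -/
theorem alive_of_between (H : D.Standing) {j : ℕ} (hbin : ∀ i < j + 1, D.BinaryCollision i)
    {p q : ℕ} (hp : p ∈ D.alive (j + 1)) (hq : q ∈ D.alive (j + 1)) (hpq : p ≤ q)
    (hs : ∀ r ∈ D.alive j, p ≤ r → r ≤ q → D.sgn r = 1) {r : ℕ} (hr : r ∈ D.alive j)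
    (hpr : p ≤ r) (hrq : r ≤ q) : r ∈ D.alive (j + 1) := by
  rcases eq_or_lt_of_le hpr with rfl | hpr
  · exact hp
  have hsub := alive_succ_subset (D := D) j
  -- Before and after the collision, the number of living waves in `(p, q]` is the difference of the
  -- cells of `q` and `p`, which does not depend on time; so none was lost.
  have h1 := (H.inv_state fun i hi => hbin i (by omega) : D.Inv (D.state j)).cell_sub H.eps
    H.datum_w (hsub hp) (hsub hq) hpq hs
  have h2 := (H.inv_state hbin).cell_sub H.eps H.datum_w hp hq hpq
    fun r hr h h' => hs r (hsub hr) h h'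
  rw [h1, one_mul, one_mul, Nat.cast_inj] at h2
  have h3 : (D.state (j + 1)).alive.filter (fun r => p < r ∧ r ≤ q) ⊆
      (D.state j).alive.filter (fun r => p < r ∧ r ≤ q) := Finset.filter_subset_filter _ hsub
  have h4 := Finset.eq_of_subset_of_card_le h3 h2.le
  have h5 : r ∈ (D.state j).alive.filter (fun r => p < r ∧ r ≤ q) :=
    Finset.mem_filter.2 ⟨hr, hpr, hrq⟩
  rw [← h4] at h5
  exact (Finset.mem_filter.1 h5).1

/-! ### Comparison of Riemann problems, chords and extreme affine pieces -/

namespace Block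

variable {A : Finset ℕ} {m n : ℤ}

/-- A Riemann problem which does not divide two waves does not divide them either if it is
restricted from a larger one, up to affine functions. -/
theorem sigmaEnt_eq_of_subset (h : D.Block 1 A m n) (hε : 0 < D.ε) {A' : Finset ℕ} {m' n' : ℤ}
    (h' : D.Block 1 A' m' n') (hsub : A ⊆ A') {g g' : ℝ → ℝ} {α β : ℝ}
    (hg : ∀ w ∈ Icc (m * D.ε) (n * D.ε), g' w = g w + (α + β * w)) {p q : ℕ} (hp : p ∈ A)
    (hq : q ∈ A) (heq : D.sigmaEnt g A p = D.sigmaEnt g A q) :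
    D.sigmaEnt g' A' p = D.sigmaEnt g' A' q := by
  obtain ⟨e, he, hs⟩ := h.exists_env_pos hε g
  obtain ⟨e', he', hs'⟩ := h'.exists_env_pos hε g'
  obtain ⟨h1, h2⟩ := h'.le_of_subset h hsub
  rw [hs' p (hsub hp), hs' q (hsub hq)]
  rw [hs p hp, hs q hq, div_left_inj' hε.ne'] at heq
  rw [he.not_divides_of_subinterval he' h1 h2 (α := α) (β := β * D.ε) (fun l hl hl' => ?_)
    (h.cell_mem hp).1 (h.cell_mem hp).2 (h.cell_mem hq).1 (h.cell_mem hq).2 heq]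
  rw [hg _ (grid_mem_Icc hε hl hl')]
  ring

/-- The chord of the graph of `g` on the interval of values of `J` lies below the graph, at the grid
points. -/
def _root_.WaveData.ChordBelow (D : WaveData) (g : ℝ → ℝ) (J : Finset ℕ) : Prop :=
  ∀ a b, D.Block 1 J a b → ∀ l : ℤ, a ≤ l → l ≤ b →
    g (a * D.ε) + D.sigmaRH g J * ((l - a) * D.ε) ≤ g (l * D.ε)

theorem unique (h : D.Block 1 A m n) {m' n' : ℤ} (h' : D.Block 1 A m' n') : m = m' ∧ n = n' := by
  have h1 := h.le_of_subset h' subset_rfl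
  have h2 := h'.le_of_subset h subset_rfl
  omega

/-- The waves which the Riemann problem `A` does not divide from `p`. -/
theorem class_spec (h : D.Block 1 A m n) (hε : 0 < D.ε) (g : ℝ → ℝ) {p : ℕ} (hp : p ∈ A)
    {J : Finset ℕ} (hJ : ∀ q, q ∈ J ↔ q ∈ A ∧ D.sigmaEnt g A p = D.sigmaEnt g A q) :
    D.sigmaRH g J = D.sigmaEnt g A p ∧ D.ChordBelow g J := by
  obtain ⟨e, he, hs⟩ := h.exists_env_pos hε g
  obtain ⟨hp1, hp2⟩ := h.cell_mem hp
  obtain ⟨c, d, hc, hcp, hpd, hd, hec, hed, hcls⟩ := he.exists_class hp1 hp2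
  have hJb : D.Block 1 J c d := by
    refine h.of_image (fun q hq => ((hJ q).1 hq).1) (by omega) ?_
    ext k
    rw [Finset.mem_image, Finset.mem_Ico]
    constructor
    · rintro ⟨q, hq, rfl⟩
      obtain ⟨hqA, hqs⟩ := (hJ q).1 hq
      rw [hs p hp, hs q hqA, div_left_inj' hε.ne'] at hqs
      exact (hcls _ (h.cell_mem hqA).1 (h.cell_mem hqA).2).1 hqs.symm
    · rintro ⟨h1, h2⟩
      obtain ⟨q, hq, rfl⟩ := h.exists_cell_eq (k := k) (by omega) (by omega)
      refine ⟨q, (hJ q).2 ⟨hq, ?_⟩, rfl⟩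
      rw [hs p hp, hs q hq, (hcls _ (by omega) (by omega)).2 ⟨h1, h2⟩]
  have hsl : ∀ i, c ≤ i → i < d → e (i + 1) - e i = e (D.cell p + 1) - e (D.cell p) :=
    fun i h1 h2 => (hcls i (by omega) (by omega)).2 ⟨h1, h2⟩
  have hcd := GridEnv.affine_of_slopes (l := d) (by omega) le_rfl hsl
  rw [hec, hed] at hcd
  have hlt : (c : ℝ) < d := by exact_mod_cast (show c < d by omega)
  have hpos := sub_pos.2 hlt
  have hrh : D.sigmaRH g J = D.sigmaEnt g A p := by
    rw [hJb.sigmaRH_eq hε, hs p hp, hcd, add_sub_cancel_left, ← sub_mul]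
    field_simp
  refine ⟨hrh, fun a b hab l hl hl' => ?_⟩
  obtain ⟨rfl, rfl⟩ := hJb.unique hab
  have h1 := he.chord_le hc hd hl hl' hec hsl
  rw [hrh, hs p hp]
  refine le_trans (le_of_eq ?_) h1
  field_simp

/-- Envelope slopes increase, so the slope at `p` is at most that of the last affine piece. The
envelope touches the data at both ends of a piece, so this is the slope of a chord of `g` ending at
`n`. -/
theorem exists_last_class (h : D.Block 1 A m n) (hε : 0 < D.ε) (g : ℝ → ℝ) {p : ℕ} (hp : p ∈ A) :
    ∃ c, m ≤ c ∧ c < n ∧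
      D.sigmaEnt g A p ≤ (g (n * D.ε) - g (c * D.ε)) / (n * D.ε - c * D.ε) := by
  obtain ⟨e, he, hs⟩ := h.exists_env_pos hε g
  obtain ⟨hp1, hp2⟩ := h.cell_mem hp
  obtain ⟨c, d, hc, hcp, hpd, hd, hec, hed, hcls⟩ :=
    he.exists_class (k := n - 1) (by omega) (by omega)
  obtain rfl : d = n := by omega
  refine ⟨c, hc, by omega, ?_⟩
  have hcd := GridEnv.affine_of_slopes (l := d) (by omega) le_rfl
    fun i h1 h2 => (hcls i (by omega) (by omega)).2 ⟨h1, h2⟩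
  rw [hec, hed] at hcd
  have hlt : (c : ℝ) < d := by exact_mod_cast (show c < d by omega)
  have hpos := sub_pos.2 hlt
  have hm := he.mono hp1 (show D.cell p ≤ d - 1 by omega) (by omega)
  rw [hs p hp, hcd, add_sub_cancel_left, ← sub_mul, div_le_div_iff₀ hε (mul_pos hpos hε)]
  have := mul_le_mul_of_nonneg_right hm (mul_pos hpos hε).le
  linarith

/-- Mirror image of the previous bound, with the first affine piece and a chord starting at `m`. -/
theorem exists_first_class (h : D.Block 1 A m n) (hε : 0 < D.ε) (g : ℝ → ℝ) {p : ℕ} (hp : p ∈ A) :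
    ∃ d, m < d ∧ d ≤ n ∧
      (g (d * D.ε) - g (m * D.ε)) / (d * D.ε - m * D.ε) ≤ D.sigmaEnt g A p := by
  obtain ⟨e, he, hs⟩ := h.exists_env_pos hε g
  obtain ⟨hp1, hp2⟩ := h.cell_mem hp
  obtain ⟨c, d, hc, hcp, hpd, hd, hec, hed, hcls⟩ :=
    he.exists_class (k := m) le_rfl (by omega)
  obtain rfl : c = m := by omega
  refine ⟨d, hpd, hd, ?_⟩
  have hcd := GridEnv.affine_of_slopes (l := d) (by omega) le_rfl
    fun i h1 h2 => (hcls i (by omega) (by omega)).2 ⟨h1, h2⟩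
  rw [hec, hed] at hcd
  have hlt : (c : ℝ) < d := by exact_mod_cast (show c < d by omega)
  have hpos := sub_pos.2 hlt
  have hm := he.mono le_rfl hp1 hp2
  rw [hs p hp, hcd, add_sub_cancel_left, ← sub_mul, div_le_div_iff₀ (mul_pos hpos hε) hε]
  have := mul_le_mul_of_nonneg_right hm (mul_pos hpos hε).le
  rw [hec] at this
  linarith

end Block

end WaveData

/-! ### Weights and the inductive properties of the partition -/

namespace WaveData

variable {D : WaveData}

theorem M_nonneg (hε : 0 < D.ε) (j s s' p p' : ℕ) : 0 ≤ D.M j s s' p p' :=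
  Finset.sum_nonneg fun _ _ => mul_nonneg hε.le (Nat.cast_nonneg _)

theorem weight_nonneg (hε : 0 < D.ε) (s s' p p' j : ℕ) : 0 ≤ D.weight s s' p p' j := by
  induction j with
  | zero => exact le_rfl
  | succ j ih =>
    rw [weight]
    split_ifs
    · exact add_nonneg ih (mul_nonneg (mul_nonneg (mul_nonneg zero_le_two D.normDwwv_nonneg)
        (abs_nonneg _)) (M_nonneg hε _ _ _ _ _))
    · exact ih
    · exact le_rfl

/-- In a non-transversal collision the point is not a jump of `v0`, its strength is zero, and the
transversal formula still holds. -/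
theorem weight_succ_of_divided {j s s' : ℕ} (hdiv : D.Divided j s s') (p p' : ℕ) :
    D.weight s s' p p' (j + 1) = D.weight s s' p p' j +
      2 * D.normDwwv * D.vStrength (D.collPoint j + D.time (j + 1)) * D.M j s s' p p' := by
  rw [weight, if_neg (not_not.2 hdiv)]
  split_ifs with h
  · rfl
  · have : D.vStrength (D.collPoint j + D.time (j + 1)) = 0 := by
      rw [IsTransversal, vJumps, mem_ofPred_eq, not_not] at h
      rw [vStrength, h, sub_self, abs_zero]
    rw [this]
    ring

/-- An interval of positive waves containing `s` is contained in the maximal one. -/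
theorem subset_comp {j s : ℕ} {I : Finset ℕ} (hsub : I ⊆ D.alive j) (hs : s ∈ I)
    (hsgn : ∀ r ∈ I, D.sgn r = 1)
    (hconv : ∀ r ∈ I, ∀ q ∈ I, ∀ p ∈ D.alive j, r < p → p < q → p ∈ I) : I ⊆ D.comp j s := by
  intro r hr
  rw [comp, Finset.mem_filter]
  refine ⟨hsub hr, fun q hq h1 h2 => ?_⟩
  rw [hsgn s hs]
  by_cases hqr : q = r
  · exact hsgn q (hqr ▸ hr)
  by_cases hqs : q = s
  · exact hsgn q (hqs ▸ hs)
  rcases le_total r s with h3 | h3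
  · exact hsgn q (hconv r hr s hs q hq (by omega) (by omega))
  · exact hsgn q (hconv s hs r hr q hq (by omega) (by omega))

/-- The properties of the partition `P(t_j, s, s')`. -/
structure Good (D : WaveData) (j s s' : ℕ) : Prop where
  sub : D.commonInterval j s s' ⊆ D.alive j
  mem_left : s ∈ D.commonInterval j s s'
  sgn : ∀ r ∈ D.commonInterval j s s', D.sgn r = 1
  conv : ∀ r ∈ D.commonInterval j s s', ∀ q ∈ D.commonInterval j s s', ∀ p ∈ D.alive j,
    r < p → p < q → p ∈ D.commonInterval j s s'
  rel_mem : ∀ p q, D.PRel s s' j p q →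
    p ∈ D.commonInterval j s s' ∧ q ∈ D.commonInterval j s s'
  rel_refl : ∀ p ∈ D.commonInterval j s s', D.PRel s s' j p p
  rel_symm : ∀ p q, D.PRel s s' j p q → D.PRel s s' j q p
  rel_trans : ∀ p q r, D.PRel s s' j p q → D.PRel s s' j q r → D.PRel s s' j p r
  rel_conv : ∀ p q r, D.PRel s s' j p r → q ∈ D.commonInterval j s s' → p < q → q < r →
    D.PRel s s' j p q
  joined : ∀ p q, D.PRel s s' j p q → ¬ D.Divided j p q
  chord : ∀ p ∈ D.commonInterval j s s', D.ChordBelow (D.effFlux j s) (D.PClass j s s' p)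
  ineq : ∀ p ∈ D.commonInterval j s s', ∀ p' ∈ D.commonInterval j s s', p < p' →
    ¬ D.PRel s s' j p p' →
    D.sigmaRH (D.effFlux j s) (D.PClass j s s' p) -
      D.sigmaRH (D.effFlux j s) (D.PClass j s s' p') ≤ D.weight s s' p p' j

/-- If the waves `s, s'` are at the same position, the partition is given by the Riemann problem,
with the effective flux, at this position. -/
theorem PRel_iff_effFlux_of_pos_eq (H : D.Standing) {j s s' : ℕ}
    (hbin : ∀ i < j, D.BinaryCollision i)
    (hs : s ∈ D.alive j) (hsgn : D.sgn s = 1) (hpos : D.pos j s = D.pos j s') {m n : ℤ}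
    (hI : D.Block 1 (D.commonInterval j s s') m n) {p q : ℕ} :
    D.PRel s s' j p q ↔ p ∈ D.commonInterval j s s' ∧ q ∈ D.commonInterval j s s' ∧
      D.sigmaEnt (D.effFlux j s) (D.commonInterval j s s') p =
        D.sigmaEnt (D.effFlux j s) (D.commonInterval j s s') q := by
  have hmem := fun r => mem_commonInterval_of_pos_eq H (r := r) hbin hpos
  obtain ⟨m', n', hcomp⟩ := comp_block H hbin hs hsgn
  have hinv := H.inv_state hbin
  have hsub : D.commonInterval j s s' ⊆ D.comp j s := by
    intro r hr
    obtain ⟨h1, h2⟩ := (hmem r).1 hr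
    rw [comp, Finset.mem_filter]
    refine ⟨h1, fun q hq h3 h4 => ?_⟩
    refine hinv.homog q hq s hs ?_
    change D.pos j q = D.pos j s
    rcases le_total r s with h5 | h5
    · rw [min_eq_left h5] at h3
      rw [max_eq_right h5] at h4
      exact le_antisymm (hinv.mono q hq s hs h4) (h2 ▸ hinv.mono r h1 q hq h3)
    · rw [min_eq_right h5] at h3
      rw [max_eq_left h5] at h4
      exact le_antisymm (h2 ▸ hinv.mono q hq r h1 h4) (hinv.mono s hs q hq h3)
  obtain ⟨α, β, haff⟩ := exists_affine_effFlux H.flux H.eps hcomp hI hsub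
    (v := D.v (D.time j) (D.pos j s)) fun r hr => by rw [((hmem r).1 hr).2]
  have hfilter : (D.state j).alive.filter (fun r => (D.state j).pos r = (D.state j).pos s) =
      D.commonInterval j s s' := by
    ext r
    rw [Finset.mem_filter, hmem]
    rfl
  have hspeed : ∀ r ∈ D.commonInterval j s s', D.speed j r =
      D.sigmaEnt (fun w => D.f w (D.v (D.time j) (D.pos j s))) (D.commonInterval j s s') r := by
    intro r hr
    have h1 : (D.state j).pos r = (D.state j).pos s := ((hmem r).1 hr).2
    rw [speed, speedIn, h1, hfilter]
    rfl
  have hdiv : ∀ p ∈ D.commonInterval j s s', ∀ q ∈ D.commonInterval j s s',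
      (¬ D.Divided j p q ↔ D.speed j p = D.speed j q) := by
    intro p hp q hq
    rw [Divided, not_not, Prod.mk.injEq, ((hmem p).1 hp).2, ((hmem q).1 hq).2]
    exact and_iff_right rfl
  rw [PRel_of_pos_eq H hbin hpos]
  refine and_congr_right fun hp => and_congr_right fun hq => ?_
  rw [hdiv p hp q hq, hspeed p hp, hspeed q hq]
  constructor
  · refine hI.sigmaEnt_eq_of_subset H.eps hI subset_rfl (α := -α) (β := -β) (fun w hw => ?_) hp hq
    rw [haff w hw]
    ring
  · exact hI.sigmaEnt_eq_of_subset H.eps hI subset_rfl haff hp hq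

theorem commonInterval_block_of_pos_eq (H : D.Standing) {j s s' : ℕ}
    (hbin : ∀ i < j, D.BinaryCollision i)
    (hs : s ∈ D.alive j) (hsgn : D.sgn s = 1) (hpos : D.pos j s = D.pos j s') :
    ∃ m n, D.Block 1 (D.commonInterval j s s') m n := by
  obtain ⟨m, n, h⟩ := (H.inv_state hbin).block_at H.eps H.datum_w hs
  refine ⟨m, n, ?_⟩
  convert h using 1
  · exact hsgn.symm
  · ext r
    rw [Finset.mem_filter, mem_commonInterval_of_pos_eq H hbin hpos]
    rfl

namespace Good

/-- The partition is that of one Riemann problem on the whole interval, so the speeds of the classes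
are slopes of a single convex envelope and increase from left to right. No property of earlier
partitions is needed. -/
theorem of_pos_eq (H : D.Standing) {j s s' : ℕ} (hbin : ∀ i < j, D.BinaryCollision i)
    (hs : s ∈ D.alive j) (hsgn : D.sgn s = 1) (hpos : D.pos j s = D.pos j s') :
    D.Good j s s' := by
  have hmem := fun r => mem_commonInterval_of_pos_eq H (r := r) hbin hpos
  obtain ⟨m, n, hI⟩ := commonInterval_block_of_pos_eq H hbin hs hsgn hpos
  have hrel := fun p q => PRel_iff_effFlux_of_pos_eq H (p := p) (q := q) hbin hs hsgn hpos hI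
  have hinv := H.inv_state hbin
  have hclass : ∀ p ∈ D.commonInterval j s s', ∀ q, q ∈ D.PClass j s s' p ↔
      q ∈ D.commonInterval j s s' ∧
      D.sigmaEnt (D.effFlux j s) (D.commonInterval j s s') p =
        D.sigmaEnt (D.effFlux j s) (D.commonInterval j s s') q := by
    intro p hp q
    rw [PClass, Finset.mem_filter, hrel]
    tauto
  have hmono : ∀ p ∈ D.commonInterval j s s', ∀ q ∈ D.commonInterval j s s', p < q →
      D.sigmaEnt (D.effFlux j s) (D.commonInterval j s s') p ≤
        D.sigmaEnt (D.effFlux j s) (D.commonInterval j s s') q := fun p hp q hq hpq =>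
    hI.sigmaEnt_mono (Or.inl rfl) H.eps _ hp hq hpq
  refine ⟨fun r hr => ((hmem r).1 hr).1, (hmem s).2 ⟨hs, rfl⟩, hI.sgn, ?_, ?_, ?_, ?_, ?_, ?_, ?_,
    ?_, ?_⟩
  · intro r hr q hq p hp hrp hpq
    obtain ⟨h1, h2⟩ := (hmem r).1 hr
    obtain ⟨h3, h4⟩ := (hmem q).1 hq
    exact (hmem p).2 ⟨hp, le_antisymm (h4 ▸ hinv.mono p hp q h3 hpq.le)
      (h2 ▸ hinv.mono r h1 p hp hrp.le)⟩
  · exact fun p q h => ⟨((hrel p q).1 h).1, ((hrel p q).1 h).2.1⟩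
  · exact fun p hp => (hrel p p).2 ⟨hp, hp, rfl⟩
  · intro p q h
    obtain ⟨h1, h2, h3⟩ := (hrel p q).1 h
    exact (hrel q p).2 ⟨h2, h1, h3.symm⟩
  · intro p q r h h'
    obtain ⟨h1, h2, h3⟩ := (hrel p q).1 h
    obtain ⟨h4, h5, h6⟩ := (hrel q r).1 h'
    exact (hrel p r).2 ⟨h1, h5, h3.trans h6⟩
  · intro p q r h hq hpq hqr
    obtain ⟨h1, h2, h3⟩ := (hrel p r).1 h
    exact (hrel p q).2 ⟨h1, hq, le_antisymm (hmono p h1 q hq hpq) (h3 ▸ hmono q hq r h2 hqr)⟩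
  · exact fun p q h => ((PRel_of_pos_eq H hbin hpos).1 h).2.2
  · exact fun p hp => (hI.class_spec H.eps _ hp (hclass p hp)).2
  · intro p hp p' hp' hlt _
    rw [(hI.class_spec H.eps _ hp (hclass p hp)).1, (hI.class_spec H.eps _ hp' (hclass p' hp')).1]
    have h1 := hmono p hp p' hp' hlt
    have h2 := D.weight_nonneg H.eps s s' p p' j
    linarith

variable {j s s' : ℕ}

theorem mem_PClass (h : D.Good j s s') {p q : ℕ} :
    q ∈ D.PClass j s s' p ↔ D.PRel s s' j p q := by
  rw [PClass, Finset.mem_filter]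
  exact and_iff_right_of_imp fun hpq => (h.rel_mem p q hpq).2

theorem PClass_eq (h : D.Good j s s') {p q : ℕ} (hpq : D.PRel s s' j p q) :
    D.PClass j s s' p = D.PClass j s s' q := by
  ext r
  rw [h.mem_PClass, h.mem_PClass]
  exact ⟨fun h1 => h.rel_trans _ _ _ (h.rel_symm _ _ hpq) h1, fun h1 => h.rel_trans _ _ _ hpq h1⟩

theorem interval_block (h : D.Good j s s') (H : D.Standing)
    (hbin : ∀ i < j, D.BinaryCollision i) : ∃ m n, D.Block 1 (D.commonInterval j s s') m n :=
  (H.inv_state hbin).block H.eps H.datum_w (Or.inl rfl) h.sub ⟨s, h.mem_left⟩ h.sgn h.conv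

/-- Classes are intervals of waves. -/
theorem rel_conv_of_mem (h : D.Good j s s') {p r q t : ℕ} (hr : D.PRel s s' j p r)
    (hq : D.PRel s s' j p q) (ht : t ∈ D.alive j) (hrt : r < t) (htq : t < q) :
    D.PRel s s' j p t := by
  have h1 := h.rel_trans _ _ _ (h.rel_symm _ _ hr) hq
  obtain ⟨h2, h3⟩ := h.rel_mem _ _ h1
  exact h.rel_trans _ _ _ hr (h.rel_conv _ _ _ h1 (h.conv _ h2 _ h3 _ ht hrt htq) hrt htq)

theorem class_block (h : D.Good j s s') (H : D.Standing) (hbin : ∀ i < j, D.BinaryCollision i)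
    {p : ℕ} (hp : p ∈ D.commonInterval j s s') : ∃ a b, D.Block 1 (D.PClass j s s' p) a b := by
  refine (H.inv_state hbin).block H.eps H.datum_w (Or.inl rfl) ?_
    ⟨p, h.mem_PClass.2 (h.rel_refl p hp)⟩ ?_ ?_
  · exact (Finset.filter_subset _ _).trans h.sub
  · exact fun r hr => h.sgn r (h.rel_mem _ _ (h.mem_PClass.1 hr)).2
  · intro r hr q hq t ht hrt htq
    rw [h.mem_PClass] at hr hq ⊢
    exact h.rel_conv_of_mem hr hq ht hrt htq

theorem classes_lt (h : D.Good j s s') {p q : ℕ} (hp : p ∈ D.commonInterval j s s')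
    (hpq : p < q) (hn : ¬ D.PRel s s' j p q) :
    WavesLT (D.PClass j s s' p) (D.PClass j s s' q) := by
  intro x hx y hy
  rw [h.mem_PClass] at hx hy
  by_contra! hyx
  rcases eq_or_lt_of_le hyx with rfl | hyx
  · exact hn (h.rel_trans _ _ _ hx (h.rel_symm _ _ hy))
  rcases lt_trichotomy p y with h1 | rfl | h1
  · have h2 := h.rel_conv _ _ _ hx (h.rel_mem _ _ hy).2 h1 hyx
    exact hn (h.rel_trans _ _ _ h2 (h.rel_symm _ _ hy))
  · exact hn (h.rel_symm _ _ hy)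
  · have h2 := h.rel_conv _ _ _ (h.rel_symm _ _ hy) hp h1 hpq
    exact hn (h.rel_symm _ _ (h.rel_trans _ _ _ hy h2))

theorem interval_subset_comp (h : D.Good j s s') : D.commonInterval j s s' ⊆ D.comp j s :=
  subset_comp h.sub h.mem_left h.sgn h.conv

end Good

end WaveData

namespace WaveData

variable {D : WaveData} {j s s' : ℕ}

/-! ### The first family at a collision -/

theorem v_succ_eq (H : D.Standing) (hbin : ∀ i < j + 1, D.BinaryCollision i) {r : ℕ}
    (hr : r ∈ D.alive j) (hne : D.pos (j + 1) r ≠ D.collPoint j) :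
    D.v (D.time (j + 1)) (D.pos (j + 1) r) = D.v (D.time j) (D.pos j r) :=
  ((H.inv_state fun i hi => hbin i (by omega)).v_track (hbin j (by omega)).toBinary H.eps H.datum_w
    H.datum_v H.flux H.hyp hr).2 hne

/-- At the collision point the left limit of `v` is the value the wave saw before, so `v` changes
along it by exactly the strength of the first-family front, zero if there is none. -/
theorem abs_v_succ_sub (H : D.Standing) (hbin : ∀ i < j + 1, D.BinaryCollision i) {r : ℕ}
    (hr : r ∈ D.alive j) (heq : D.pos (j + 1) r = D.collPoint j) :
    |D.v (D.time (j + 1)) (D.pos (j + 1) r) - D.v (D.time j) (D.pos j r)| =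
      D.vStrength (D.collPoint j + D.time (j + 1)) := by
  have h1 : Function.leftLim D.v0 (D.pos (j + 1) r + D.time (j + 1)) =
      D.v0 (D.pos j r + D.time j) :=
    ((H.inv_state fun i hi => hbin i (by omega)).v_track (hbin j (by omega)).toBinary H.eps
      H.datum_w H.datum_v H.flux H.hyp hr).1
  rw [vStrength, ← heq, h1]
  rfl

namespace Good

/-- The increment of the weight controls the strength of the waves, at the collision point, between
two elements of the partition. -/
theorem card_le_weight (h : D.Good j s s') (H : D.Standing)
    (hbin : ∀ i < j + 1, D.BinaryCollision i) (hdiv : D.Divided j s s') {p p' : ℕ}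
    (hp : p ∈ D.commonInterval j s s') {R : Finset ℕ}
    (hR : ∀ r ∈ R, r ∈ D.commonInterval j s s' ∧ D.pos (j + 1) r = D.collPoint j ∧
      (D.PRel s s' j p r ∨ p < r) ∧ (D.PRel s s' j r p' ∨ r < p')) :
    D.normDwwv * D.vStrength (D.collPoint j + D.time (j + 1)) * (D.ε * R.card) ≤
      D.weight s s' p p' (j + 1) - D.weight s s' p p' j := by
  have hN := D.normDwwv_nonneg
  have hε := H.eps
  have hV : 0 ≤ D.vStrength (D.collPoint j + D.time (j + 1)) := abs_nonneg _
  have hM := M_nonneg hε j s s' p p'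
  rw [weight_succ_of_divided hdiv, add_sub_cancel_left]
  -- Off the jumps of `v0` the strength is zero and both sides vanish.
  by_cases ht : D.collPoint j + D.time (j + 1) ∈ D.vJumps
  · have hsub : R ⊆ ((D.P j s s').filter fun J => WavesLE (D.PClass j s s' p) J ∧
        WavesLE J (D.PClass j s s' p') ∧ J ⊆ D.wavesAtColl j).biUnion id := by
      intro r hr
      obtain ⟨hrI, hrc, h1, h2⟩ := hR r hr
      rw [Finset.mem_biUnion]
      refine ⟨D.PClass j s s' r, ?_, h.mem_PClass.2 (h.rel_refl r hrI)⟩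
      rw [Finset.mem_filter]
      refine ⟨Finset.mem_image_of_mem _ hrI, ?_, ?_, ?_⟩
      · by_cases hpr : D.PRel s s' j p r
        · exact Or.inr (h.PClass_eq hpr)
        · exact Or.inl (h.classes_lt hp (h1.resolve_left hpr) hpr)
      · by_cases hpr : D.PRel s s' j r p'
        · exact Or.inr (h.PClass_eq hpr)
        · exact Or.inl (h.classes_lt hrI (h2.resolve_left hpr) hpr)
      · intro q hq
        rw [h.mem_PClass] at hq
        -- A class is joined, so if one of its waves reaches the collision point all of them do; in
        -- a transversal collision none is canceled.
        have hqa : q ∈ D.alive j := h.sub (h.rel_mem _ _ hq).2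
        have hqc : D.pos (j + 1) q = D.collPoint j := by
          rw [← pos_succ_eq_of_not_divided (h.joined _ _ hq), hrc]
        rw [wavesAtColl, Finset.mem_filter]
        refine ⟨mem_next_alive.2 ⟨hqa, fun hqA => ?_⟩, hqc⟩
        exact (H.inv_state fun i hi => hbin i (by omega)).survives_of_transversal
          (hbin j (by omega)).toBinary H.eps H.datum_w H.datum_v H.flux H.hyp ht hqA
    have hcard : D.ε * R.card ≤ D.M j s s' p p' := by
      rw [M, ← Finset.mul_sum]
      refine mul_le_mul_of_nonneg_left ?_ hε.le
      exact_mod_cast (Finset.card_le_card hsub).trans Finset.card_biUnion_le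
    -- Half of the factor `2` in the weight is enough.
    have h1 := mul_le_mul_of_nonneg_left hcard (mul_nonneg hN hV)
    have h2 := mul_nonneg (mul_nonneg hN hV) hM
    linarith
  · have : D.vStrength (D.collPoint j + D.time (j + 1)) = 0 := by
      rw [vJumps, mem_ofPred_eq, not_not] at ht
      rw [vStrength, ht, sub_self, abs_zero]
    rw [this]
    simp

end Good

/-- The comparison of mean slopes at two consecutive collision times. -/
theorem slope_sub_slope_le (H : D.Standing) {i j : ℕ} {m n m' n' : ℤ}
    (hbi : D.Block 1 (D.comp i s) m n) (hbj : D.Block 1 (D.comp j s) m' n')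
    {A R : Finset ℕ} {a d b c : ℤ} (hA : D.Block 1 A c d) (hAi : A ⊆ D.comp i s)
    (hAj : A ⊆ D.comp j s) {κ : ℝ} (hκ : 0 ≤ κ)
    (hR : ∀ r ∈ A, r ∈ R → |D.v (D.time j) (D.pos j r) - D.v (D.time i) (D.pos i r)| ≤ κ)
    (hR' : ∀ r ∈ A, r ∉ R → D.v (D.time j) (D.pos j r) = D.v (D.time i) (D.pos i r))
    (hcb : c < b) (hba : b ≤ a) (had : a < d) {x y : ℝ}
    (hx : D.effFlux i s (b * D.ε) - D.effFlux i s (c * D.ε) ≤ x * (b * D.ε - c * D.ε))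
    (hy : y * (d * D.ε - a * D.ε) ≤ D.effFlux i s (d * D.ε) - D.effFlux i s (a * D.ε)) :
    (D.effFlux j s (b * D.ε) - D.effFlux j s (c * D.ε)) / (b * D.ε - c * D.ε) -
      (D.effFlux j s (d * D.ε) - D.effFlux j s (a * D.ε)) / (d * D.ε - a * D.ε) ≤
      x - y + D.normDwwv * κ * (D.ε * R.card) := by
  have hε := H.eps
  have hlt1 : (c : ℝ) * D.ε < b * D.ε := mul_lt_mul_of_pos_right (by exact_mod_cast hcb) hε
  have hle : (b : ℝ) * D.ε ≤ a * D.ε := mul_le_mul_of_nonneg_right (by exact_mod_cast hba) hε.le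
  have hlt2 : (a : ℝ) * D.ε < d * D.ε := mul_lt_mul_of_pos_right (by exact_mod_cast had) hε
  have hd : ∀ w, HasDerivAt (fun w => D.effFlux j s w - D.effFlux i s w)
      ((∫ t in (0 : ℝ)..w, D.effSecond j s t) - ∫ t in (0 : ℝ)..w, D.effSecond i s t) w := fun w =>
    (hasDerivAt_effFlux H.flux j s w).sub (hasDerivAt_effFlux H.flux i s w)
  have hcont : ∀ S : Set ℝ, ContinuousOn (fun w => D.effFlux j s w - D.effFlux i s w) S :=
    fun S w _ => (hd w).continuousAt.continuousWithinAt
  -- The change of each mean slope is the derivative of (new flux - old flux) at some point of its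
  -- interval. As `ξ < η`, the difference of the two changes is an integral of second derivatives
  -- over `[ξ, η]`.
  obtain ⟨ξ, hξ, hξe⟩ := exists_hasDerivAt_eq_slope _ _ hlt1 (hcont _) fun w _ => hd w
  obtain ⟨η, hη, hηe⟩ := exists_hasDerivAt_eq_slope _ _ hlt2 (hcont _) fun w _ => hd w
  have hint := fun i => effSecond_intervalIntegrable (D := D) H.flux i s
  have hkey := abs_effFlux_deriv_sub_le H.flux hε H.bound hbi hbj hA hAi hAj hκ hR hR'
    (x := ξ) (y := η) hξ.1.le (by linarith [hξ.2, hη.1]) hη.2.le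
  rw [← intervalIntegral.integral_interval_sub_left (hint j 0 η) (hint j 0 ξ),
    ← intervalIntegral.integral_interval_sub_left (hint i 0 η) (hint i 0 ξ)] at hkey
  have hkey' := (abs_le.1 hkey).1
  have h1 : (D.effFlux j s (b * D.ε) - D.effFlux j s (c * D.ε)) / (b * D.ε - c * D.ε) =
      (D.effFlux i s (b * D.ε) - D.effFlux i s (c * D.ε)) / (b * D.ε - c * D.ε) +
        ((∫ t in (0 : ℝ)..ξ, D.effSecond j s t) - ∫ t in (0 : ℝ)..ξ, D.effSecond i s t) := by
    rw [hξe, ← add_div]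
    congr 1
    ring
  have h2 : (D.effFlux j s (d * D.ε) - D.effFlux j s (a * D.ε)) / (d * D.ε - a * D.ε) =
      (D.effFlux i s (d * D.ε) - D.effFlux i s (a * D.ε)) / (d * D.ε - a * D.ε) +
        ((∫ t in (0 : ℝ)..η, D.effSecond j s t) - ∫ t in (0 : ℝ)..η, D.effSecond i s t) := by
    rw [hηe, ← add_div]
    congr 1
    ring
  rw [← div_le_iff₀ (sub_pos.2 hlt1)] at hx
  rw [← le_div_iff₀ (sub_pos.2 hlt2)] at hy
  linarith

/-! ### The inductive step -/

namespace Good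

/-- Since `s`, `s'` are apart at the new time, the partition refines the old one: `K p` below is the
surviving part of the old class of `p`, split by the Riemann problem with the new effective flux. -/
theorem succ (h : D.Good j s s') (H : D.Standing) (hbin : ∀ i < j + 1, D.BinaryCollision i)
    (hs : s ∈ D.alive (j + 1)) (hs' : s' ∈ D.alive (j + 1))
    (hpos : D.pos (j + 1) s ≠ D.pos (j + 1) s') (hint : D.AlreadyInteracted j s s') :
    D.Good (j + 1) s s' := by
  have hε := H.eps
  have hbin' : ∀ i < j, D.BinaryCollision i := fun i hi => hbin i (by omega)
  have hb := hbin j (by omega)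
  have hsub := alive_succ_subset (D := D) j
  have hinv := H.inv_state hbin
  have hdiv : D.Divided j s s' := by
    by_contra hc
    exact hpos (pos_succ_eq_of_not_divided hc)
  have hmem := fun r => mem_commonInterval_succ H (r := r) hb (hsub hs) (hsub hs') hpos hint
  have hrel := fun p q => PRel_succ H (p := p) (q := q) hb (hsub hs) (hsub hs') hpos hint
  set K : ℕ → Finset ℕ := fun p => (D.alive (j + 1)).filter (D.PRel s s' j p) with hK
  have hmemK : ∀ p q, q ∈ K p ↔ q ∈ D.alive (j + 1) ∧ D.PRel s s' j p q := fun p q =>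
    Finset.mem_filter
  have hKeq : ∀ p q, D.PRel s s' j p q → K p = K q := by
    intro p q hpq
    ext r
    rw [hmemK, hmemK]
    exact and_congr_right fun _ => ⟨fun h1 => h.rel_trans _ _ _ (h.rel_symm _ _ hpq) h1,
      fun h1 => h.rel_trans _ _ _ hpq h1⟩
  have hKself : ∀ p ∈ D.commonInterval (j + 1) s s', p ∈ K p := fun p hp =>
    (hmemK p p).2 ⟨((hmem p).1 hp).2, h.rel_refl p ((hmem p).1 hp).1⟩
  have hKI : ∀ p q, q ∈ K p → q ∈ D.commonInterval (j + 1) s s' := fun p q hq =>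
    (hmem q).2 ⟨(h.rel_mem _ _ ((hmemK p q).1 hq).2).2, ((hmemK p q).1 hq).1⟩
  have hKb : ∀ p ∈ D.commonInterval (j + 1) s s', ∃ a b, D.Block 1 (K p) a b := by
    intro p hp
    refine hinv.block hε H.datum_w (Or.inl rfl) (Finset.filter_subset _ _) ⟨p, hKself p hp⟩ ?_ ?_
    · exact fun r hr => h.sgn r (h.rel_mem _ _ ((hmemK p r).1 hr).2).2
    · intro r hr q hq t ht hrt htq
      rw [hmemK] at hr hq ⊢
      exact ⟨ht, h.rel_conv_of_mem hr.2 hq.2 (hsub ht) hrt htq⟩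
  have hIsub : D.commonInterval (j + 1) s s' ⊆ D.alive (j + 1) := fun r hr => ((hmem r).1 hr).2
  have hsI : s ∈ D.commonInterval (j + 1) s s' := (hmem s).2 ⟨h.mem_left, hs⟩
  have hIsgn : ∀ r ∈ D.commonInterval (j + 1) s s', D.sgn r = 1 := fun r hr =>
    h.sgn r ((hmem r).1 hr).1
  have hIconv : ∀ r ∈ D.commonInterval (j + 1) s s', ∀ q ∈ D.commonInterval (j + 1) s s',
      ∀ p ∈ D.alive (j + 1), r < p → p < q → p ∈ D.commonInterval (j + 1) s s' := by
    intro r hr q hq p hp hrp hpq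
    exact (hmem p).2 ⟨h.conv r ((hmem r).1 hr).1 q ((hmem q).1 hq).1 p (hsub hp) hrp hpq, hp⟩
  have hrel_mem : ∀ p q, D.PRel s s' (j + 1) p q →
      p ∈ D.commonInterval (j + 1) s s' ∧ q ∈ D.commonInterval (j + 1) s s' := fun p q hpq =>
    ⟨((hrel p q).1 hpq).1, ((hrel p q).1 hpq).2.1⟩
  have hclass : ∀ p ∈ D.commonInterval (j + 1) s s', ∀ q, q ∈ D.PClass (j + 1) s s' p ↔
      q ∈ K p ∧ D.sigmaEnt (D.effFlux (j + 1) s) (K p) p =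
        D.sigmaEnt (D.effFlux (j + 1) s) (K p) q := by
    intro p hp q
    rw [PClass, Finset.mem_filter, hrel, hmemK]
    constructor
    · rintro ⟨h1, h2, h3, h4, h5⟩
      exact ⟨⟨hIsub h1, h4⟩, h5⟩
    · rintro ⟨⟨h1, h2⟩, h3⟩
      have h4 := hKI p q ((hmemK p q).2 ⟨h1, h2⟩)
      exact ⟨h4, hp, h4, h2, h3⟩
  have hmono : ∀ p ∈ D.commonInterval (j + 1) s s', ∀ q ∈ K p, ∀ r ∈ K p, q < r →
      D.sigmaEnt (D.effFlux (j + 1) s) (K p) q ≤ D.sigmaEnt (D.effFlux (j + 1) s) (K p) r := by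
    intro p hp q hq r hr hqr
    obtain ⟨a, b, hab⟩ := hKb p hp
    exact hab.sigmaEnt_mono (Or.inl rfl) hε _ hq hr hqr
  refine ⟨hIsub, hsI, hIsgn, hIconv, hrel_mem, ?_, ?_, ?_, ?_, ?_, ?_, ?_⟩
  · exact fun p hp => (hrel p p).2 ⟨hp, hp, h.rel_refl p ((hmem p).1 hp).1, rfl⟩
  · intro p q hpq
    obtain ⟨h1, h2, h3, h4⟩ := (hrel p q).1 hpq
    refine (hrel q p).2 ⟨h2, h1, h.rel_symm _ _ h3, ?_⟩
    change D.sigmaEnt _ (K q) q = D.sigmaEnt _ (K q) p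
    rw [← hKeq p q h3]
    exact h4.symm
  · intro p q r hpq hqr
    obtain ⟨h1, h2, h3, h4⟩ := (hrel p q).1 hpq
    obtain ⟨h5, h6, h7, h8⟩ := (hrel q r).1 hqr
    refine (hrel p r).2 ⟨h1, h6, h.rel_trans _ _ _ h3 h7, h4.trans ?_⟩
    change D.sigmaEnt _ (K p) q = D.sigmaEnt _ (K p) r
    rw [hKeq p q h3]
    exact h8
  · intro p q r hpr hq hpq hqr
    obtain ⟨h1, h2, h3, h4⟩ := (hrel p r).1 hpr
    have h5 := h.rel_conv _ _ _ h3 ((hmem q).1 hq).1 hpq hqr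
    have hqK : q ∈ K p := (hmemK p q).2 ⟨hIsub hq, h5⟩
    have hrK : r ∈ K p := (hmemK p r).2 ⟨hIsub h2, h3⟩
    refine (hrel p q).2 ⟨h1, hq, h5, ?_⟩
    exact le_antisymm (hmono p h1 p (hKself p h1) q hqK hpq)
      ((hmono p h1 q hqK r hrK hqr).trans h4.ge)
  · intro p q hpq
    obtain ⟨h1, h2, h3, h4⟩ := (hrel p q).1 hpq
    have hposq : D.pos (j + 1) p = D.pos (j + 1) q :=
      pos_succ_eq_of_not_divided (h.joined _ _ h3)
    rw [Divided, not_not, Prod.mk.injEq]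
    refine ⟨hposq, ?_⟩
    obtain ⟨a, b, hab⟩ := hKb p h1
    obtain ⟨m, n, hmn⟩ := hinv.block_at hε H.datum_w (hIsub h1)
    rw [hIsgn p h1] at hmn
    obtain ⟨m', n', hcomp⟩ := comp_block H hbin hs (hIsgn s hsI)
    have hKpos : ∀ r ∈ K p, D.pos (j + 1) r = D.pos (j + 1) p := fun r hr =>
      (pos_succ_eq_of_not_divided (h.joined _ _ ((hmemK p r).1 hr).2)).symm
    -- `K p` sits at one position, so on it the effective flux is `f(·, v)` up to an affine
    -- function. The true Riemann problem there contains `K p`, hence does not divide `p` and `q`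
    -- either.
    obtain ⟨α, β, haff⟩ := exists_affine_effFlux H.flux hε hcomp hab
      (fun r hr => subset_comp hIsub hsI hIsgn hIconv (hKI p r hr))
      (v := D.v (D.time (j + 1)) (D.pos (j + 1) p)) fun r hr => by rw [hKpos r hr]
    have h5 := hab.sigmaEnt_eq_of_subset hε hmn (fun r hr => Finset.mem_filter.2
      ⟨((hmemK p r).1 hr).1, hKpos r hr⟩) haff (hKself p h1)
      ((hmemK p q).2 ⟨hIsub h2, h3⟩) h4
    rw [speed, speed, speedIn, speedIn]
    have h6 : (D.state (j + 1)).pos q = (D.state (j + 1)).pos p := hposq.symm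
    rw [h6]
    exact h5
  · intro p hp
    obtain ⟨a, b, hab⟩ := hKb p hp
    exact (hab.class_spec hε _ (hKself p hp) (hclass p hp)).2
  · intro p hp p' hp' hlt _
    obtain ⟨a₁, b₁, hab₁⟩ := hKb p hp
    obtain ⟨a₂, b₂, hab₂⟩ := hKb p' hp'
    rw [(hab₁.class_spec hε _ (hKself p hp) (hclass p hp)).1,
      (hab₂.class_spec hε _ (hKself p' hp') (hclass p' hp')).1]
    -- In the same old class both speeds are slopes of one convex envelope, and the difference is
    -- nonpositive.
    by_cases hn : D.PRel s s' j p p'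
    · rw [← hKeq p p' hn]
      have h1 := hmono p hp p (hKself p hp) p' ((hmemK p p').2 ⟨hIsub hp', hn⟩) hlt
      have h2 := D.weight_nonneg hε s s' p p' (j + 1)
      linarith
    · obtain ⟨hpI, hpa⟩ := (hmem p).1 hp
      obtain ⟨hpI', hpa'⟩ := (hmem p').1 hp'
      obtain ⟨mI, nI, hI⟩ := h.interval_block H hbin'
      obtain ⟨mJ, nJ, hJ⟩ := hinv.block hε H.datum_w (Or.inl rfl) hIsub ⟨s, hsI⟩ hIsgn hIconv
      obtain ⟨a, b, hab⟩ := h.class_block H hbin' hpI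
      obtain ⟨a', b', hab'⟩ := h.class_block H hbin' hpI'
      have hcl := h.classes_lt hpI hlt hn
      have hpC := h.mem_PClass.2 (h.rel_refl p hpI)
      have hpC' := h.mem_PClass.2 (h.rel_refl p' hpI')
      have hCI : ∀ q r, r ∈ D.PClass j s s' q → r ∈ D.commonInterval j s s' := fun q r hr =>
        (h.rel_mem _ _ (h.mem_PClass.1 hr)).2
      have hKC : ∀ q, K q ⊆ D.PClass j s s' q := fun q r hr =>
        h.mem_PClass.2 ((hmemK q r).1 hr).2
      have hbetween : ∀ r ∈ D.alive j, p ≤ r → r ≤ p' → r ∈ D.commonInterval j s s' := by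
        intro r hr h1 h2
        rcases eq_or_lt_of_le h1 with rfl | h1
        · exact hpI
        rcases eq_or_lt_of_le h2 with rfl | h2
        · exact hpI'
        exact h.conv p hpI p' hpI' r hr h1 h2
      -- All waves between `p` and `p'` are positive and survive, so cancellation can erode `K p`
      -- only from the left and `K p'` only from the right.
      have hsurv : ∀ r ∈ D.commonInterval j s s', p ≤ r → r ≤ p' → r ∈ D.alive (j + 1) :=
        fun r hr h1 h2 => alive_of_between H hbin hpa hpa' hlt.le
          (fun q hq h3 h4 => h.sgn q (hbetween q hq h3 h4)) (h.sub hr) h1 h2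
      have hle₁ := hab.le_of_subset hab₁ (hKC p)
      have hle₂ := hab'.le_of_subset hab₂ (hKC p')
      have hlt₁ := hab.lt
      have hlt₂ := hab'.lt
      -- `r` is the last wave of the old class of `p` and `r'` the first of that of `p'`. Both lie
      -- between `p` and `p'` and survive, which fixes the inner ends: `b₁ = b`, `a₂ = a'`.
      obtain ⟨r, hr, hrc⟩ := hab.exists_cell_eq (k := b - 1) (by omega) (by omega)
      obtain ⟨r', hr', hrc'⟩ := hab'.exists_cell_eq (k := a') le_rfl (by omega)
      have hpr : p ≤ r := by
        rw [← hab.cell_le hpC hr]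
        have := hab.cell_mem hpC
        omega
      have hrp' : r' ≤ p' := by
        rw [← hab'.cell_le hr' hpC']
        have := hab'.cell_mem hpC'
        omega
      have hbb : b₁ = b := by
        have h1 : r ∈ K p := (hmemK p r).2
          ⟨hsurv r (hCI p r hr) hpr (hcl r hr p' hpC').le, h.mem_PClass.1 hr⟩
        have := hab₁.cell_mem h1
        omega
      have haa : a₂ = a' := by
        have h1 : r' ∈ K p' := (hmemK p' r').2
          ⟨hsurv r' (hCI p' r' hr') (hcl p hpC r' hr').le hrp', h.mem_PClass.1 hr'⟩
        have := hab₂.cell_mem h1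
        omega
      subst hbb haa
      have hba : b₁ ≤ a₂ := by
        have := (hI.cell_lt (hCI p r hr) (hCI p' r' hr')).2 (hcl r hr r' hr')
        omega
      obtain ⟨c, hc, hcb, hlast⟩ := hab₁.exists_last_class hε (D.effFlux (j + 1) s) (hKself p hp)
      obtain ⟨d, hd, hdb, hfirst⟩ :=
        hab₂.exists_first_class hε (D.effFlux (j + 1) s) (hKself p' hp')
      have hJ₁ := hJ.le_of_subset hab₁ fun q hq => hKI p q hq
      have hJ₂ := hJ.le_of_subset hab₂ fun q hq => hKI p' q hq
      -- `A` also contains the classes between those of `p` and `p'`: the comparison of derivatives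
      -- runs across the whole gap.
      set A := (D.commonInterval (j + 1) s s').filter fun q => c ≤ D.cell q ∧ D.cell q < d with hAdef
      have hA : D.Block 1 A c d := by
        refine hJ.of_image (Finset.filter_subset _ _) (by omega) ?_
        ext k
        rw [Finset.mem_image, Finset.mem_Ico]
        constructor
        · rintro ⟨q, hq, rfl⟩
          exact (Finset.mem_filter.1 hq).2
        · rintro ⟨h1, h2⟩
          obtain ⟨q, hq, rfl⟩ := hJ.exists_cell_eq (k := k) (by omega) (by omega)
          exact ⟨q, Finset.mem_filter.2 ⟨hq, h1, h2⟩, rfl⟩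
      have hAI : ∀ q ∈ A, q ∈ D.commonInterval j s s' := fun q hq =>
        ((hmem q).1 (Finset.mem_filter.1 hq).1).1
      obtain ⟨m, n, hmn⟩ := comp_block H hbin' (hsub hs) (hIsgn s hsI)
      obtain ⟨m', n', hmn'⟩ := comp_block H hbin hs (hIsgn s hsI)
      have hchord₁ := h.chord p hpI a b₁ hab c (by omega) hcb.le
      have hchord₂ := h.chord p' hpI' a₂ b' hab' d hd.le (by omega)
      have hrh := hab.sigmaRH_eq hε (D.effFlux j s)
      -- The chord of the old class lies below the flux at `c` and meets it at `b₁`, so the mean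
      -- slope over `[c, b₁]` is at most the old speed; `hy` is the mirror statement on `[a₂, d]`.
      have hx : D.effFlux j s (b₁ * D.ε) - D.effFlux j s (c * D.ε) ≤
          D.sigmaRH (D.effFlux j s) (D.PClass j s s' p) * (b₁ * D.ε - c * D.ε) := by
        rw [eq_div_iff (sub_pos.2 (hab.grid_lt hε)).ne'] at hrh
        linarith
      have hy : D.sigmaRH (D.effFlux j s) (D.PClass j s s' p') * (d * D.ε - a₂ * D.ε) ≤
          D.effFlux j s (d * D.ε) - D.effFlux j s (a₂ * D.ε) := by
        linarith
      have hV : 0 ≤ D.vStrength (D.collPoint j + D.time (j + 1)) := abs_nonneg _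
      have hslope := slope_sub_slope_le H hmn hmn' hA
        (R := A.filter fun q => D.pos (j + 1) q = D.collPoint j)
        (fun q hq => h.interval_subset_comp (hAI q hq))
        (fun q hq => subset_comp hIsub hsI hIsgn hIconv (Finset.mem_filter.1 hq).1)
        hV
        (fun q hq hqR => (abs_v_succ_sub H hbin (h.sub (hAI q hq)) (Finset.mem_filter.1 hqR).2).le)
        (fun q hq hqR => v_succ_eq H hbin (h.sub (hAI q hq))
          fun heq => hqR (Finset.mem_filter.2 ⟨hq, heq⟩)) hcb hba hd hx hy
      -- A wave of `A` to the left of `p` still belongs to the old class of `p`, because its cell is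
      -- not before the left end of that class; similarly on the right of `p'`.
      have hweight := h.card_le_weight H hbin hdiv hpI (p' := p')
        (R := A.filter fun q => D.pos (j + 1) q = D.collPoint j) fun q hq => by
          obtain ⟨hqA, hqc⟩ := Finset.mem_filter.1 hq
          have hqI := hAI q hqA
          obtain ⟨hq1, hq2⟩ := (Finset.mem_filter.1 hqA).2
          refine ⟨hqI, hqc, ?_, ?_⟩
          · by_contra! hcon
            rcases eq_or_lt_of_le hcon.2 with rfl | hqp
            · exact hcon.1 (h.rel_refl q hpI)
            obtain ⟨u, hu, huc⟩ := hab.exists_cell_eq (k := a) le_rfl (by omega)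
            have huq : u ≤ q := by
              rw [← hI.cell_le (hCI p u hu) hqI]
              omega
            have hup := h.mem_PClass.1 hu
            rcases eq_or_lt_of_le huq with rfl | huq
            · exact hcon.1 hup
            exact hcon.1 (h.rel_trans _ _ _ hup
              (h.rel_conv _ _ _ (h.rel_symm _ _ hup) hqI huq hqp))
          · by_contra! hcon
            rcases eq_or_lt_of_le hcon.2 with rfl | hqp
            · exact hcon.1 (h.rel_refl _ hpI')
            obtain ⟨u, hu, huc⟩ := hab'.exists_cell_eq (k := b' - 1) (by omega) (by omega)
            have huq : q ≤ u := by
              rw [← hI.cell_le hqI (hCI p' u hu)]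
              omega
            have hup := h.mem_PClass.1 hu
            rcases eq_or_lt_of_le huq with rfl | huq
            · exact hcon.1 (h.rel_symm _ _ hup)
            exact hcon.1 (h.rel_symm _ _ (h.rel_conv _ _ _ hup hqI hqp huq))
      have hIH := h.ineq p hpI p' hpI' hlt hn
      linarith

/-- The induction descends to a time when `s`, `s'` share a position; at time `0`, having interacted
means exactly that. -/
theorem of_divided (H : D.Standing) (hbin : ∀ i < j, D.BinaryCollision i)
    (hs : s ∈ D.alive j) (hs' : s' ∈ D.alive j) (hsgn : D.sgn s = 1)
    (hint : D.AlreadyInteracted j s s') : D.Good j s s' := by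
  induction j with
  | zero =>
    refine of_pos_eq H hbin hs hsgn ?_
    by_contra hpos
    obtain ⟨t, ht, htt⟩ := hint
    have : t ∈ D.meetings 0 s s' := ⟨ht, htt⟩
    rw [meetings_zero hpos] at this
    exact this
  | succ j ih =>
    by_cases hpos : D.pos (j + 1) s = D.pos (j + 1) s'
    · exact of_pos_eq H hbin hs hsgn hpos
    · have hsub := alive_succ_subset (D := D) j
      have hint' := alreadyInteracted_of_succ H (hbin j (by omega)) (hsub hs) (hsub hs') hpos hint
      exact (ih (fun i hi => hbin i (by omega)) (hsub hs) (hsub hs') hint').succ H hbin hs hs' hpos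
        hint'

end Good

end WaveData

end

/-! ### Passage to an arbitrary effective flux -/

theorem mainTheorem6 (D : WaveData)
    -- standing assumptions on the parameter, the flux and the initial data
    (hε : 0 < D.ε)
    (hf : ContDiff ℝ 3 (fun z : ℝ × ℝ => D.f z.1 z.2))
    (hfb : ∃ C : ℝ, ∀ w v : ℝ, |D.dwwv w v| ≤ C)
    (hw : IsGridDatum D.ε D.w0)
    (hv : IsGridDatum D.ε D.v0)
    (hyp : ∀ w ∈ convexHull ℝ (Set.range D.w0), ∀ v ∈ Set.range D.v0,
      -1 < deriv (fun x => D.f x v) w)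
    -- the first `j` collisions exist and are binary
    (j : ℕ) (hbin : ∀ i < j, D.BinaryCollision i)
    -- the waves `s < s'`
    (s s' : ℕ) (hs : s ∈ D.alive j) (hs' : s' ∈ D.alive j) (hlt : s < s')
    (hpos : D.sgn s = 1) (hpos' : D.sgn s' = 1)
    (hint : D.AlreadyInteracted j s s') (hdiv : D.Divided j s s')
    -- any effective flux at time `t_j`, on the maximal homogeneous interval containing `s, s'`
    (feff : ℝ → ℝ) (hfeff : D.IsEffectiveFlux j s feff)
    -- the elements of the partition
    (J J' : Finset ℕ) (hJ : J ∈ D.P j s s') (hJ' : J' ∈ D.P j s s') (hJJ' : WavesLT J J')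
    (p p' : ℕ) (hp : p ∈ J) (hp' : p' ∈ J') :
    D.sigmaRH feff J - D.sigmaRH feff J' ≤ D.weight s s' p p' j := by
  have H : D.Standing := ⟨hε, hf, hfb, hw, hv, hyp⟩
  have h := WaveData.Good.of_divided H hbin hs hs' hpos hint
  obtain ⟨r, hr, rfl⟩ := Finset.mem_image.1 hJ
  obtain ⟨r', hr', rfl⟩ := Finset.mem_image.1 hJ'
  have hrp := h.mem_PClass.1 hp
  have hrp' := h.mem_PClass.1 hp'
  have hpI := (h.rel_mem _ _ hrp).2
  have hpI' := (h.rel_mem _ _ hrp').2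
  rw [h.PClass_eq hrp] at hp hJJ' ⊢
  rw [h.PClass_eq hrp'] at hp' hJJ' ⊢
  have hn : ¬ D.PRel s s' j p p' := fun hpp =>
    lt_irrefl p' (hJJ' p' (h.mem_PClass.2 hpp) p' hp')
  have hmain := h.ineq p hpI p' hpI' (hJJ' p hp p' hp') hn
  obtain ⟨m, n, hcomp⟩ := WaveData.comp_block H hbin hs hpos
  obtain ⟨α, β, haff⟩ := hfeff.exists_affine hf hε hcomp
  -- An affine correction of the flux shifts every Rankine-Hugoniot speed by the same `β`, which
  -- cancels in the difference.
  have hshift : ∀ q ∈ D.commonInterval j s s', D.sigmaRH feff (D.PClass j s s' q) =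
      D.sigmaRH (D.effFlux j s) (D.PClass j s s' q) + β := by
    intro q hq
    obtain ⟨a, b, hab⟩ := h.class_block H hbin hq
    have hsub : D.PClass j s s' q ⊆ D.comp j s :=
      fun u hu => h.interval_subset_comp (h.rel_mem _ _ (h.mem_PClass.1 hu)).2
    obtain ⟨h1, h2⟩ := hcomp.le_of_subset hab hsub
    have h3 := hab.lt
    have h4 := sub_pos.2 (hab.grid_lt hε)
    rw [hab.sigmaRH_eq hε, hab.sigmaRH_eq hε, haff _ (grid_mem_Icc hε h1 (by omega)),
      haff _ (grid_mem_Icc hε (by omega) h2)]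
    rw [div_eq_iff h4.ne', add_mul, div_mul_cancel₀ _ h4.ne']
    ring
  rw [hshift p hpI, hshift p' hpI']
  linarith
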